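/- Let $H_1=\mathbb R^2_{x,y}\times\mathbb R_t$ be the Heisenberg group with law $(x,y,t)(x',y',t')=(x+x',y+y',t+t'+\frac{xy'-x'y}{2})$, let $X=\partial_x-\frac y2\partial_t$, $Y=\partial_y+\frac x2\partial_t$ be its canonical left-invariant vector fields and $L=-(X^2+Y^2)$. Fix $\lambda_2\neq 0$ and consider $A=L+\lambda_2^2(x^2+y^2)$ as an unbounded operator on $L^2(H_1)$ (Lebesgue measure), with domain the set of $f\in L^2(H_1)$ such that $(L+\lambda_2^2(x^2+y^2))f$, taken in the sense of distributions, is in $L^2(H_1)$. For $\lambda=(\lambda_1,\lambda_2)$, $\lambda_1\in\mathbb R$, and $m=(m_+,m_-)\in\mathbb N^2$ put $$\mu_{\pm,\lambda}=\tfrac12\Big(\lambda_1^2+2\lambda_2^2\pm|\lambda_1|\sqrt{\lambda_1^2+4\lambda_2^2}\Big),\qquad \nu_{\lambda,m}=\mu_{+,\lambda}^{1/2}(2m_++1)+\mu_{-,\lambda}^{1/2}(2m_-+1).$$ For $\lambda_1\ne0$ let $k_\lambda$ be the orthogonal $2\times2$ matrix whose two columns are the vectors $\big(\lambda_1\lambda_2,\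 \tfrac12(\lambda_1^2\mp|\lambda_1|\sqrt{\lambda_1^2+4\lambda_2^2})\big)^t$ (upper sign for the first column, lower sign for the second), each divided by its Euclidean norm, and let $k_\lambda$ be the identity for $\lambda_1=0$; thus $$k_\lambda^{-1}\begin{pmatrix}\lambda_1^2+\lambda_2^2&-\lambda_1\lambda_2\\-\lambda_1\lambda_2&\lambda_2^2\end{pmatrix}k_\lambda=\operatorname{diag}(\mu_{+,\lambda},\mu_{-,\lambda}).$$ With $h_n(s)=(2^nn!\sqrt\pi)^{-1/2}e^{-s^2/2}H_n(s)$, $H_n(s)=(-1)^ne^{s^2}\frac{d^n}{ds^n}e^{-s^2}$, the $L^2$-normalised Hermite functions, let $$h_{\lambda,m}(u)=|\lambda_2|^{1/2}\,h_{m_+}(\mu_{+,\lambda}^{1/4}u_1')\,h_{m_-}(\mu_{-,\lambda}^{1/4}u_2'),\quad u'=k_\lambda^{-1}u,\qquad T_\lambda h(x,y)=\sqrt{\tfrac{|\lambda_2|}{2\pi}}\,e^{i\lambda_1xy/2}\int_{\mathbb R}e^{-i\lambda_2yz}h(x,z)\,dz.$$ Let $\mathcal F_{\lambda_1}f(x,y)=\int_{\mathbb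 R}e^{-i\lambda_1t}f(x,y,t)\,dt$ be the Fourier transform in the central variable, extended to $L^2(H_1)$ (as the limit in $L^2$ of the integrals over $[-R,R]$ as $R\to\infty$), and set $c_{\lambda,m}(f)=\big(\mathcal F_{\lambda_1}f,\,T_\lambda h_{\lambda,m}\big)_{L^2(\mathbb R^2)}$, where $(g,h)_{L^2(\mathbb R^2)}=\int g\bar h$. Then: 1. $A$ is self-adjoint. For every Borel set $B\subset\mathbb R$ there is a unique bounded operator $E(B)$ on $L^2(H_1)$ with $$\mathcal F_{\lambda_1}\big(E(B)f\big)=\sum_{m\in\mathbb N^2}1_{\nu_{\lambda,m}\in B}\;c_{\lambda,m}(f)\;T_\lambda h_{\lambda,m}\qquad(f\in L^2(H_1)),$$ the series of functions of $(x,y,\lambda_1)$ converging unconditionally in $L^2(\mathbb R^3)$. 2. $B\mapsto E(B)$ is the spectral resolution of $A$: it is a projection-valued measure and $A=\int_{\mathbb R}s\,dE(s)$, i.e. $f$ is in the domain of $A$ if and only if $\int s^2\,d(E(s)f,f)<\infty$, and then $(Af,f)=\int s\,d(E(s)f,f)$. 3. The spectrum of $A$ is $$\{\nu_{(\lambda_1,\lambda_2),m}:\lambda_1\in\mathbb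 R,\ m\in\mathbb N^2\}=[\nu_{(0,\lambda_2),0},+\infty),\qquad \nu_{(0,\lambda_2),0}=2|\lambda_2|.$$ -/

import Mathlib

open MeasureTheory Filter Topology
open scoped ContDiff InnerProductSpace ENNReal ComplexConjugate

noncomputable section

/-! ### Unbounded operators: spectrum, and spectral resolutions -/

section Abstract

variable {H : Type*} [NormedAddCommGroup H] [InnerProductSpace ℂ H]

/-- The resolvent set of an unbounded operator `A`: those `z` for which `A - z` is a bijection
from the domain of `A` onto `H` with bounded inverse `R`. -/
def resolventSetPMap (A : H →ₗ.[ℂ] H) : Set ℂ :=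
  {z | ∃ R : H →L[ℂ] H,
    (∀ f : H, ∃ hf : R f ∈ A.domain, A ⟨R f, hf⟩ - z • R f = f) ∧
    (∀ f : A.domain, R (A f - z • (f : H)) = f)}

/-- The spectrum of an unbounded operator: the complement of its resolvent set. -/
def spectrumPMap (A : H →ₗ.[ℂ] H) : Set ℂ := (resolventSetPMap A)ᶜ

variable [CompleteSpace H]

/-- Projection-valued measures on the Borel sets of the line: each `E B` is an orthogonal
projection, and `B ↦ E B` is strongly countably additive, multiplicative and normalised. -/
structure IsProjValuedMeasure (E : Set ℝ → (H →L[ℂ] H)) : Prop where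
  proj : ∀ B, MeasurableSet B → IsStarProjection (E B)
  empty : E ∅ = 0
  univ : E Set.univ = 1
  inter : ∀ B C, MeasurableSet B → MeasurableSet C → E (B ∩ C) = E B * E C
  iUnion : ∀ B : ℕ → Set ℝ, (∀ n, MeasurableSet (B n)) → Pairwise (Function.onFun Disjoint B) →
    ∀ f, HasSum (fun n => E (B n) f) (E (⋃ n, B n) f)

theorem IsProjValuedMeasure.re_inner_nonneg {E : Set ℝ → (H →L[ℂ] H)}
    (hE : IsProjValuedMeasure E) (f : H) {B : Set ℝ} (hB : MeasurableSet B) :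
    0 ≤ (⟪f, E B f⟫_ℂ).re := by
  have hp := hE.proj B hB
  have h1 : E B f = E B (E B f) := by
    conv_lhs => rw [← hp.isIdempotentElem.eq]
    rfl
  have h2 : ContinuousLinearMap.adjoint (E B) = E B := hp.isSelfAdjoint
  have h3 : ⟪f, E B f⟫_ℂ = ⟪E B f, E B f⟫_ℂ := by
    rw [← ContinuousLinearMap.adjoint_inner_right, h2, ← h1]
  rw [h3]
  exact inner_self_nonneg (𝕜 := ℂ) (x := E B f)

/-- The scalar spectral measure `B ↦ ⟨E(B) f, f⟩` of a vector `f`. -/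
def IsProjValuedMeasure.measure {E : Set ℝ → (H →L[ℂ] H)} (hE : IsProjValuedMeasure E) (f : H) :
    Measure ℝ :=
  Measure.ofMeasurable (fun B _ => ENNReal.ofReal (⟪f, E B f⟫_ℂ).re)
    (by simp [hE.empty])
    (by
      intro B hB hd
      have h1 := hE.iUnion B hB hd f
      have h2 : HasSum (fun n => (⟪f, E (B n) f⟫_ℂ).re) (⟪f, E (⋃ n, B n) f⟫_ℂ).re :=
        Complex.reCLM.hasSum ((innerSL ℂ f).hasSum h1)
      rw [← h2.tsum_eq]
      exact ENNReal.ofReal_tsum_of_nonneg (fun n => hE.re_inner_nonneg f (hB n)) h2.summable)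

/-- `E` is the spectral resolution of the unbounded operator `A`: it is a projection-valued measure
and `A = ∫ s dE(s)`, that is, the domain of `A` consists of the `f` with
`∫ s² d⟨E(s) f, f⟩ < ∞`, and `⟨A f, f⟩ = ∫ s d⟨E(s) f, f⟩` on the domain. -/
def IsSpectralResolution (E : Set ℝ → (H →L[ℂ] H)) (A : H →ₗ.[ℂ] H) : Prop :=
  ∃ hE : IsProjValuedMeasure E,
    (∀ f : H, f ∈ A.domain ↔ ∫⁻ s, ENNReal.ofReal (s ^ 2) ∂(hE.measure f) < ⊤) ∧
    (∀ f : A.domain, ⟪(f : H), A f⟫_ℂ = ((∫ s, s ∂(hE.measure (f : H)) : ℝ) : ℂ))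

end Abstract

/-! ### The Heisenberg group and the Heisenberg oscillator -/

/-- The underlying space of the Heisenberg group, with points `((x, y), t)`. Its Haar measure is
Lebesgue measure. -/
abbrev Heis : Type := (ℝ × ℝ) × ℝ

/-- The group law `(x,y,t)(x',y',t') = (x+x', y+y', t+t'+(xy'-x'y)/2)`. -/
def heisMul (p q : Heis) : Heis :=
  ((p.1.1 + q.1.1, p.1.2 + q.1.2), p.2 + q.2 + (p.1.1 * q.1.2 - q.1.1 * p.1.2) / 2)

/-- The left-invariant vector field `X`. -/
def heisX (φ : Heis → ℂ) (p : Heis) : ℂ :=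
  deriv (fun s : ℝ => φ (heisMul p ((s, 0), 0))) 0

/-- The left-invariant vector field `Y`. -/
def heisY (φ : Heis → ℂ) (p : Heis) : ℂ :=
  deriv (fun s : ℝ => φ (heisMul p ((0, s), 0))) 0

/-- The differential expression `L + κ² (x² + y²)` with the sublaplacian `L = -(X² + Y²)`. -/
def heisOscExpr (κ : ℝ) (φ : Heis → ℂ) (p : Heis) : ℂ :=
  -(heisX (heisX φ) p + heisY (heisY φ) p) + ((κ ^ 2 * (p.1.1 ^ 2 + p.1.2 ^ 2) : ℝ) : ℂ) * φ p

/-- Smooth compactly supported functions on the Heisenberg group. -/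
def IsTestFun (φ : Heis → ℂ) : Prop := ContDiff ℝ ∞ φ ∧ HasCompactSupport φ

theorem heisX_eq {φ : Heis → ℂ} (hφ : ContDiff ℝ ∞ φ) (p : Heis) :
    heisX φ p = fderiv ℝ φ p ((1, 0), -(p.1.2 / 2)) := by
  have hd : HasFDerivAt φ (fderiv ℝ φ p) p := (hφ.differentiable (by simp) p).hasFDerivAt
  have hp : heisMul p (((0 : ℝ), 0), 0) = p := by simp [heisMul]
  have hc : HasDerivAt (fun s : ℝ => heisMul p ((s, 0), 0)) ((1, 0), -(p.1.2 / 2)) 0 := by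
    have h1 : HasDerivAt (fun s : ℝ => p.1.1 + s) 1 0 := by
      simpa using (hasDerivAt_id (0 : ℝ)).const_add p.1.1
    have h2 : HasDerivAt (fun _ : ℝ => p.1.2 + 0) 0 (0 : ℝ) := hasDerivAt_const _ _
    have h3 : HasDerivAt (fun s : ℝ => p.2 + 0 + (p.1.1 * 0 - s * p.1.2) / 2)
        (-(p.1.2 / 2)) 0 := by
      have := ((((hasDerivAt_id (0 : ℝ)).mul_const p.1.2).const_sub (p.1.1 * 0)).div_const
        2).const_add (p.2 + 0)
      convert! this using 1
      ring
    exact (h1.prodMk h2).prodMk h3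
  rw [← hp] at hd
  have := hd.comp_hasDerivAt (0 : ℝ) hc
  rw [hp] at this
  exact this.deriv

theorem heisY_eq {φ : Heis → ℂ} (hφ : ContDiff ℝ ∞ φ) (p : Heis) :
    heisY φ p = fderiv ℝ φ p ((0, 1), p.1.1 / 2) := by
  have hd : HasFDerivAt φ (fderiv ℝ φ p) p := (hφ.differentiable (by simp) p).hasFDerivAt
  have hp : heisMul p (((0 : ℝ), 0), 0) = p := by simp [heisMul]
  have hc : HasDerivAt (fun s : ℝ => heisMul p ((0, s), 0)) ((0, 1), p.1.1 / 2) 0 := by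
    have h1 : HasDerivAt (fun s : ℝ => p.1.2 + s) 1 0 := by
      simpa using (hasDerivAt_id (0 : ℝ)).const_add p.1.2
    have h2 : HasDerivAt (fun _ : ℝ => p.1.1 + 0) 0 (0 : ℝ) := hasDerivAt_const _ _
    have h3 : HasDerivAt (fun s : ℝ => p.2 + 0 + (p.1.1 * s - 0 * p.1.2) / 2)
        (p.1.1 / 2) 0 := by
      have := ((((hasDerivAt_id (0 : ℝ)).const_mul p.1.1).sub_const (0 * p.1.2)).div_const
        2).const_add (p.2 + 0)
      convert! this using 1
      ring
    exact (h2.prodMk h1).prodMk h3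
  rw [← hp] at hd
  have := hd.comp_hasDerivAt (0 : ℝ) hc
  rw [hp] at this
  exact this.deriv

theorem IsTestFun.heisX {φ : Heis → ℂ} (hφ : IsTestFun φ) : IsTestFun (heisX φ) := by
  have h : _root_.heisX φ = fun p => fderiv ℝ φ p ((1, 0), -(p.1.2 / 2)) :=
    funext (heisX_eq hφ.1)
  refine ⟨?_, ?_⟩
  · rw [h]
    exact (hφ.1.fderiv_right (m := ∞) (by simp)).clm_apply (by fun_prop)
  · refine (hφ.2.fderiv (𝕜 := ℝ)).mono fun p hp => ?_
    rw [h] at hp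
    intro h0
    exact hp (by simp [h0])

theorem IsTestFun.heisY {φ : Heis → ℂ} (hφ : IsTestFun φ) : IsTestFun (heisY φ) := by
  have h : _root_.heisY φ = fun p => fderiv ℝ φ p ((0, 1), p.1.1 / 2) :=
    funext (heisY_eq hφ.1)
  refine ⟨?_, ?_⟩
  · rw [h]
    exact (hφ.1.fderiv_right (m := ∞) (by simp)).clm_apply (by fun_prop)
  · refine (hφ.2.fderiv (𝕜 := ℝ)).mono fun p hp => ?_
    rw [h] at hp
    intro h0
    exact hp (by simp [h0])

theorem IsTestFun.heisOscExpr (κ : ℝ) {φ : Heis → ℂ} (hφ : IsTestFun φ) :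
    IsTestFun (heisOscExpr κ φ) := by
  have hx := hφ.heisX.heisX
  have hy := hφ.heisY.heisY
  refine ⟨?_, ?_⟩
  · have hV : ContDiff ℝ ∞ (fun p : Heis => ((κ ^ 2 * (p.1.1 ^ 2 + p.1.2 ^ 2) : ℝ) : ℂ)) :=
      by
      have h0 : ContDiff ℝ ∞ (fun p : Heis => κ ^ 2 * (p.1.1 ^ 2 + p.1.2 ^ 2)) := by fun_prop
      exact Complex.ofRealCLM.contDiff.comp h0
    exact (hx.1.add hy.1).neg.add (hV.mul hφ.1)
  · have h1 : HasCompactSupport (-(_root_.heisX (_root_.heisX φ) +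
        _root_.heisY (_root_.heisY φ))) := by
      refine (hx.2.add hy.2).mono ?_
      rw [Function.support_neg]
    exact h1.add (hφ.2.mul_left (f := fun p : Heis =>
      ((κ ^ 2 * (p.1.1 ^ 2 + p.1.2 ^ 2) : ℝ) : ℂ)))

theorem IsTestFun.integrable_mul {φ : Heis → ℂ} (hφ : IsTestFun φ)
    (f : Lp ℂ 2 (volume : Measure Heis)) : Integrable (fun p => f p * φ p) volume :=
  MemLp.integrable_mul (p := 2) (q := 2) (Lp.memLp f)
    (hφ.1.continuous.memLp_of_hasCompactSupport hφ.2)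

/-- The set of pairs `(f, g)` of square integrable functions such that `(L + κ² (x² + y²)) f = g`
in the sense of distributions. As the vector fields `X` and `Y` are formally skew-symmetric,
`L + κ² (x² + y²)` is its own formal transpose. -/
def heisOscGraph (κ : ℝ) :
    Submodule ℂ (Lp ℂ 2 (volume : Measure Heis) × Lp ℂ 2 (volume : Measure Heis)) where
  carrier := {w | ∀ φ : Heis → ℂ, IsTestFun φ →
    ∫ p, w.1 p * heisOscExpr κ φ p = ∫ p, w.2 p * φ p}
  zero_mem' := by
    intro φ _
    have h : ∀ ψ : Heis → ℂ,
        ∫ p, (0 : Lp ℂ 2 (volume : Measure Heis)) p * ψ p = 0 := by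
      intro ψ
      refine integral_eq_zero_of_ae ?_
      filter_upwards [Lp.coeFn_zero ℂ 2 (volume : Measure Heis)] with p hp
      simp
    exact (h _).trans (h _).symm
  add_mem' := by
    intro v w hv hw φ hφ
    have h : ∀ (a b : Lp ℂ 2 (volume : Measure Heis)) (ψ : Heis → ℂ), IsTestFun ψ →
        ∫ p, (a + b) p * ψ p = (∫ p, a p * ψ p) + ∫ p, b p * ψ p := by
      intro a b ψ hψ
      rw [← integral_add (hψ.integrable_mul a) (hψ.integrable_mul b)]
      refine integral_congr_ae ?_
      filter_upwards [Lp.coeFn_add a b] with p hp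
      simp only [hp, Pi.add_apply, add_mul]
    exact (h _ _ _ (hφ.heisOscExpr κ)).trans
      ((congrArg₂ (· + ·) (hv φ hφ) (hw φ hφ)).trans (h _ _ _ hφ).symm)
  smul_mem' := by
    intro c w hw φ hφ
    have h : ∀ (a : Lp ℂ 2 (volume : Measure Heis)) (ψ : Heis → ℂ),
        ∫ p, (c • a) p * ψ p = c * ∫ p, a p * ψ p := by
      intro a ψ
      rw [← integral_const_mul]
      refine integral_congr_ae ?_
      filter_upwards [Lp.coeFn_smul c a] with p hp
      simp [hp, mul_assoc]
    exact (h _ _).trans ((congrArg (c * ·) (hw φ hφ)).trans (h _ _).symm)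

/-- The Heisenberg oscillator `L + κ² (x² + y²)` as an unbounded operator on `L²`, with domain the
`f ∈ L²` such that the distribution `(L + κ² (x² + y²)) f` is in `L²`. -/
def heisOsc (κ : ℝ) :
    Lp ℂ 2 (volume : Measure Heis) →ₗ.[ℂ] Lp ℂ 2 (volume : Measure Heis) :=
  (heisOscGraph κ).toLinearPMap

theorem heisOscGraph_functional (κ : ℝ)
    (w : Lp ℂ 2 (volume : Measure Heis) × Lp ℂ 2 (volume : Measure Heis))
    (hw : w ∈ heisOscGraph κ) (h0 : w.1 = 0) : w.2 = 0 := by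
  have hl : LocallyIntegrable (w.2 : Heis → ℂ) volume :=
    (Lp.memLp w.2).locallyIntegrable (by norm_num)
  refine (Lp.eq_zero_iff_ae_eq_zero).2
    (ae_eq_zero_of_integral_contDiff_smul_eq_zero hl fun g hg hgc => ?_)
  have hφ : IsTestFun (fun p => (g p : ℂ)) :=
    ⟨Complex.ofRealCLM.contDiff.comp hg, hgc.comp_left (g := fun r : ℝ => (r : ℂ)) (by simp)⟩
  have h1 := hw _ hφ
  have h2 : ∫ p, w.1 p * heisOscExpr κ (fun p => (g p : ℂ)) p = 0 := by
    rw [h0]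
    refine integral_eq_zero_of_ae ?_
    filter_upwards [Lp.coeFn_zero ℂ 2 (volume : Measure Heis)] with p hp
    simp
  rw [h2] at h1
  rw [h1]
  refine integral_congr_ae (ae_of_all _ fun p => ?_)
  simp [mul_comm]

theorem heisOsc_graph (κ : ℝ) : (heisOsc κ).graph = heisOscGraph κ :=
  Submodule.toLinearPMap_graph_eq _ (heisOscGraph_functional κ)

/-! ### Eigenvalues and eigenfunctions after Fourier transform in the central variable -/

/-- `μ_{ε,λ} = (λ₁² + 2 λ₂² + ε |λ₁| √(λ₁² + 4 λ₂²)) / 2`, for `ε = ±1`, `λ = (l, κ)`. -/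
def muEig (ε l κ : ℝ) : ℝ :=
  (l ^ 2 + 2 * κ ^ 2 + ε * |l| * √(l ^ 2 + 4 * κ ^ 2)) / 2

/-- `ν_{λ,m} = μ_{+,λ}^{1/2} (2 m₊ + 1) + μ_{-,λ}^{1/2} (2 m₋ + 1)`. -/
def nuEig (l κ : ℝ) (m : ℕ × ℕ) : ℝ :=
  √(muEig 1 l κ) * (2 * m.1 + 1) + √(muEig (-1) l κ) * (2 * m.2 + 1)

/-- The orthogonal matrix `k_λ` with `k_λ⁻¹ M_λ k_λ = diag (μ_{+,λ}, μ_{-,λ})`, where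
`M_λ = !![λ₁² + λ₂², -λ₁ λ₂; -λ₁ λ₂, λ₂²]`; for `λ₁ = 0` the matrix `M_λ` is scalar and the
identity is taken. -/
def kMat (l κ : ℝ) : Matrix (Fin 2) (Fin 2) ℝ :=
  if l = 0 then 1 else
    let a := (l ^ 2 - |l| * √(l ^ 2 + 4 * κ ^ 2)) / 2
    let b := (l ^ 2 + |l| * √(l ^ 2 + 4 * κ ^ 2)) / 2
    !![l * κ / √((l * κ) ^ 2 + a ^ 2), l * κ / √((l * κ) ^ 2 + b ^ 2);
       a / √((l * κ) ^ 2 + a ^ 2), b / √((l * κ) ^ 2 + b ^ 2)]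

/-- The `L²`-normalised Hermite functions on the line:
`(2ⁿ n! √π)^{-1/2} e^{-x²/2} H_n(x)` with `H_n(x) = (-1)ⁿ e^{x²} (dⁿ/dxⁿ) e^{-x²}`. -/
def hermiteFun (n : ℕ) (x : ℝ) : ℝ :=
  (√(2 ^ n * (n.factorial : ℝ) * √Real.pi))⁻¹ * Real.exp (-x ^ 2 / 2) *
    ((-1) ^ n * Real.exp (x ^ 2) * iteratedDeriv n (fun s : ℝ => Real.exp (-s ^ 2)) x)

/-- The eigenfunctions `h_{λ,m}` of `-∂₁² - ∂₂² + ⟨M_λ u, u⟩`, in the coordinates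
`u' = k_λ⁻¹ u = k_λᵀ u`. -/
def hEig (l κ : ℝ) (m : ℕ × ℕ) (u : ℝ × ℝ) : ℝ :=
  let u' := (kMat l κ).transpose.mulVec ![u.1, u.2]
  √|κ| * hermiteFun m.1 (muEig 1 l κ ^ (1 / 4 : ℝ) * u' 0) *
    hermiteFun m.2 (muEig (-1) l κ ^ (1 / 4 : ℝ) * u' 1)

/-- The operator `T_λ`:
`T h (x, y) = (|λ₂| / 2π)^{1/2} e^{i λ₁ x y / 2} ∫ e^{-i λ₂ y z} h(x, z) dz`. -/
def opT (l κ : ℝ) (h : ℝ × ℝ → ℂ) (q : ℝ × ℝ) : ℂ :=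
  (√(|κ| / (2 * Real.pi)) : ℝ) * Complex.exp (Complex.I * (l / 2 * q.1 * q.2 : ℝ)) *
    ∫ z : ℝ, Complex.exp (-Complex.I * (κ * q.2 * z : ℝ)) * h (q.1, z)

/-- The functions `T_λ h_{λ,m}` on the plane. -/
def thEig (l κ : ℝ) (m : ℕ × ℕ) : ℝ × ℝ → ℂ :=
  opT l κ (fun u => (hEig l κ m u : ℂ))

/-- `F` is the Fourier transform of `f ∈ L²` in the central variable:
`F(x,y,l) = ∫ e^{-ilt} f(x,y,t) dt`, as the limit in `L²` of the integrals over `[-R, R]`. -/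
def IsCentralFourier (f F : Lp ℂ 2 (volume : Measure Heis)) : Prop :=
  Tendsto (fun R : ℝ => eLpNorm (fun p : Heis => F p -
    ∫ t in (-R)..R, Complex.exp (-Complex.I * (p.2 * t : ℝ)) * f (p.1, t)) 2 volume) atTop (𝓝 0)

/-- The coefficient `c_{λ,m}(f) = (F_{λ₁} f, T h_{λ,m})_{L²(ℝ²)}`, as a function of the
Fourier transform `F` of `f` in the central variable. -/
def cCoeff (F : Lp ℂ 2 (volume : Measure Heis)) (l κ : ℝ) (m : ℕ × ℕ) : ℂ :=
  ∫ q : ℝ × ℝ, F (q, l) * conj (thEig l κ m q)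

open Classical in
/-- `P` is the operator `E(B)`: for all `f ∈ L²`, the Fourier transform of `P f` in the central
variable is `∑_m 1_{ν_{λ,m} ∈ B} c_{λ,m}(f) T h_{λ,m}`, the series of functions of `(x, y, λ₁)`
converging in `L²`. -/
def IsSpectralProj (κ : ℝ) (B : Set ℝ)
    (P : Lp ℂ 2 (volume : Measure Heis) →L[ℂ] Lp ℂ 2 (volume : Measure Heis)) : Prop :=
  ∀ f, ∃ F G : Lp ℂ 2 (volume : Measure Heis), IsCentralFourier f F ∧ IsCentralFourier (P f) G ∧
    ∃ u : ℕ × ℕ → Lp ℂ 2 (volume : Measure Heis),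
      (∀ m, u m =ᵐ[volume] fun p : Heis =>
        if nuEig p.2 κ m ∈ B then cCoeff F p.2 κ m * thEig p.2 κ m p.1 else 0) ∧
      HasSum u G

end

/-!
The operator `A = L + κ² (x² + y²)` is carried by a unitary operator to multiplication by
`ν_{λ,m}` on `L²(ℕ² × ℝ)`, where `λ = (l, κ)` and `l` is the frequency in the central variable.
Everything asserted about `A` holds for such a multiplication operator: it is self-adjoint because
`ν` is bounded away from zero (`IsDiagonalizedBy.isSelfAdjoint`), its spectrum is the essential
range of `ν` (`IsDiagonalizedBy.spectrum_eq`), and its spectral projections are the multiplications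
by `1_{ν ∈ B}` (`IsDiagonalizedBy.isSpectralResolution`).

The unitary operator `oscUnitary` is composed of two. The Fourier transform in `t` is unitary up to
the factor `√(2π)` (`centralUnitary`): the truncated Fourier integrals converge in `L²` by
Plancherel's identity on almost every line, and the range is everything because the transform is
symmetric for the bilinear pairing `∫ f g`. At a fixed frequency `l`, the functions `T_λ h_{λ,m}`
form an orthonormal basis of `L²(ℝ²)`, and the coefficients in these bases give `coeffUnitary`.
The functions `h_{λ,m}` are products of Hermite functions in two linear forms that diagonalise
the quadratic form `(l x - κ z)² + κ² x²` (`exists_isHermiteFrame`), and `T_λ` is a partial Fourier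
transform followed by multiplication by the phase `e^{ilxy/2}`, which gives the orthonormality. For
the completeness, the products of Hermite functions span the polynomial multiples of a Gaussian,
the partial Fourier transform carries these to the polynomial multiples of another Gaussian, and a
function orthogonal to all of the latter is zero: it becomes a function with exponential moments,
and the vanishing of its moments makes its Fourier transform vanish
(`ae_eq_zero_of_integral_mul_polyGauss_eq_zero`).

That `A` becomes multiplication by `ν` (`isDiagonalizedBy_heisOsc`) comes from the eigenfunctions
`e^{ilt} T_λ h_{λ,m}` of the differential expression (`exists_eigenfunction`), which are smooth but
not square integrable. If `A f = g` in the sense of distributions, the conjugate eigenfunctions,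
multiplied by cut-offs `η(δ_r ·)` with `δ_r` the dilations of the group and `r → 0`, are admissible
test functions; the derivatives of the cut-offs tend uniformly to zero, and in the limit the
coefficients of `g` are `ν_{λ,m}` times those of `f`, for almost every `l`
(`ae_cCoeff_of_mem_heisOscGraph`). Conversely, if the coefficients are so related, then
`(g, φ) = (f, A φ)` for all test functions `φ`, because test functions lie in the domain and the
first part applies to them; this is the distributional equation `A f = g`, so the domain is the
maximal one.

The series that defines `E(B)` is the expansion of `1_{ν ∈ B} c_{λ,m}(f)` in the bases
`T_λ h_{λ,m}`, so that it determines `E(B)` as multiplication by `1_{ν ∈ B}` (`isSpectralProj_iff`).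
Finally `ν_{λ,0} = √(l² + 4κ²)` (`nuEig_zero`), which is least at `l = 0` and takes all values from
`2|κ|` on (`setOf_nuEig_eq_Ici`).
-/

noncomputable section

/-! ### Multiplication operators on `L²` -/

section Multiplication

variable {Z : Type*} [MeasurableSpace Z] {μ : Measure Z}

theorem memLp_two_mul_of_bound {b : Z → ℂ} (hb : Measurable b) {C : ℝ} (hC : ∀ z, ‖b z‖ ≤ C)
    {φ : Z → ℂ} (hφ : MemLp φ 2 μ) : MemLp (fun z => b z * φ z) 2 μ := by
  refine hφ.of_le_mul (c := C) (hb.aestronglyMeasurable.mul hφ.1) (ae_of_all _ fun z => ?_)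
  rw [norm_mul]
  exact mul_le_mul_of_nonneg_right (hC z) (norm_nonneg _)

/-- Multiplication by a bounded measurable function, as a bounded operator on `L²`. -/
def mulL2 (b : Z → ℂ) (hb : Measurable b) (C : ℝ) (hC : ∀ z, ‖b z‖ ≤ C) :
    Lp ℂ 2 μ →L[ℂ] Lp ℂ 2 μ :=
  LinearMap.mkContinuous
    { toFun := fun φ => (memLp_two_mul_of_bound hb hC (Lp.memLp φ)).toLp _
      map_add' := fun φ ψ => by
        refine Lp.ext ?_
        filter_upwards [MemLp.coeFn_toLp (memLp_two_mul_of_bound hb hC (Lp.memLp (φ + ψ))),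
          MemLp.coeFn_toLp (memLp_two_mul_of_bound hb hC (Lp.memLp φ)),
          MemLp.coeFn_toLp (memLp_two_mul_of_bound hb hC (Lp.memLp ψ)),
          Lp.coeFn_add φ ψ, Lp.coeFn_add ((memLp_two_mul_of_bound hb hC (Lp.memLp φ)).toLp _)
            ((memLp_two_mul_of_bound hb hC (Lp.memLp ψ)).toLp _)] with z h1 h2 h3 h4 h5
        rw [h1, h5, Pi.add_apply, h2, h3, h4, Pi.add_apply, mul_add]
      map_smul' := fun c φ => by
        refine Lp.ext ?_
        filter_upwards [MemLp.coeFn_toLp (memLp_two_mul_of_bound hb hC (Lp.memLp (c • φ))),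
          MemLp.coeFn_toLp (memLp_two_mul_of_bound hb hC (Lp.memLp φ)),
          Lp.coeFn_smul c φ,
          Lp.coeFn_smul c ((memLp_two_mul_of_bound hb hC (Lp.memLp φ)).toLp _)]
          with z h1 h2 h4 h5
        simp only [RingHom.id_apply]
        rw [h1, h5, Pi.smul_apply, h2, h4, Pi.smul_apply, smul_eq_mul, smul_eq_mul]
        ring } C
    (fun φ => by
      refine Lp.norm_le_mul_norm_of_ae_le_mul ?_
      filter_upwards [MemLp.coeFn_toLp (memLp_two_mul_of_bound hb hC (Lp.memLp φ))] with z h1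
      simp only [LinearMap.coe_mk, AddHom.coe_mk]
      rw [h1, norm_mul]
      exact mul_le_mul_of_nonneg_right (hC z) (norm_nonneg _))

theorem coeFn_mulL2 {b : Z → ℂ} (hb : Measurable b) (C : ℝ) (hC : ∀ z, ‖b z‖ ≤ C)
    (φ : Lp ℂ 2 μ) : mulL2 b hb C hC φ =ᵐ[μ] fun z => b z * φ z :=
  MemLp.coeFn_toLp (memLp_two_mul_of_bound hb hC (Lp.memLp φ))

/-- The restrictions of an `L²` function to countably many disjoint sets sum unconditionally to its
restriction to the union, by dominated convergence along the finite subsets. Countable additivity of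
the spectral projections and convergence of the series for `E(B)` are both instances. -/
theorem hasSum_of_ae_eq_indicator {ι : Type*} [Countable ι] {S : ι → Set Z}
    (hS : ∀ i, MeasurableSet (S i)) (hd : Pairwise (Function.onFun Disjoint S))
    {φ w : Lp ℂ 2 μ} {u : ι → Lp ℂ 2 μ} (hu : ∀ i, u i =ᵐ[μ] (S i).indicator φ)
    (hw : w =ᵐ[μ] (⋃ i, S i).indicator φ) : HasSum u w := by
  classical
  unfold HasSum
  simp only [SummationFilter.unconditional_filter]
  rw [Lp.tendsto_Lp_iff_tendsto_eLpNorm']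
  have h1 : ∀ s : Finset ι, eLpNorm (⇑(∑ i ∈ s, u i) - ⇑w) 2 μ =
      (∫⁻ z, ‖∑ i ∈ s, (S i).indicator φ z - (⋃ i, S i).indicator φ z‖ₑ ^ (2 : ℝ) ∂μ) ^
        (1 / 2 : ℝ) := by
    intro s
    rw [eLpNorm_eq_lintegral_rpow_enorm_toReal (by norm_num) (by norm_num)]
    simp only [ENNReal.toReal_ofNat]
    congr 1
    refine lintegral_congr_ae ?_
    have h2 : ∀ᵐ z ∂μ, ∀ i, u i z = (S i).indicator φ z := ae_all_iff.2 hu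
    filter_upwards [h2, hw, Lp.coeFn_finsetSum s u] with z h2 h3 h4
    rw [Pi.sub_apply, h4, h3, Finset.sum_apply]
    simp only [h2]
  simp only [h1]
  have h3 : ∀ z, ∀ᶠ s : Finset ι in atTop,
      ∑ i ∈ s, (S i).indicator φ z - (⋃ i, S i).indicator φ z = 0 := by
    intro z
    by_cases hz : ∃ j, z ∈ S j
    · obtain ⟨j, hj⟩ := hz
      filter_upwards [eventually_ge_atTop {j}] with s hs
      rw [Finset.sum_eq_single_of_mem j (hs (Finset.mem_singleton_self j)),
        Set.indicator_of_mem hj, Set.indicator_of_mem (Set.mem_iUnion.2 ⟨j, hj⟩), sub_self]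
      intro i _ hij
      refine Set.indicator_of_notMem (fun hi => ?_) _
      exact Set.disjoint_left.1 (hd hij) hi hj
    · push Not at hz
      refine Eventually.of_forall fun s => ?_
      rw [Set.indicator_of_notMem (by simpa using hz), sub_zero]
      exact Finset.sum_eq_zero fun i _ => Set.indicator_of_notMem (hz i) _
  have hm : ∀ s : Finset ι, Measurable fun z =>
      ∑ i ∈ s, (S i).indicator φ z - (⋃ i, S i).indicator φ z := by
    intro s
    have hφ := (Lp.stronglyMeasurable φ).measurable
    exact (Finset.measurable_sum s fun i _ => hφ.indicator (hS i)).sub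
      (hφ.indicator (MeasurableSet.iUnion hS))
  have hfin : ∫⁻ z, ‖φ z‖ₑ ^ (2 : ℝ) ∂μ ≠ ⊤ := by
    have := (eLpNorm_lt_top_iff_lintegral_rpow_enorm_lt_top (p := 2) (by norm_num)
      (by norm_num)).1 (Lp.memLp φ).2
    simpa using this.ne
  have hlim : Tendsto (fun s : Finset ι =>
      ∫⁻ z, ‖∑ i ∈ s, (S i).indicator φ z - (⋃ i, S i).indicator φ z‖ₑ ^ (2 : ℝ) ∂μ) atTop
      (𝓝 (∫⁻ _, 0 ∂μ)) := by
    refine tendsto_lintegral_filter_of_dominated_convergence (fun z => ‖φ z‖ₑ ^ (2 : ℝ))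
      (Eventually.of_forall fun s => ((hm s).enorm.pow_const _)) ?_ hfin ?_
    · refine Eventually.of_forall fun s => ae_of_all _ fun z => ?_
      refine ENNReal.rpow_le_rpow ?_ (by norm_num)
      by_cases hz : ∃ j ∈ s, z ∈ S j
      · obtain ⟨j, hjs, hj⟩ := hz
        rw [Finset.sum_eq_single_of_mem j hjs, Set.indicator_of_mem hj,
          Set.indicator_of_mem (Set.mem_iUnion.2 ⟨j, hj⟩), sub_self]
        · simp
        · intro i _ hij
          exact Set.indicator_of_notMem (fun hi => Set.disjoint_left.1 (hd hij) hi hj) _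
      · push Not at hz
        rw [Finset.sum_eq_zero fun i hi => Set.indicator_of_notMem (hz i hi) _, zero_sub,
          enorm_neg]
        exact enorm_indicator_le_enorm_self _ _
    · refine ae_of_all _ fun z => ?_
      refine tendsto_const_nhds.congr' ?_
      filter_upwards [h3 z] with s hs
      rw [hs]
      simp
  have h4 := hlim.ennrpow_const (1 / 2 : ℝ)
  simpa using h4

end Multiplication

/-! ### Operators unitarily equivalent to a multiplication operator -/

section Diagonal

variable {Z : Type*} [MeasurableSpace Z] {μ : Measure Z}
variable {H : Type*} [NormedAddCommGroup H] [InnerProductSpace ℂ H]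

/-- The unitary `U` carries the unbounded operator `A` to the operator of multiplication by the
real function `ν`, with its maximal domain. -/
def IsDiagonalizedBy (A : H →ₗ.[ℂ] H) (U : H ≃ₗᵢ[ℂ] Lp ℂ 2 μ) (ν : Z → ℝ) : Prop :=
  ∀ f g : H, (f, g) ∈ A.graph ↔ U g =ᵐ[μ] fun z => (ν z : ℂ) * U f z

variable {A : H →ₗ.[ℂ] H} {U : H ≃ₗᵢ[ℂ] Lp ℂ 2 μ} {ν : Z → ℝ}

theorem inner_eq_integral_of_isometry (U : H ≃ₗᵢ[ℂ] Lp ℂ 2 μ) (f g : H) :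
    ⟪f, g⟫_ℂ = ∫ z, conj (U f z) * U g z ∂μ := by
  rw [← U.inner_map_map, L2.inner_def]
  simp only [RCLike.inner_apply']

theorem IsDiagonalizedBy.inner_comm (h : IsDiagonalizedBy A U ν) {f g f' g' : H}
    (hf : (f, g) ∈ A.graph) (hf' : (f', g') ∈ A.graph) : ⟪g, f'⟫_ℂ = ⟪f, g'⟫_ℂ := by
  rw [inner_eq_integral_of_isometry U, inner_eq_integral_of_isometry U]
  refine integral_congr_ae ?_
  filter_upwards [(h f g).1 hf, (h f' g').1 hf'] with z h1 h2
  rw [h1, h2]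
  simp only [map_mul, Complex.conj_ofReal]
  ring

/-- A solution operator for `(A - w) f = g` when `ν - w` is bounded away from zero. -/
theorem IsDiagonalizedBy.exists_inverse (h : IsDiagonalizedBy A U ν) (hν : Measurable ν) {c : ℝ}
    (hc : 0 < c) {w : ℂ} (hcν : ∀ z, c ≤ ‖(ν z : ℂ) - w‖) :
    ∃ R : H →L[ℂ] H, (∀ g, (R g, g + w • R g) ∈ A.graph) ∧
      ∀ f g, (f, g + w • f) ∈ A.graph → f = R g := by
  have hb : Measurable fun z => ((ν z : ℂ) - w)⁻¹ :=
    ((Complex.measurable_ofReal.comp hν).sub_const w).inv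
  have hC : ∀ z, ‖((ν z : ℂ) - w)⁻¹‖ ≤ c⁻¹ := fun z => by
    rw [norm_inv]
    exact inv_anti₀ hc (hcν z)
  have hne : ∀ z, (ν z : ℂ) - w ≠ 0 := fun z hz => by
    have := hcν z
    rw [hz, norm_zero] at this
    linarith
  let R : H →L[ℂ] H := U.symm.toContinuousLinearEquiv.toContinuousLinearMap ∘L
    (mulL2 (μ := μ) _ hb _ hC) ∘L U.toContinuousLinearEquiv.toContinuousLinearMap
  have hR : ∀ g, U (R g) =ᵐ[μ] fun z => ((ν z : ℂ) - w)⁻¹ * U g z := fun g => by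
    have : U (R g) = mulL2 (μ := μ) _ hb _ hC (U g) := by simp [R]
    rw [this]
    exact coeFn_mulL2 hb _ hC (U g)
  refine ⟨R, fun g => ?_, fun f g hfg => ?_⟩
  · rw [h]
    have h2 : U (g + w • R g) = U g + w • U (R g) := by simp
    rw [h2]
    filter_upwards [hR g, Lp.coeFn_add (U g) (w • U (R g)), Lp.coeFn_smul w (U (R g))]
      with z h3 h4 h5
    rw [h4, Pi.add_apply, h5, Pi.smul_apply, h3, smul_eq_mul]
    field_simp [hne z]
    ring
  · apply U.injective
    refine Lp.ext ?_
    have h1 := (h _ _).1 hfg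
    have h2 : U (g + w • f) = U g + w • U f := by simp
    rw [h2] at h1
    filter_upwards [hR g, h1, Lp.coeFn_add (U g) (w • U f), Lp.coeFn_smul w (U f)]
      with z h3 h4 h5 h6
    rw [h5, Pi.add_apply, h6, Pi.smul_apply, smul_eq_mul] at h4
    rw [h3, eq_sub_of_add_eq h4]
    field_simp [hne z]

/-- Since `ν` is bounded away from zero, `A` has a bounded inverse defined on all of `H`. It is
symmetric, and the inverse of an injective bounded symmetric operator is self-adjoint. -/
theorem IsDiagonalizedBy.isSelfAdjoint [CompleteSpace H] (h : IsDiagonalizedBy A U ν)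
    (hν : Measurable ν) {c : ℝ} (hc : 0 < c) (hcν : ∀ z, c ≤ ν z) : IsSelfAdjoint A := by
  obtain ⟨R, hR1, -⟩ := h.exists_inverse hν hc (w := 0) (fun z => by
    rw [sub_zero, Complex.norm_real]
    exact (hcν z).trans (le_abs_self _))
  simp only [zero_smul, add_zero] at hR1
  -- `R` is symmetric, and its range lies in the domain of `A`
  have hsymm : ∀ f g, ⟪f, R g⟫_ℂ = ⟪R f, g⟫_ℂ := fun f g => h.inner_comm (hR1 f) (hR1 g)
  have hdense : Dense (A.domain : Set H) := by
    rw [Submodule.dense_iff_topologicalClosure_eq_top,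
      Submodule.topologicalClosure_eq_top_iff, Submodule.eq_bot_iff]
    intro y hy
    have h0 : ∀ g, ⟪R y, g⟫_ℂ = 0 := fun g => by
      rw [← hsymm]
      exact inner_eq_zero_symm.1 ((Submodule.mem_orthogonal _ _).1 hy _
        (LinearPMap.mem_domain_of_mem_graph (hR1 g)))
    have hRy : R y = 0 := inner_self_eq_zero.1 (h0 _)
    have := hR1 y
    rw [hRy] at this
    exact LinearPMap.graph_fst_eq_zero_snd A this rfl
  rw [LinearPMap.isSelfAdjoint_def]
  refine le_antisymm ?_ ?_
  · refine LinearPMap.le_of_le_graph ?_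
    rintro ⟨y, w⟩ hyw
    obtain ⟨y', hy', rfl⟩ := (LinearPMap.mem_graph_iff _).1 hyw
    simp only at hy'
    have hfa := LinearPMap.adjoint_isFormalAdjoint hdense y'
    have key : ∀ g, ⟪(y' : H) - R (A.adjoint y'), g⟫_ℂ = 0 := fun g => by
      obtain ⟨x, hx, hxg⟩ := (LinearPMap.mem_graph_iff _).1 (hR1 g)
      simp only at hx hxg
      have h1 := hfa x
      rw [hx, hxg, hsymm] at h1
      rw [inner_sub_left, h1, sub_self]
    have h2 : (y' : H) = R (A.adjoint y') := sub_eq_zero.1 (inner_self_eq_zero.1 (key _))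
    have h3 := hR1 (A.adjoint y')
    rw [← h2] at h3
    simpa [hy'] using h3
  · refine LinearPMap.IsFormalAdjoint.le_adjoint hdense fun x y => ?_
    exact h.inner_comm (LinearPMap.mem_graph A x) (LinearPMap.mem_graph A y)

/-- The spectrum is the essential range of `ν`: off `S` the function `(ν - w)⁻¹` is bounded, and
near a point `s` of `S` the indicator functions of subsets of `{|ν - s| < ε}` are approximate
eigenvectors. Sigma-finiteness provides such subsets of positive finite measure. -/
theorem IsDiagonalizedBy.spectrum_eq [SigmaFinite μ] (h : IsDiagonalizedBy A U ν) (hν : Measurable ν)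
    {S : Set ℝ} (hS : IsClosed S) (hνS : ∀ z, ν z ∈ S)
    (hpos : ∀ s ∈ S, ∀ ε > 0, μ {z | |ν z - s| < ε} ≠ 0) :
    spectrumPMap A = Complex.ofReal '' S := by
  ext w
  simp only [spectrumPMap, Set.mem_compl_iff]
  constructor
  · contrapose!
    intro hw
    have hcl : IsClosed (Complex.ofReal '' S) :=
      Complex.isometry_ofReal.isClosedEmbedding.isClosedMap _ hS
    obtain ⟨c, hc, hball⟩ := Metric.isOpen_iff.1 hcl.isOpen_compl w hw
    have hcν : ∀ z, c ≤ ‖(ν z : ℂ) - w‖ := fun z => by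
      by_contra! hlt
      exact hball (by rwa [Metric.mem_ball, dist_eq_norm]) ⟨ν z, hνS z, rfl⟩
    obtain ⟨R, hR1, hR2⟩ := h.exists_inverse hν hc hcν
    refine ⟨R, fun f => ?_, fun f => ?_⟩
    · obtain ⟨x, hx, hxg⟩ := (LinearPMap.mem_graph_iff _).1 (hR1 f)
      simp only at hx hxg
      refine ⟨hx ▸ x.2, ?_⟩
      have : A ⟨R f, hx ▸ x.2⟩ = A x := by congr 1; exact Subtype.ext hx.symm
      rw [this, hxg, add_sub_cancel_right]
    · refine (hR2 f _ ?_).symm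
      rw [sub_add_cancel]
      exact LinearPMap.mem_graph A f
  · rintro ⟨s, hs, rfl⟩ ⟨R, hR1, hR2⟩
    -- approximate eigenvectors: functions supported where `ν` is close to `s`
    have hRpos : 0 < ‖R‖ + 1 := by positivity
    have hm : MeasurableSet {z | |ν z - s| < (‖R‖ + 1)⁻¹} :=
      measurableSet_lt ((hν.sub_const s).norm) measurable_const
    obtain ⟨t, htm, hts, ht0, htt⟩ : ∃ t, MeasurableSet t ∧ t ⊆ {z | |ν z - s| < (‖R‖ + 1)⁻¹} ∧
        0 < μ t ∧ μ t < ⊤ :=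
      Measure.exists_subset_measure_lt_top hm (pos_iff_ne_zero.2 (hpos s hs _ (by positivity)))
    have hφm : MemLp (t.indicator fun _ => (1 : ℂ)) 2 μ :=
      memLp_indicator_const 2 htm 1 (Or.inr htt.ne)
    have hψm : MemLp (t.indicator fun z => ((ν z - s : ℝ) : ℂ)) 2 μ := by
      refine hφm.of_le_mul (c := (‖R‖ + 1)⁻¹) ?_ (ae_of_all _ fun z => ?_)
      · exact ((Complex.measurable_ofReal.comp (hν.sub_const s)).indicator htm).aestronglyMeasurable
      · by_cases hz : z ∈ t
        · simp only [Set.indicator_of_mem hz, Complex.norm_real, norm_one, mul_one]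
          exact (hts hz).le
        · simp [Set.indicator_of_notMem hz]
    set f := U.symm (hφm.toLp _) with hf
    set g := U.symm (hψm.toLp _) with hg
    have hUf : U f =ᵐ[μ] t.indicator fun _ => (1 : ℂ) := by
      rw [hf, U.apply_symm_apply]; exact hφm.coeFn_toLp
    have hUg : U g =ᵐ[μ] t.indicator fun z => ((ν z - s : ℝ) : ℂ) := by
      rw [hg, U.apply_symm_apply]; exact hψm.coeFn_toLp
    have hgraph : (f, g + (s : ℂ) • f) ∈ A.graph := by
      rw [h]
      have h2 : U (g + (s : ℂ) • f) = U g + (s : ℂ) • U f := by rw [map_add, map_smul]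
      rw [h2]
      filter_upwards [hUf, hUg, Lp.coeFn_add (U g) ((s : ℂ) • U f), Lp.coeFn_smul (s : ℂ) (U f)]
        with z h3 h4 h5 h6
      rw [h5, Pi.add_apply, h6, Pi.smul_apply, h3, h4]
      by_cases hz : z ∈ t
      · simp [Set.indicator_of_mem hz]
      · simp [Set.indicator_of_notMem hz]
    obtain ⟨x, hx, hxg⟩ := (LinearPMap.mem_graph_iff _).1 hgraph
    simp only at hx hxg
    have hRg : R g = f := by
      have := hR2 x
      rwa [hx, hxg, add_sub_cancel_right] at this
    have hle : ‖g‖ ≤ (‖R‖ + 1)⁻¹ * ‖f‖ := by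
      rw [← U.norm_map g, ← U.norm_map f]
      refine Lp.norm_le_mul_norm_of_ae_le_mul ?_
      filter_upwards [hUf, hUg] with z h3 h4
      rw [h3, h4]
      by_cases hz : z ∈ t
      · simp only [Set.indicator_of_mem hz, Complex.norm_real, norm_one, mul_one]
        exact (hts hz).le
      · simp [Set.indicator_of_notMem hz]
    have hf0 : f = 0 := by
      have h1 : ‖f‖ ≤ ‖R‖ * ((‖R‖ + 1)⁻¹ * ‖f‖) := by
        conv_lhs => rw [← hRg]
        exact (R.le_opNorm g).trans (mul_le_mul_of_nonneg_left hle (norm_nonneg _))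
      have h2 : (‖R‖ + 1) * ‖f‖ ≤ ‖R‖ * ‖f‖ := by
        calc (‖R‖ + 1) * ‖f‖ ≤ (‖R‖ + 1) * (‖R‖ * ((‖R‖ + 1)⁻¹ * ‖f‖)) :=
              mul_le_mul_of_nonneg_left h1 hRpos.le
          _ = ‖R‖ * ‖f‖ := by field_simp
      have h3 : ‖f‖ ≤ 0 := by linarith
      exact norm_le_zero_iff.1 h3
    have h0 : (t.indicator fun _ => (1 : ℂ)) =ᵐ[μ] 0 := by
      refine hUf.symm.trans ?_
      rw [hf0, map_zero]
      exact Lp.coeFn_zero _ _ _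
    refine ht0.ne' (measure_mono_null (fun z hz => ?_) h0)
    simpa using hz

/-- The scalar measure `(E(·) f, f)` is the image under `ν` of the measure with density `|U f|²`, so
that `∫ s² d(E(s) f, f) < ∞` says that `ν · U f` is square integrable. -/
theorem IsDiagonalizedBy.isSpectralResolution [CompleteSpace H] (h : IsDiagonalizedBy A U ν)
    (hν : Measurable ν) {E : Set ℝ → (H →L[ℂ] H)}
    (hE : ∀ B, MeasurableSet B → ∀ f, U (E B f) =ᵐ[μ] (ν ⁻¹' B).indicator (U f)) :
    IsSpectralResolution E A := by
  have hpvm : IsProjValuedMeasure E := by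
    refine ⟨fun B hB => ⟨?_, ?_⟩, ?_, ?_, fun B C hB hC => ?_, fun B hB hd f => ?_⟩
    · refine ContinuousLinearMap.ext fun f => U.injective (Lp.ext ?_)
      filter_upwards [hE B hB f, hE B hB (E B f)] with z h1 h2
      change U (E B (E B f)) z = _
      rw [h2]
      by_cases hz : z ∈ ν ⁻¹' B
      · rw [Set.indicator_of_mem hz]
      · rw [h1, Set.indicator_of_notMem hz, Set.indicator_of_notMem hz]
    · rw [ContinuousLinearMap.isSelfAdjoint_iff_isSymmetric]
      intro f g
      simp only [ContinuousLinearMap.coe_coe]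
      rw [inner_eq_integral_of_isometry U, inner_eq_integral_of_isometry U]
      refine integral_congr_ae ?_
      filter_upwards [hE B hB f, hE B hB g] with z h1 h2
      rw [h1, h2]
      by_cases hz : z ∈ ν ⁻¹' B
      · rw [Set.indicator_of_mem hz, Set.indicator_of_mem hz]
      · rw [Set.indicator_of_notMem hz, Set.indicator_of_notMem hz]; simp
    · refine ContinuousLinearMap.ext fun f => U.injective (Lp.ext ?_)
      rw [zero_apply, map_zero]
      filter_upwards [hE ∅ .empty f, Lp.coeFn_zero ℂ 2 μ] with z h1 h2
      rw [h1, h2]; simp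
    · refine ContinuousLinearMap.ext fun f => U.injective (Lp.ext ?_)
      filter_upwards [hE Set.univ .univ f] with z h1
      rw [h1]; simp
    · refine ContinuousLinearMap.ext fun f => U.injective (Lp.ext ?_)
      filter_upwards [hE (B ∩ C) (hB.inter hC) f, hE B hB (E C f), hE C hC f] with z h1 h2 h3
      change _ = U (E B (E C f)) z
      rw [h1, h2, Set.preimage_inter, ← Set.indicator_indicator]
      by_cases hz : z ∈ ν ⁻¹' B
      · rw [Set.indicator_of_mem hz, Set.indicator_of_mem hz, h3]
      · rw [Set.indicator_of_notMem hz, Set.indicator_of_notMem hz]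
    · have h1 : HasSum (fun n => U (E (B n) f)) (U (E (⋃ n, B n) f)) := by
        refine hasSum_of_ae_eq_indicator (S := fun n => ν ⁻¹' B n) (fun n => hν (hB n))
          (fun i j hij => (hd hij).preimage ν) (φ := U f) (fun n => hE _ (hB n) f) ?_
        rw [← Set.preimage_iUnion]
        exact hE _ (MeasurableSet.iUnion hB) f
      have h2 := h1.mapL U.symm.toContinuousLinearEquiv.toContinuousLinearMap
      simpa using h2
  have hmeas : ∀ f : H, Measurable (U f) := fun f => (Lp.stronglyMeasurable (U f)).measurable
  have hint : ∀ f : H, Integrable (fun z => ‖U f z‖ ^ 2) μ := fun f =>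
    (memLp_two_iff_integrable_sq_norm (Lp.memLp (U f)).1).1 (Lp.memLp (U f))
  have hmeasure : ∀ f : H, hpvm.measure f =
      Measure.map ν (μ.withDensity fun z => ((‖U f z‖₊ ^ 2 : NNReal) : ℝ≥0∞)) := by
    intro f
    ext B hB
    rw [Measure.map_apply hν hB, withDensity_apply _ (hν hB)]
    rw [IsProjValuedMeasure.measure, Measure.ofMeasurable_apply _ hB]
    have h1 : ⟪f, E B f⟫_ℂ = ((∫ z in ν ⁻¹' B, ‖U f z‖ ^ 2 ∂μ : ℝ) : ℂ) := by
      rw [inner_eq_integral_of_isometry U, ← integral_indicator (hν hB), ← integral_complex_ofReal]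
      refine integral_congr_ae ?_
      filter_upwards [hE B hB f] with z h1
      rw [h1]
      by_cases hz : z ∈ ν ⁻¹' B
      · rw [Set.indicator_of_mem hz, Set.indicator_of_mem hz, ← Complex.normSq_eq_conj_mul_self,
          Complex.normSq_eq_norm_sq]
      · rw [Set.indicator_of_notMem hz, Set.indicator_of_notMem hz]; simp
    rw [h1, Complex.ofReal_re,
      ofReal_integral_eq_lintegral_ofReal (hint f).integrableOn (ae_of_all _ fun z => by positivity)]
    refine lintegral_congr fun z => ?_
    rw [← ENNReal.ofReal_coe_nnreal]
    simp
  refine ⟨hpvm, fun f => ?_, fun f => ?_⟩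
  · have h1 : f ∈ A.domain ↔ MemLp (fun z => (ν z : ℂ) * U f z) 2 μ := by
      rw [LinearPMap.mem_domain_iff]
      constructor
      · rintro ⟨g, hg⟩
        exact (Lp.memLp (U g)).ae_eq ((h f g).1 hg)
      · intro hm
        refine ⟨U.symm (hm.toLp _), (h _ _).2 ?_⟩
        rw [U.apply_symm_apply]
        exact hm.coeFn_toLp
    have hm : AEStronglyMeasurable (fun z => (ν z : ℂ) * U f z) μ :=
      ((Complex.measurable_ofReal.comp hν).mul (hmeas f)).aestronglyMeasurable
    rw [h1, memLp_two_iff_integrable_sq_norm hm, hmeasure, lintegral_map (by fun_prop) hν,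
      lintegral_withDensity_eq_lintegral_mul _ (by have := hmeas f; fun_prop) (by fun_prop)]
    have hm2 : AEStronglyMeasurable (fun z => ‖(ν z : ℂ) * U f z‖ ^ 2) μ := hm.norm.pow 2
    rw [Integrable, and_iff_right hm2, hasFiniteIntegral_iff_ofReal
      (ae_of_all _ fun z => by positivity)]
    have h2 : ∀ z, ENNReal.ofReal (‖(ν z : ℂ) * U f z‖ ^ 2) =
        ((fun z => ((‖U f z‖₊ ^ 2 : NNReal) : ℝ≥0∞)) * fun z => ENNReal.ofReal (ν z ^ 2)) z := by
      intro z
      rw [Pi.mul_apply, ← ENNReal.ofReal_coe_nnreal, ← ENNReal.ofReal_mul (by positivity)]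
      congr 1
      rw [norm_mul, mul_pow, Complex.norm_real, Real.norm_eq_abs, sq_abs]
      simp [mul_comm]
    simp only [h2]
  · rw [inner_eq_integral_of_isometry U, hmeasure, integral_map hν.aemeasurable (by fun_prop),
      integral_withDensity_eq_integral_smul (by have := hmeas f; fun_prop),
      ← integral_complex_ofReal]
    refine integral_congr_ae ?_
    filter_upwards [(h _ _).1 (LinearPMap.mem_graph A f)] with z h1
    rw [h1]
    have : conj (U f z) * ((ν z : ℂ) * U f z) = (ν z : ℂ) * (conj (U f z) * U f z) := by ring
    rw [this, ← Complex.normSq_eq_conj_mul_self, Complex.normSq_eq_norm_sq, NNReal.smul_def]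
    push_cast
    simp [mul_comm]

end Diagonal

/-! ### Plancherel's theorem on the line -/

section Line

open scoped FourierTransform

/-- The Fourier transform of `L²` agrees with the Fourier integral on `L¹ ∩ L²`. -/
theorem coeFn_fourier_toLp {f : ℝ → ℂ} (h1 : Integrable f) (h2 : MemLp f 2) :
    (𝓕 (h2.toLp f) : Lp ℂ 2 (volume : Measure ℝ)) =ᵐ[volume] 𝓕 f := by
  have hcont : Continuous (𝓕 f) := by
    have := VectorFourier.fourierIntegral_continuous (μ := volume) (L := innerₗ ℝ)
      Real.continuous_fourierChar (by exact continuous_inner) h1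
    exact this
  refine ae_eq_of_integral_contDiff_smul_eq
    ((Lp.memLp _).locallyIntegrable (by norm_num)) hcont.locallyIntegrable fun g hg hgc => ?_
  have hgc' : HasCompactSupport (fun x => (g x : ℂ)) :=
    hgc.comp_left (g := fun r : ℝ => (r : ℂ)) (by simp)
  let φ : SchwartzMap ℝ ℂ := hgc'.toSchwartzMap (Complex.ofRealCLM.contDiff.comp hg)
  have hφ : ∀ x, φ x = (g x : ℂ) := fun x => rfl
  have e1 : ∫ x, φ x • (𝓕 (h2.toLp f) : Lp ℂ 2 (volume : Measure ℝ)) x =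
      ∫ x, (𝓕 φ) x • (h2.toLp f) x := by
    have := DFunLike.congr_fun (Lp.fourier_toTemperedDistribution_eq (h2.toLp f)) φ
    rw [TemperedDistribution.fourier_apply, Lp.toTemperedDistribution_apply,
      Lp.toTemperedDistribution_apply] at this
    exact this.symm
  have e2 : ∫ x, (𝓕 φ) x • (h2.toLp f) x = ∫ x, (𝓕 φ) x • f x := by
    refine integral_congr_ae ?_
    filter_upwards [h2.coeFn_toLp] with x hx
    rw [hx]
  have e3 : ∫ x, (𝓕 φ) x • f x = ∫ x, φ x • (𝓕 f) x := by
    have := VectorFourier.integral_fourierIntegral_smul_eq_flip (L := innerₗ ℝ)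
      Real.continuous_fourierChar (μ := volume) (ν := volume) (by exact continuous_inner)
      φ.integrable h1
    rw [flip_innerₗ] at this
    exact this
  have e4 := e1.trans (e2.trans e3)
  simp only [hφ, Complex.coe_smul] at e4
  exact e4

/-- The Fourier transform on the line, without a normalising factor. -/
def lineFT (f : ℝ → ℂ) (l : ℝ) : ℂ :=
  ∫ t : ℝ, Complex.exp (-Complex.I * (l * t : ℝ)) * f t

theorem lineFT_eq_fourier (f : ℝ → ℂ) (l : ℝ) : lineFT f l = 𝓕 f (l / (2 * Real.pi)) := by
  rw [Real.fourier_real_eq_integral_exp_smul, lineFT]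
  refine integral_congr_ae (ae_of_all _ fun t => ?_)
  simp only [smul_eq_mul]
  congr 2
  push_cast
  field_simp

theorem integral_comp_div_two_pi (F : ℝ → ℂ) :
    ∫ l, F (l / (2 * Real.pi)) = (2 * Real.pi : ℝ) • ∫ w, F w := by
  rw [Measure.integral_comp_div, abs_of_pos (by positivity)]

/-- Plancherel's identity, where the factor `2π` comes from the kernel `e^{-ilt}`. -/
theorem integral_conj_lineFT_mul_lineFT {f g : ℝ → ℂ} (hf : Integrable f) (hf2 : MemLp f 2)
    (hg : Integrable g) (hg2 : MemLp g 2) :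
    ∫ l, conj (lineFT f l) * lineFT g l = (2 * Real.pi : ℝ) • ∫ t, conj (f t) * g t := by
  simp only [lineFT_eq_fourier]
  rw [integral_comp_div_two_pi fun w => conj (𝓕 f w) * 𝓕 g w]
  congr 1
  have h := Lp.inner_fourier_eq (hf2.toLp f) (hg2.toLp g)
  rw [L2.inner_def, L2.inner_def] at h
  simp only [RCLike.inner_apply'] at h
  refine Eq.trans (integral_congr_ae ?_) (h.trans (integral_congr_ae ?_))
  · filter_upwards [coeFn_fourier_toLp hf hf2, coeFn_fourier_toLp hg hg2] with w h1 h2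
    rw [h1, h2]
  · filter_upwards [hf2.coeFn_toLp, hg2.coeFn_toLp] with w h1 h2
    rw [h1, h2]

theorem memLp_lineFT {f : ℝ → ℂ} (hf : Integrable f) (hf2 : MemLp f 2) : MemLp (lineFT f) 2 := by
  have h1 : MemLp (𝓕 f) 2 := (memLp_congr_ae (coeFn_fourier_toLp hf hf2)).1 (Lp.memLp _)
  have h2 : lineFT f = fun l => 𝓕 f ((2 * Real.pi)⁻¹ • l) := by
    funext l
    rw [lineFT_eq_fourier, smul_eq_mul, div_eq_inv_mul]
  rw [h2]
  have h3 : Measure.map (fun l : ℝ => (2 * Real.pi)⁻¹ • l) volume =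
      ENNReal.ofReal (2 * Real.pi) • (volume : Measure ℝ) := by
    rw [Measure.map_addHaar_smul _ (by positivity)]
    simp [abs_of_pos Real.pi_pos]
  have h4 : MemLp (𝓕 f) 2 (Measure.map (fun l : ℝ => (2 * Real.pi)⁻¹ • l) volume) := by
    rw [h3]
    exact h1.smul_measure ENNReal.ofReal_ne_top
  exact h4.comp_of_map (by fun_prop)

theorem lintegral_enorm_lineFT_sq {f : ℝ → ℂ} (hf : Integrable f) (hf2 : MemLp f 2) :
    ∫⁻ l, ‖lineFT f l‖ₑ ^ 2 = ENNReal.ofReal (2 * Real.pi) * ∫⁻ t, ‖f t‖ₑ ^ 2 := by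
  have h := integral_conj_lineFT_mul_lineFT hf hf2 hf hf2
  have h1 := (memLp_two_iff_integrable_sq_norm (memLp_lineFT hf hf2).1).1 (memLp_lineFT hf hf2)
  have h2 := (memLp_two_iff_integrable_sq_norm hf2.1).1 hf2
  simp only [← Complex.normSq_eq_conj_mul_self, Complex.normSq_eq_norm_sq] at h
  rw [integral_complex_ofReal, integral_complex_ofReal, Complex.real_smul, ← Complex.ofReal_mul,
    Complex.ofReal_inj] at h
  have h3 := congrArg ENNReal.ofReal h
  rw [ENNReal.ofReal_mul (by positivity),
    ofReal_integral_eq_lintegral_ofReal h1 (ae_of_all _ fun z => by positivity),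
    ofReal_integral_eq_lintegral_ofReal h2 (ae_of_all _ fun z => by positivity)] at h3
  simpa only [← ofReal_norm, ENNReal.ofReal_pow (norm_nonneg _)] using h3

/-- Symmetry of the Fourier kernel, by Fubini. -/
theorem integral_lineFT_mul {f g : ℝ → ℂ} (hf : Integrable f) (hg : Integrable g) :
    ∫ l, lineFT f l * g l = ∫ t, f t * lineFT g t := by
  have hint : Integrable (Function.uncurry fun l t : ℝ =>
      Complex.exp (-Complex.I * (l * t : ℝ)) * f t * g l) (volume.prod volume) := by
    have h1 : Integrable (fun p : ℝ × ℝ => g p.1 * f p.2) (volume.prod volume) := hg.mul_prod hf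
    refine (h1.bdd_mul (c := 1) (f := fun p : ℝ × ℝ =>
      Complex.exp (-Complex.I * (p.1 * p.2 : ℝ))) (by fun_prop) (ae_of_all _ fun p => ?_)).congr
      (ae_of_all _ fun p => ?_)
    · rw [neg_mul, mul_comm, ← neg_mul, ← Complex.ofReal_neg, Complex.norm_exp_ofReal_mul_I]
    · simp only [Function.uncurry]; ring
  simp only [lineFT, ← integral_mul_const, ← integral_const_mul]
  rw [integral_integral_swap hint]
  refine integral_congr_ae (ae_of_all _ fun t => integral_congr_ae (ae_of_all _ fun l => ?_))
  simp only
  rw [mul_comm l t]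
  ring

end Line

/-! ### The Fourier transform in the central variable -/

section Central

/-- The Fourier integral in the central variable. -/
def centralFT (f : Heis → ℂ) (p : Heis) : ℂ := lineFT (fun t => f (p.1, t)) p.2

theorem measurable_centralFT {f : Heis → ℂ} (hf : Measurable f) : Measurable (centralFT f) := by
  have h : StronglyMeasurable fun q : Heis × ℝ =>
      Complex.exp (-Complex.I * (q.1.2 * q.2 : ℝ)) * f (q.1.1, q.2) := by
    refine Measurable.stronglyMeasurable ?_
    have h1 : Measurable fun q : Heis × ℝ => f (q.1.1, q.2) :=
      hf.comp ((measurable_fst.comp measurable_fst).prodMk measurable_snd)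
    exact Measurable.mul (by fun_prop) h1
  exact (StronglyMeasurable.integral_prod_right (ν := volume) h).measurable

theorem ae_memLp_slice {f : Heis → ℂ} (hf : Measurable f) (h2 : MemLp f 2) :
    ∀ᵐ q : ℝ × ℝ, MemLp (fun t : ℝ => f (q, t)) 2 := by
  have h := (memLp_two_iff_integrable_sq_norm h2.1).1 h2
  rw [Measure.volume_eq_prod] at h
  filter_upwards [h.prod_right_ae] with q hq
  exact (memLp_two_iff_integrable_sq_norm
    (hf.comp measurable_prodMk_left).aestronglyMeasurable).2 hq

theorem ae_memLp_slice_left {f : Heis → ℂ} (hf : Measurable f) (h2 : MemLp f 2) :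
    ∀ᵐ l : ℝ, MemLp (fun q : ℝ × ℝ => f (q, l)) 2 := by
  have h := (memLp_two_iff_integrable_sq_norm h2.1).1 h2
  rw [Measure.volume_eq_prod] at h
  filter_upwards [h.prod_left_ae] with l hl
  exact (memLp_two_iff_integrable_sq_norm
    (hf.comp measurable_prodMk_right).aestronglyMeasurable).2 hl

theorem integrable_of_memLp_two_of_bounded_support {g : ℝ → ℂ} {R : ℝ} (hg : MemLp g 2)
    (hR : ∀ t, R < |t| → g t = 0) : Integrable g := by
  have h1 : IntegrableOn g (Set.Icc (-R) R) := by
    have := hg.restrict (Set.Icc (-R) R)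
    exact (this.mono_exponent (p := 1) (by norm_num)).integrable le_rfl
  refine (integrableOn_iff_integrable_of_support_subset fun t ht => ?_).1 h1
  by_contra hn
  refine ht (hR t ?_)
  rw [Set.mem_Icc, ← abs_le] at hn
  exact not_le.1 hn

theorem lintegral_heis {f : Heis → ℝ≥0∞} (hf : Measurable f) :
    ∫⁻ p, f p = ∫⁻ q : ℝ × ℝ, ∫⁻ t : ℝ, f (q, t) :=
  lintegral_prod f hf.aemeasurable

theorem lintegral_heis_symm {f : Heis → ℝ≥0∞} (hf : Measurable f) :
    ∫⁻ p, f p = ∫⁻ l : ℝ, ∫⁻ q : ℝ × ℝ, f (q, l) :=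
  lintegral_prod_symm f hf.aemeasurable

theorem integral_heis {f : Heis → ℂ} (hf : Integrable f) :
    ∫ p, f p = ∫ q : ℝ × ℝ, ∫ t : ℝ, f (q, t) :=
  integral_prod f hf

theorem lintegral_enorm_centralFT_slice {f : Heis → ℂ} {R : ℝ}
    (hR : ∀ p : Heis, R < |p.2| → f p = 0) {q : ℝ × ℝ} (hq : MemLp (fun t : ℝ => f (q, t)) 2) :
    ∫⁻ t : ℝ, ‖centralFT f (q, t)‖ₑ ^ 2 =
      ENNReal.ofReal (2 * Real.pi) * ∫⁻ t : ℝ, ‖f (q, t)‖ₑ ^ 2 := by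
  have hi : Integrable fun t : ℝ => f (q, t) :=
    integrable_of_memLp_two_of_bounded_support hq fun t ht => hR (q, t) ht
  change ∫⁻ t : ℝ, ‖lineFT (fun s => f (q, s)) t‖ₑ ^ 2 = _
  have h := lintegral_enorm_lineFT_sq hi hq
  exact h

theorem lintegral_enorm_centralFT_sq {f : Heis → ℂ} (hf : Measurable f) (h2 : MemLp f 2) {R : ℝ}
    (hR : ∀ p : Heis, R < |p.2| → f p = 0) :
    ∫⁻ p, ‖centralFT f p‖ₑ ^ 2 = ENNReal.ofReal (2 * Real.pi) * ∫⁻ p, ‖f p‖ₑ ^ 2 := by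
  have hm1 : Measurable fun p => ‖centralFT f p‖ₑ ^ 2 :=
    (measurable_centralFT hf).enorm.pow_const 2
  have hm2 : Measurable fun p => ‖f p‖ₑ ^ 2 := hf.enorm.pow_const 2
  rw [lintegral_heis hm1, lintegral_heis hm2, ← lintegral_const_mul' _ _ ENNReal.ofReal_ne_top]
  exact lintegral_congr_ae ((ae_memLp_slice hf h2).mono fun q hq =>
    lintegral_enorm_centralFT_slice hR hq)

theorem eLpNorm_two_eq {X : Type*} [MeasurableSpace X] {μ : Measure X} (f : X → ℂ) :
    eLpNorm f 2 μ = (∫⁻ p, ‖f p‖ₑ ^ 2 ∂μ) ^ (1 / 2 : ℝ) := by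
  rw [eLpNorm_eq_lintegral_rpow_enorm_toReal (by norm_num) (by norm_num)]
  simp

theorem eLpNorm_centralFT {f : Heis → ℂ} (hf : Measurable f) (h2 : MemLp f 2) {R : ℝ}
    (hR : ∀ p : Heis, R < |p.2| → f p = 0) :
    eLpNorm (centralFT f) 2 = ENNReal.ofReal (√(2 * Real.pi)) * eLpNorm f 2 := by
  rw [eLpNorm_two_eq, eLpNorm_two_eq, lintegral_enorm_centralFT_sq hf h2 hR,
    ENNReal.mul_rpow_of_nonneg _ _ (by norm_num), Real.sqrt_eq_rpow,
    ENNReal.ofReal_rpow_of_nonneg (by positivity) (by norm_num)]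

theorem memLp_centralFT {f : Heis → ℂ} (hf : Measurable f) (h2 : MemLp f 2) {R : ℝ}
    (hR : ∀ p : Heis, R < |p.2| → f p = 0) : MemLp (centralFT f) 2 :=
  ⟨(measurable_centralFT hf).aestronglyMeasurable, by
    rw [eLpNorm_centralFT hf h2 hR]
    exact ENNReal.mul_lt_top ENNReal.ofReal_lt_top h2.2⟩

/-- The indicator function of the slab `-R < t ≤ R`. -/
def slab (R : ℝ) : Heis → ℂ := {p : Heis | p.2 ∈ Set.Ioc (-R) R}.indicator fun _ => 1

theorem measurable_slab (R : ℝ) : Measurable (slab R) :=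
  measurable_const.indicator (measurable_snd measurableSet_Ioc)

theorem norm_slab_le (R : ℝ) (p : Heis) : ‖slab R p‖ ≤ 1 := by
  unfold slab
  refine (norm_indicator_le_norm_self _ _).trans ?_
  simp

theorem slab_eq_zero {R : ℝ} {p : Heis} (hp : R < |p.2|) : slab R p = 0 := by
  refine Set.indicator_of_notMem (fun h => ?_) _
  rw [Set.mem_ofPred_eq, Set.mem_Ioc] at h
  exact absurd (abs_le.2 ⟨h.1.le, h.2⟩) (not_le.2 hp)

theorem slab_eq_one {R : ℝ} {p : Heis} (hp : |p.2| < R) : slab R p = 1 :=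
  Set.indicator_of_mem (s := {p : Heis | p.2 ∈ Set.Ioc (-R) R})
    ⟨(abs_lt.1 hp).1, (abs_lt.1 hp).2.le⟩ _

theorem measurable_coeFn (f : Lp ℂ 2 (volume : Measure Heis)) : Measurable f :=
  (Lp.stronglyMeasurable f).measurable

theorem memLp_slab_mul (R : ℝ) (f : Lp ℂ 2 (volume : Measure Heis)) :
    MemLp (fun p => slab R p * f p) 2 :=
  memLp_two_mul_of_bound (measurable_slab R) (norm_slab_le R) (Lp.memLp f)

theorem memLp_centralFT_slab (R : ℝ) (f : Lp ℂ 2 (volume : Measure Heis)) :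
    MemLp (centralFT fun p => slab R p * f p) 2 :=
  memLp_centralFT ((measurable_slab R).mul (measurable_coeFn f)) (memLp_slab_mul R f) (R := R)
    fun p hp => by rw [slab_eq_zero hp, zero_mul]

theorem ae_integrable_slab_mul (R : ℝ) (f : Lp ℂ 2 (volume : Measure Heis)) :
    ∀ᵐ q : ℝ × ℝ, Integrable fun t : ℝ => slab R (q, t) * f (q, t) := by
  filter_upwards [ae_memLp_slice ((measurable_slab R).mul (measurable_coeFn f))
    (memLp_slab_mul R f)] with q hq
  exact integrable_of_memLp_two_of_bounded_support hq (R := R)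
    fun t ht => by simp only [slab_eq_zero (p := (q, t)) ht, zero_mul]

theorem ae_heis_of_ae_fst {P : ℝ × ℝ → Prop} (h : ∀ᵐ q, P q) :
    ∀ᵐ p : Heis, P p.1 :=
  Measure.quasiMeasurePreserving_fst (μ := (volume : Measure (ℝ × ℝ)))
    (ν := (volume : Measure ℝ)) |>.ae h

theorem ae_heis_of_ae_snd {P : ℝ → Prop} (h : ∀ᵐ l, P l) :
    ∀ᵐ p : Heis, P p.2 :=
  Measure.quasiMeasurePreserving_snd (μ := (volume : Measure (ℝ × ℝ)))
    (ν := (volume : Measure ℝ)) |>.ae h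

theorem ae_ae_of_ae_heis {P : Heis → Prop} (h : ∀ᵐ p, P p) :
    ∀ᵐ q : ℝ × ℝ, ∀ᵐ t : ℝ, P (q, t) :=
  Measure.ae_ae_of_ae_prod h

theorem ae_ae_of_ae_heis_left {P : Heis → Prop} (h : ∀ᵐ p, P p) :
    ∀ᵐ l : ℝ, ∀ᵐ q : ℝ × ℝ, P (q, l) := by
  have h1 : ∀ᵐ p ∂((volume : Measure ℝ).prod (volume : Measure (ℝ × ℝ))), P p.swap :=
    (Measure.measurePreserving_swap (μ := (volume : Measure ℝ))
      (ν := (volume : Measure (ℝ × ℝ)))).quasiMeasurePreserving.ae h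
  exact Measure.ae_ae_of_ae_prod h1

theorem centralFT_congr_ae {f g : Heis → ℂ} (h : f =ᵐ[volume] g) :
    centralFT f =ᵐ[volume] centralFT g := by
  filter_upwards [ae_heis_of_ae_fst (ae_ae_of_ae_heis h)] with p hp
  refine integral_congr_ae ?_
  filter_upwards [hp] with t ht
  simp only [ht]

theorem integrable_exp_mul {g : ℝ → ℂ} (hg : Integrable g) (l : ℝ) :
    Integrable fun t : ℝ => Complex.exp (-Complex.I * (l * t : ℝ)) * g t := by
  refine hg.bdd_mul (c := 1) (by fun_prop) (ae_of_all _ fun t => ?_)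
  rw [neg_mul, mul_comm, ← neg_mul, ← Complex.ofReal_neg, Complex.norm_exp_ofReal_mul_I]

/-- The Fourier integral in the central variable over `-R < t ≤ R`, as a linear map on `L²`. -/
def truncCentralFT (R : ℝ) :
    Lp ℂ 2 (volume : Measure Heis) →ₗ[ℂ] Lp ℂ 2 (volume : Measure Heis) where
  toFun f := (memLp_centralFT_slab R f).toLp _
  map_add' f g := by
    refine Lp.ext ?_
    filter_upwards [(memLp_centralFT_slab R (f + g)).coeFn_toLp,
      Lp.coeFn_add ((memLp_centralFT_slab R f).toLp _) ((memLp_centralFT_slab R g).toLp _),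
      (memLp_centralFT_slab R f).coeFn_toLp, (memLp_centralFT_slab R g).coeFn_toLp,
      ae_heis_of_ae_fst (ae_ae_of_ae_heis (Lp.coeFn_add f g)),
      ae_heis_of_ae_fst (ae_integrable_slab_mul R f),
      ae_heis_of_ae_fst (ae_integrable_slab_mul R g)] with p h1 h2 h3 h4 h5 h6 h7
    rw [h1, h2, Pi.add_apply, h3, h4]
    simp only [centralFT, lineFT]
    rw [← integral_add (integrable_exp_mul h6 _) (integrable_exp_mul h7 _)]
    refine integral_congr_ae ?_
    filter_upwards [h5] with t ht
    rw [ht, Pi.add_apply]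
    ring
  map_smul' c f := by
    refine Lp.ext ?_
    filter_upwards [(memLp_centralFT_slab R (c • f)).coeFn_toLp,
      Lp.coeFn_smul c ((memLp_centralFT_slab R f).toLp _),
      (memLp_centralFT_slab R f).coeFn_toLp,
      ae_heis_of_ae_fst (ae_ae_of_ae_heis (Lp.coeFn_smul c f))] with p h1 h2 h3 h5
    rw [RingHom.id_apply, h1, h2, Pi.smul_apply, h3]
    simp only [centralFT, lineFT]
    rw [smul_eq_mul, ← integral_const_mul]
    refine integral_congr_ae ?_
    filter_upwards [h5] with t ht
    rw [ht, Pi.smul_apply, smul_eq_mul]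
    ring

theorem coeFn_truncCentralFT (R : ℝ) (f : Lp ℂ 2 (volume : Measure Heis)) :
    truncCentralFT R f =ᵐ[volume] centralFT fun p => slab R p * f p :=
  (memLp_centralFT_slab R f).coeFn_toLp

/-- Multiplication by the indicator function of a slab. -/
def slabMul (R : ℝ) : Lp ℂ 2 (volume : Measure Heis) →L[ℂ] Lp ℂ 2 (volume : Measure Heis) :=
  mulL2 (slab R) (measurable_slab R) 1 (norm_slab_le R)

theorem coeFn_slabMul (R : ℝ) (f : Lp ℂ 2 (volume : Measure Heis)) :
    slabMul R f =ᵐ[volume] fun p => slab R p * f p :=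
  coeFn_mulL2 _ _ _ _

/-- The restriction of `f` to a slab is integrable in the central variable almost everywhere, so
that Plancherel applies on each line. -/
theorem norm_truncCentralFT (R : ℝ) (f : Lp ℂ 2 (volume : Measure Heis)) :
    ‖truncCentralFT R f‖ = √(2 * Real.pi) * ‖slabMul R f‖ := by
  rw [Lp.norm_def, Lp.norm_def, eLpNorm_congr_ae (coeFn_truncCentralFT R f),
    eLpNorm_congr_ae (coeFn_slabMul R f),
    eLpNorm_centralFT (f := fun p => slab R p * f p)
      ((measurable_slab R).mul (measurable_coeFn f)) (memLp_slab_mul R f) (R := R)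
      fun p hp => by rw [slab_eq_zero hp, zero_mul],
    ENNReal.toReal_mul, ENNReal.toReal_ofReal (Real.sqrt_nonneg _)]

theorem slab_mul_slab {R R' : ℝ} (h : R ≤ R') (p : Heis) : slab R' p * slab R p = slab R p := by
  by_cases hp : p.2 ∈ Set.Ioc (-R) R
  · have hp' : p.2 ∈ Set.Ioc (-R') R' := ⟨by linarith [hp.1], hp.2.trans h⟩
    rw [slab, Set.indicator_of_mem (by exact hp'), one_mul]
  · have : slab R p = 0 := Set.indicator_of_notMem (by exact hp) _
    rw [this, mul_zero]

theorem slabMul_slabMul {R R' : ℝ} (h : R ≤ R') (f : Lp ℂ 2 (volume : Measure Heis)) :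
    slabMul R' (slabMul R f) = slabMul R f := by
  refine Lp.ext ?_
  filter_upwards [coeFn_slabMul R' (slabMul R f), coeFn_slabMul R f] with p h1 h2
  rw [h1, h2, ← mul_assoc, slab_mul_slab h]

theorem truncCentralFT_slabMul {R R' : ℝ} (h : R ≤ R') (f : Lp ℂ 2 (volume : Measure Heis)) :
    truncCentralFT R' (slabMul R f) = truncCentralFT R f := by
  refine Lp.ext ?_
  refine (coeFn_truncCentralFT _ _).trans (EventuallyEq.trans ?_ (coeFn_truncCentralFT _ _).symm)
  refine centralFT_congr_ae ?_
  filter_upwards [coeFn_slabMul R f] with p h2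
  rw [h2, ← mul_assoc, slab_mul_slab h]

/-- Bounded multipliers converging pointwise to `1` converge strongly to the identity. -/
theorem tendsto_mul_of_tendsto_one {Z ι : Type*} [MeasurableSpace Z] {μ : Measure Z}
    {l : Filter ι} [l.IsCountablyGenerated] {b : ι → Z → ℂ} (hb : ∀ i, Measurable (b i))
    {C : ℝ} (hC : ∀ i z, ‖b i z‖ ≤ C) (hlim : ∀ z, Tendsto (fun i => b i z) l (𝓝 1))
    (f : Lp ℂ 2 μ) : Tendsto (fun i => mulL2 (b i) (hb i) C (hC i) f) l (𝓝 f) := by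
  rw [Lp.tendsto_Lp_iff_tendsto_eLpNorm']
  have h1 : ∀ i, eLpNorm (⇑(mulL2 (b i) (hb i) C (hC i) f) - ⇑f) 2 μ =
      (∫⁻ z, ‖(b i z - 1) * f z‖ₑ ^ 2 ∂μ) ^ (1 / 2 : ℝ) := by
    intro i
    rw [eLpNorm_two_eq]
    congr 1
    refine lintegral_congr_ae ?_
    filter_upwards [coeFn_mulL2 (hb i) C (hC i) f] with z hz
    rw [Pi.sub_apply, hz, sub_mul, one_mul]
  simp only [h1]
  have hf := (Lp.stronglyMeasurable f).measurable
  have hfin : ∫⁻ z, (ENNReal.ofReal (C + 1) * ‖f z‖ₑ) ^ 2 ∂μ ≠ ⊤ := by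
    simp only [mul_pow]
    rw [lintegral_const_mul' _ _ (by simp)]
    refine ENNReal.mul_ne_top (by simp) ?_
    have := (eLpNorm_lt_top_iff_lintegral_rpow_enorm_lt_top (p := 2) (by norm_num)
      (by norm_num)).1 (Lp.memLp f).2
    simpa using this.ne
  have hl : Tendsto (fun i => ∫⁻ z, ‖(b i z - 1) * f z‖ₑ ^ 2 ∂μ) l (𝓝 (∫⁻ _, 0 ∂μ)) := by
    refine tendsto_lintegral_filter_of_dominated_convergence _
      (Eventually.of_forall fun i => ((((hb i).sub_const 1).mul hf).enorm.pow_const 2))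
      (Eventually.of_forall fun i => ae_of_all _ fun z => ?_) hfin (ae_of_all _ fun z => ?_)
    · gcongr
      rw [enorm_mul]
      gcongr
      rw [← ofReal_norm]
      refine ENNReal.ofReal_le_ofReal ((norm_sub_le _ _).trans ?_)
      rw [norm_one]
      linarith [hC i z]
    · have h2 : Tendsto (fun i => (b i z - 1) * f z) l (𝓝 ((1 - 1) * f z)) :=
        ((hlim z).sub_const 1).mul_const _
      have h3 := ENNReal.Tendsto.pow (n := 2) h2.enorm
      simpa using h3
  simpa using hl.ennrpow_const (1 / 2 : ℝ)

theorem tendsto_slabMul (f : Lp ℂ 2 (volume : Measure Heis)) :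
    Tendsto (fun R => slabMul R f) atTop (𝓝 f) := by
  refine tendsto_mul_of_tendsto_one measurable_slab norm_slab_le (fun p => ?_) f
  refine tendsto_const_nhds.congr' ?_
  filter_upwards [eventually_gt_atTop |p.2|] with R hR
  rw [slab_eq_one hR]

theorem norm_truncCentralFT_sub {R R' : ℝ} (h : R ≤ R') (f : Lp ℂ 2 (volume : Measure Heis)) :
    ‖truncCentralFT R' f - truncCentralFT R f‖ =
      √(2 * Real.pi) * ‖slabMul R' f - slabMul R f‖ := by
  rw [← truncCentralFT_slabMul h, ← map_sub, norm_truncCentralFT, map_sub, slabMul_slabMul h]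

/-- The truncated transforms are Cauchy, because they are a constant multiple of an isometry applied
to the restrictions of `f` to slabs. -/
theorem exists_tendsto_truncCentralFT (f : Lp ℂ 2 (volume : Measure Heis)) :
    ∃ F, Tendsto (fun R => truncCentralFT R f) atTop (𝓝 F) := by
  have h1 : CauchySeq fun R => slabMul R f := (tendsto_slabMul f).cauchySeq
  have h2 : CauchySeq fun R => truncCentralFT R f := by
    rw [Metric.cauchySeq_iff'] at h1 ⊢
    intro ε hε
    obtain ⟨N, hN⟩ := h1 (ε / √(2 * Real.pi)) (by positivity)
    refine ⟨N, fun R hR => ?_⟩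
    rw [dist_eq_norm, norm_truncCentralFT_sub hR, ← dist_eq_norm]
    have := hN R hR
    rwa [lt_div_iff₀' (by positivity)] at this
  exact cauchySeq_tendsto_of_complete h2

/-- The Fourier transform in the central variable on `L²`, with the kernel `e^{-ilt}` and no
normalising factor, as the limit of the truncated transforms. -/
def centralFourier : Lp ℂ 2 (volume : Measure Heis) →ₗ[ℂ] Lp ℂ 2 (volume : Measure Heis) where
  toFun f := (exists_tendsto_truncCentralFT f).choose
  map_add' f g := by
    refine tendsto_nhds_unique (exists_tendsto_truncCentralFT (f + g)).choose_spec ?_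
    simp only [map_add]
    exact (exists_tendsto_truncCentralFT f).choose_spec.add
      (exists_tendsto_truncCentralFT g).choose_spec
  map_smul' c f := by
    refine tendsto_nhds_unique (exists_tendsto_truncCentralFT (c • f)).choose_spec ?_
    simp only [map_smul]
    exact (exists_tendsto_truncCentralFT f).choose_spec.const_smul c

theorem tendsto_truncCentralFT (f : Lp ℂ 2 (volume : Measure Heis)) :
    Tendsto (fun R => truncCentralFT R f) atTop (𝓝 (centralFourier f)) :=
  (exists_tendsto_truncCentralFT f).choose_spec

theorem norm_centralFourier (f : Lp ℂ 2 (volume : Measure Heis)) :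
    ‖centralFourier f‖ = √(2 * Real.pi) * ‖f‖ := by
  refine tendsto_nhds_unique (tendsto_truncCentralFT f).norm ?_
  simp only [norm_truncCentralFT]
  exact (tendsto_slabMul f).norm.const_mul _

/-- The limit of the integrals over `[-R, R]` is unique and always exists. -/
theorem isCentralFourier_iff (f F : Lp ℂ 2 (volume : Measure Heis)) :
    IsCentralFourier f F ↔ F = centralFourier f := by
  have key : ∀ᶠ R : ℝ in atTop, eLpNorm (fun p : Heis => F p -
      ∫ t in (-R)..R, Complex.exp (-Complex.I * (p.2 * t : ℝ)) * f (p.1, t)) 2 volume =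
      eLpNorm (⇑(truncCentralFT R f) - ⇑F) 2 volume := by
    filter_upwards [eventually_ge_atTop 0] with R hR
    rw [← eLpNorm_neg]
    refine eLpNorm_congr_ae ?_
    filter_upwards [coeFn_truncCentralFT R f] with p hp
    rw [Pi.neg_apply, Pi.sub_apply, hp, neg_sub, intervalIntegral.integral_of_le (by linarith),
      ← integral_indicator measurableSet_Ioc, centralFT, lineFT]
    congr 1
    refine integral_congr_ae (ae_of_all _ fun t => ?_)
    by_cases ht : t ∈ Set.Ioc (-R) R
    · rw [Set.indicator_of_mem ht]
      simp only [slab]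
      rw [Set.indicator_of_mem (by exact ht), one_mul]
    · rw [Set.indicator_of_notMem ht]
      simp only [slab]
      rw [Set.indicator_of_notMem (by exact ht), zero_mul, mul_zero]
  rw [IsCentralFourier, tendsto_congr' key, ← Lp.tendsto_Lp_iff_tendsto_eLpNorm']
  exact ⟨fun h => tendsto_nhds_unique h (tendsto_truncCentralFT f),
    fun h => h ▸ tendsto_truncCentralFT f⟩

/-- For functions of bounded support in the central variable the Fourier transform is given by
the Fourier integral. -/
theorem coeFn_centralFourier_toLp {f : Heis → ℂ} (hf : MemLp f 2) {R : ℝ}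
    (hR : ∀ p : Heis, R < |p.2| → f p = 0) :
    centralFourier (hf.toLp f) =ᵐ[volume] centralFT f := by
  have h1 : ∀ᶠ R' : ℝ in atTop,
      truncCentralFT R' (hf.toLp f) = truncCentralFT (R + 1) (hf.toLp f) := by
    filter_upwards [eventually_ge_atTop (R + 1)] with R' hR'
    rw [← truncCentralFT_slabMul hR']
    congr 1
    refine Lp.ext ?_
    filter_upwards [coeFn_slabMul (R + 1) (hf.toLp f), hf.coeFn_toLp] with p h2 h3
    rw [h2, h3]
    by_cases hp : |p.2| < R + 1
    · rw [slab_eq_one hp, one_mul]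
    · rw [hR p (by linarith), mul_zero]
  have h2 : centralFourier (hf.toLp f) = truncCentralFT (R + 1) (hf.toLp f) :=
    tendsto_nhds_unique (tendsto_truncCentralFT _)
      (tendsto_const_nhds.congr' (h1.mono fun _ h => h.symm))
  rw [h2]
  refine (coeFn_truncCentralFT _ _).trans (centralFT_congr_ae ?_)
  filter_upwards [hf.coeFn_toLp] with p h3
  rw [h3]
  by_cases hp : |p.2| < R + 1
  · rw [slab_eq_one hp, one_mul]
  · rw [hR p (by linarith), mul_zero]

/-- The bilinear pairing `(f, g) ↦ ∫ f g` on `L²`. The Fourier transform is symmetric for it,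
whereas for the inner product its adjoint is another transform. -/
def bilinPairing : Lp ℂ 2 (volume : Measure Heis) →L[ℂ] Lp ℂ 2 (volume : Measure Heis) →L[ℂ] ℂ :=
  (ContinuousLinearMap.mul ℂ ℂ).lpPairing volume 2 2

theorem bilinPairing_apply (f g : Lp ℂ 2 (volume : Measure Heis)) :
    bilinPairing f g = ∫ p, f p * g p := by
  rw [bilinPairing, ContinuousLinearMap.lpPairing_eq_integral]
  rfl

/-- Truncating both arguments to the same slab makes Fubini available on each line. -/
theorem bilinPairing_truncCentralFT (R : ℝ) (f g : Lp ℂ 2 (volume : Measure Heis)) :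
    bilinPairing (truncCentralFT R f) (slabMul R g) =
      bilinPairing (slabMul R f) (truncCentralFT R g) := by
  have hint : ∀ f g : Lp ℂ 2 (volume : Measure Heis), Integrable (fun p => f p * g p) := fun f g =>
    MemLp.integrable_mul (Lp.memLp f) (Lp.memLp g)
  rw [bilinPairing_apply, bilinPairing_apply, integral_heis (hint _ _), integral_heis (hint _ _)]
  refine integral_congr_ae ?_
  filter_upwards [ae_integrable_slab_mul R f, ae_integrable_slab_mul R g,
    ae_ae_of_ae_heis (coeFn_truncCentralFT R f), ae_ae_of_ae_heis (coeFn_truncCentralFT R g),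
    ae_ae_of_ae_heis (coeFn_slabMul R f), ae_ae_of_ae_heis (coeFn_slabMul R g)]
    with q h1 h2 h3 h4 h5 h6
  refine Eq.trans (integral_congr_ae ?_) ((integral_lineFT_mul h1 h2).trans (integral_congr_ae ?_))
  · filter_upwards [h3, h6] with t h7 h8
    rw [h7, h8]; rfl
  · filter_upwards [h4, h5] with t h7 h8
    rw [h7, h8]; rfl

theorem bilinPairing_centralFourier (f g : Lp ℂ 2 (volume : Measure Heis)) :
    bilinPairing (centralFourier f) g = bilinPairing f (centralFourier g) := by
  have h : ∀ {a b : ℝ → Lp ℂ 2 (volume : Measure Heis)} {a₀ b₀ : Lp ℂ 2 (volume : Measure Heis)},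
      Tendsto a atTop (𝓝 a₀) → Tendsto b atTop (𝓝 b₀) →
      Tendsto (fun R => bilinPairing (a R) (b R)) atTop (𝓝 (bilinPairing a₀ b₀)) := fun ha hb =>
    by
    have h1 := (bilinPairing.continuous₂.tendsto (_, _)).comp (ha.prodMk_nhds hb)
    exact h1
  refine tendsto_nhds_unique (h (tendsto_truncCentralFT f) (tendsto_slabMul g)) ?_
  simp only [bilinPairing_truncCentralFT]
  exact h (tendsto_slabMul f) (tendsto_truncCentralFT g)

theorem bilinPairing_star (f g : Lp ℂ 2 (volume : Measure Heis)) :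
    bilinPairing (star f) g = ⟪f, g⟫_ℂ := by
  rw [bilinPairing_apply, L2.inner_def]
  have h : ∀ᵐ p, (star f : Lp ℂ 2 (volume : Measure Heis)) p = conj (f p) := Lp.coeFn_star f
  refine integral_congr_ae (h.mono fun p hp => ?_)
  simp only [hp, RCLike.inner_apply']

theorem star_zero_lp : star (0 : Lp ℂ 2 (volume : Measure Heis)) = 0 := by
  refine Lp.ext ?_
  filter_upwards [Lp.coeFn_star (0 : Lp ℂ 2 (volume : Measure Heis)),
    Lp.coeFn_zero ℂ 2 (volume : Measure Heis)] with p h8 h9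
  rw [h8, Pi.star_apply, h9, Pi.zero_apply, star_zero]

/-- The unitary multiple of the Fourier transform in the central variable. -/
def centralIsometry :
    Lp ℂ 2 (volume : Measure Heis) →ₗᵢ[ℂ] Lp ℂ 2 (volume : Measure Heis) where
  toLinearMap := ((√(2 * Real.pi))⁻¹ : ℂ) • centralFourier
  norm_map' f := by
    rw [LinearMap.smul_apply, norm_smul, norm_centralFourier, norm_inv, Complex.norm_real,
      Real.norm_of_nonneg (Real.sqrt_nonneg _), ← mul_assoc, inv_mul_cancel₀ (by positivity),
      one_mul]

/-- The transform is symmetric for the bilinear pairing and norm preserving, so that nothing is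
orthogonal to its range. -/
theorem surjective_centralIsometry : Function.Surjective centralIsometry := by
  have hcl : IsClosed ((LinearMap.range centralIsometry.toLinearMap : Submodule ℂ _) :
      Set (Lp ℂ 2 (volume : Measure Heis))) := by
    rw [LinearMap.coe_range]
    exact centralIsometry.isometry.isClosedEmbedding.isClosed_range
  have hbot : (LinearMap.range centralIsometry.toLinearMap)ᗮ = ⊥ := by
    rw [Submodule.eq_bot_iff]
    intro y hy
    have h1 : ∀ f, bilinPairing (star y) (centralFourier f) = 0 := fun f => by
      have h2 := inner_eq_zero_symm.1 ((Submodule.mem_orthogonal _ _).1 hy _ ⟨f, rfl⟩)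
      have h3 : ⟪y, ((√(2 * Real.pi))⁻¹ : ℂ) • centralFourier f⟫_ℂ = 0 := h2
      rw [inner_smul_right, mul_eq_zero, or_iff_right] at h3
      · rw [bilinPairing_star, h3]
      · rw [inv_eq_zero, Complex.ofReal_eq_zero]; positivity
    have h4 : centralFourier (star y) = 0 := by
      have h5 := h1 (star (centralFourier (star y)))
      rw [← bilinPairing_centralFourier] at h5
      have h6 := bilinPairing_star (star (centralFourier (star y))) (star (centralFourier (star y)))
      rw [star_star, h5] at h6
      have h7 := inner_self_eq_zero.1 h6.symm
      rw [← star_star (centralFourier (star y)), h7]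
      exact star_zero_lp
    have h5 := norm_centralFourier (star y)
    rw [h4, norm_zero, eq_comm, mul_eq_zero, or_iff_right (by positivity), norm_eq_zero] at h5
    rw [← star_star y, h5]
    exact star_zero_lp
  have htop : LinearMap.range centralIsometry.toLinearMap = ⊤ := by
    have := (Submodule.topologicalClosure_eq_top_iff).2 hbot
    rwa [hcl.submodule_topologicalClosure_eq] at this
  exact LinearMap.range_eq_top.1 htop

/-- The unitary multiple of the Fourier transform in the central variable, as an equivalence. -/
def centralUnitary :
    Lp ℂ 2 (volume : Measure Heis) ≃ₗᵢ[ℂ] Lp ℂ 2 (volume : Measure Heis) :=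
  LinearIsometryEquiv.ofSurjective centralIsometry surjective_centralIsometry

theorem centralUnitary_apply (f : Lp ℂ 2 (volume : Measure Heis)) :
    centralUnitary f = ((√(2 * Real.pi))⁻¹ : ℂ) • centralFourier f := rfl

end Central

/-! ### Hermite functions -/

section Hermite

/-- The Hermite functions `(-1)ⁿ e^{x²/2} (dⁿ/dxⁿ) e^{-x²}`, not normalised. -/
def rawHermite (n : ℕ) (x : ℝ) : ℝ :=
  (-1) ^ n * Real.exp (x ^ 2 / 2) * iteratedDeriv n (fun s : ℝ => Real.exp (-s ^ 2)) x

/-- The `L²` norm of `rawHermite n`. -/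
def hermiteNorm (n : ℕ) : ℝ := √(2 ^ n * (n.factorial : ℝ) * √Real.pi)

theorem hermiteNorm_pos (n : ℕ) : 0 < hermiteNorm n := by
  unfold hermiteNorm
  have := Real.pi_pos
  have := n.factorial_pos
  positivity

theorem hermiteNorm_sq (n : ℕ) : hermiteNorm n ^ 2 = 2 ^ n * (n.factorial : ℝ) * √Real.pi :=
  Real.sq_sqrt (by positivity)

theorem hermiteFun_eq (n : ℕ) (x : ℝ) : hermiteFun n x = (hermiteNorm n)⁻¹ * rawHermite n x := by
  rw [hermiteFun, rawHermite, hermiteNorm]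
  have h : Real.exp (x ^ 2 / 2) = Real.exp (-x ^ 2 / 2) * Real.exp (x ^ 2) := by
    rw [← Real.exp_add]; congr 1; ring
  rw [h]; ring

theorem hasDerivAt_iteratedDeriv_exp_neg_sq (n : ℕ) (x : ℝ) :
    HasDerivAt (iteratedDeriv n fun s : ℝ => Real.exp (-s ^ 2))
      (iteratedDeriv (n + 1) (fun s : ℝ => Real.exp (-s ^ 2)) x) x := by
  rw [iteratedDeriv_succ]
  have h : ContDiff ℝ ((n + 1 : ℕ) : WithTop ℕ∞) fun s : ℝ => Real.exp (-s ^ 2) := by fun_prop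
  exact ((h.differentiable_iteratedDeriv n (by exact_mod_cast n.lt_succ_self)) x).hasDerivAt

theorem iteratedDeriv_exp_neg_sq_succ (n : ℕ) (x : ℝ) :
    iteratedDeriv (n + 1) (fun s : ℝ => Real.exp (-s ^ 2)) x =
      -2 * x * iteratedDeriv n (fun s : ℝ => Real.exp (-s ^ 2)) x -
        2 * n * iteratedDeriv (n - 1) (fun s : ℝ => Real.exp (-s ^ 2)) x := by
  induction n generalizing x with
  | zero =>
    have h : HasDerivAt (fun s : ℝ => Real.exp (-s ^ 2)) (Real.exp (-x ^ 2) * (-(2 * x))) x := by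
      have := ((hasDerivAt_pow 2 x).neg).exp
      simpa using this
    rw [iteratedDeriv_one, iteratedDeriv_zero, h.deriv]
    simp; ring
  | succ n ih =>
    have h1 : HasDerivAt (fun x => -2 * x * iteratedDeriv n (fun s : ℝ => Real.exp (-s ^ 2)) x -
        2 * n * iteratedDeriv (n - 1) (fun s : ℝ => Real.exp (-s ^ 2)) x)
        ((-2 * 1) * iteratedDeriv n (fun s : ℝ => Real.exp (-s ^ 2)) x +
          -2 * x * iteratedDeriv (n + 1) (fun s : ℝ => Real.exp (-s ^ 2)) x -
        2 * n * iteratedDeriv (n - 1 + 1) (fun s : ℝ => Real.exp (-s ^ 2)) x) x :=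
      (((hasDerivAt_id x).const_mul (-2)).mul (hasDerivAt_iteratedDeriv_exp_neg_sq n x)).sub
        ((hasDerivAt_iteratedDeriv_exp_neg_sq (n - 1) x).const_mul _)
    have e := (congrArg (fun F => deriv F x) (funext ih)).trans h1.deriv
    rw [iteratedDeriv_succ, e]
    rcases n with _ | n
    · simp; ring
    · simp; ring

theorem rawHermite_zero (x : ℝ) : rawHermite 0 x = Real.exp (-x ^ 2 / 2) := by
  rw [rawHermite, iteratedDeriv_zero, pow_zero, one_mul, ← Real.exp_add]
  congr 1; ring

/-- The three-term recurrence; for `n = 0` the term with the truncated index `n - 1` carries the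
factor `0`. -/
theorem rawHermite_succ (n : ℕ) (x : ℝ) :
    rawHermite (n + 1) x = 2 * x * rawHermite n x - 2 * n * rawHermite (n - 1) x := by
  rw [rawHermite, iteratedDeriv_exp_neg_sq_succ]
  rcases n with _ | n
  · simp [rawHermite]; ring
  · simp only [rawHermite, Nat.add_sub_cancel]; ring

/-- The creation operator `x - d/dx` raises the index. -/
theorem hasDerivAt_rawHermite (n : ℕ) (x : ℝ) :
    HasDerivAt (rawHermite n) (x * rawHermite n x - rawHermite (n + 1) x) x := by
  have h1 : HasDerivAt (fun x : ℝ => Real.exp (x ^ 2 / 2)) (Real.exp (x ^ 2 / 2) * x) x := by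
    have := ((hasDerivAt_pow 2 x).div_const 2).exp
    simpa using this
  have h2 := (h1.const_mul ((-1) ^ n)).mul (hasDerivAt_iteratedDeriv_exp_neg_sq n x)
  refine h2.congr_deriv ?_
  simp only [rawHermite]; ring

/-- The annihilation operator `x + d/dx` lowers the index. -/
theorem hasDerivAt_rawHermite' (n : ℕ) (x : ℝ) :
    HasDerivAt (rawHermite n) (-x * rawHermite n x + 2 * n * rawHermite (n - 1) x) x := by
  refine (hasDerivAt_rawHermite n x).congr_deriv ?_
  rw [rawHermite_succ]; ring

/-- The Hermite equation `f'' = (x² - (2n + 1)) f`, with `f'` written by means of the creation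
operator. -/
theorem hasDerivAt_deriv_rawHermite (n : ℕ) (x : ℝ) :
    HasDerivAt (fun x => x * rawHermite n x - rawHermite (n + 1) x)
      ((x ^ 2 - (2 * n + 1)) * rawHermite n x) x := by
  refine (((hasDerivAt_id x).mul (hasDerivAt_rawHermite n x)).sub
    (hasDerivAt_rawHermite' (n + 1) x)).congr_deriv ?_
  simp only [id, Nat.add_sub_cancel]; push_cast; ring

theorem exists_polynomial_rawHermite (n : ℕ) :
    ∃ P : Polynomial ℝ, ∀ x, rawHermite n x = P.eval x * Real.exp (-x ^ 2 / 2) := by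
  induction n using Nat.strong_induction_on with
  | _ n ih =>
    rcases n with _ | n
    · exact ⟨1, fun x => by rw [rawHermite_zero]; simp⟩
    · obtain ⟨P, hP⟩ := ih n (by omega)
      obtain ⟨P', hP'⟩ := ih (n - 1) (by omega)
      refine ⟨Polynomial.C 2 * Polynomial.X * P - Polynomial.C (2 * (n : ℝ)) * P', fun x => ?_⟩
      rw [rawHermite_succ, hP, hP']
      simp; ring

theorem integrable_polynomial_mul_exp_neg_sq (P : Polynomial ℝ) :
    Integrable fun x : ℝ => P.eval x * Real.exp (-x ^ 2) := by
  induction P using Polynomial.induction_on' with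
  | add p q hp hq =>
    refine (hp.add hq).congr (ae_of_all _ fun x => ?_)
    simp only [Pi.add_apply, Polynomial.eval_add]; ring
  | monomial n a =>
    have h := integrable_rpow_mul_exp_neg_mul_sq (b := 1) one_pos (s := n)
      (by have : (0 : ℝ) ≤ n := n.cast_nonneg
          linarith)
    refine (h.const_mul a).congr (ae_of_all _ fun x => ?_)
    simp only [Polynomial.eval_monomial, Real.rpow_natCast]
    rw [mul_assoc]; simp

theorem integrable_polynomial_mul_rawHermite_mul (P : Polynomial ℝ) (n m : ℕ) :
    Integrable fun x : ℝ => P.eval x * (rawHermite n x * rawHermite m x) := by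
  obtain ⟨A, hA⟩ := exists_polynomial_rawHermite n
  obtain ⟨B, hB⟩ := exists_polynomial_rawHermite m
  refine (integrable_polynomial_mul_exp_neg_sq (P * A * B)).congr (ae_of_all _ fun x => ?_)
  have h : Real.exp (-x ^ 2) = Real.exp (-x ^ 2 / 2) * Real.exp (-x ^ 2 / 2) := by
    rw [← Real.exp_add]; congr 1; ring
  simp only [hA, hB, h, Polynomial.eval_mul]; ring

theorem integrable_rawHermite_mul (n m : ℕ) :
    Integrable fun x : ℝ => rawHermite n x * rawHermite m x := by
  simpa using integrable_polynomial_mul_rawHermite_mul 1 n m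

/-- The creation and annihilation operators are adjoint to each other; orthogonality follows by
induction. -/
theorem integral_rawHermite_succ_mul (n m : ℕ) :
    ∫ x, rawHermite (n + 1) x * rawHermite m x =
      2 * m * ∫ x, rawHermite n x * rawHermite (m - 1) x := by
  have hx : Integrable fun x : ℝ => x * (rawHermite n x * rawHermite m x) := by
    simpa using integrable_polynomial_mul_rawHermite_mul Polynomial.X n m
  have h1 := integrable_rawHermite_mul (n + 1) m
  have h2 := (integrable_rawHermite_mul n (m - 1)).const_mul (2 * (m : ℝ))
  have hparts := integral_mul_deriv_eq_deriv_mul_of_integrable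
    (fun x _ => hasDerivAt_rawHermite n x) (fun x _ => hasDerivAt_rawHermite' m x)
    ((h2.sub hx).congr (ae_of_all _ fun x => by simp only [Pi.sub_apply, Pi.mul_apply]; ring))
    ((hx.sub h1).congr (ae_of_all _ fun x => by simp only [Pi.sub_apply, Pi.mul_apply]; ring))
    (integrable_rawHermite_mul n m)
  have e1 : ∫ x, rawHermite n x * (-x * rawHermite m x + 2 * m * rawHermite (m - 1) x) =
      2 * m * (∫ x, rawHermite n x * rawHermite (m - 1) x) -
        ∫ x, x * (rawHermite n x * rawHermite m x) := by
    rw [← integral_const_mul, ← integral_sub h2 hx]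
    refine integral_congr_ae (ae_of_all _ fun x => ?_)
    simp only; ring
  have e2 : ∫ x, (x * rawHermite n x - rawHermite (n + 1) x) * rawHermite m x =
      (∫ x, x * (rawHermite n x * rawHermite m x)) -
        ∫ x, rawHermite (n + 1) x * rawHermite m x := by
    rw [← integral_sub hx h1]
    refine integral_congr_ae (ae_of_all _ fun x => ?_)
    simp only; ring
  rw [e1, e2] at hparts
  linarith

theorem integral_rawHermite_mul (n m : ℕ) :
    ∫ x, rawHermite n x * rawHermite m x = if n = m then hermiteNorm n ^ 2 else 0 := by
  induction n generalizing m with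
  | zero =>
    rcases m with _ | m
    · simp only [rawHermite_zero, if_true, hermiteNorm_sq]
      have := integral_gaussian 1
      simp only [div_one] at this
      simp only [pow_zero, Nat.factorial_zero, Nat.cast_one, one_mul, ← this]
      refine integral_congr_ae (ae_of_all _ fun x => ?_)
      simp only [← Real.exp_add]; congr 1; ring
    · have h := integral_rawHermite_succ_mul m 0
      rw [if_neg (by omega)]
      simp only [mul_comm (rawHermite 0 _)]
      rw [h]; simp
  | succ n ih =>
    rw [integral_rawHermite_succ_mul]
    rcases m with _ | m
    · simp
    · rw [Nat.add_sub_cancel, ih]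
      by_cases h : n = m
      · subst h
        rw [if_pos rfl, if_pos rfl, hermiteNorm_sq, hermiteNorm_sq, Nat.factorial_succ]
        push_cast; ring
      · rw [if_neg h, if_neg (by omega), mul_zero]

theorem integral_hermiteFun_mul (n m : ℕ) :
    ∫ x, hermiteFun n x * hermiteFun m x = if n = m then 1 else 0 := by
  have h : ∀ x, hermiteFun n x * hermiteFun m x =
      ((hermiteNorm n)⁻¹ * (hermiteNorm m)⁻¹) * (rawHermite n x * rawHermite m x) := fun x => by
    rw [hermiteFun_eq, hermiteFun_eq]; ring
  simp only [h]
  rw [integral_const_mul, integral_rawHermite_mul]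
  by_cases hnm : n = m
  · subst hnm
    have := (hermiteNorm_pos n).ne'
    rw [if_pos rfl, if_pos rfl]; field_simp
  · rw [if_neg hnm, if_neg hnm, mul_zero]

theorem contDiff_rawHermite (n : ℕ) : ContDiff ℝ ∞ (rawHermite n) := by
  obtain ⟨P, hP⟩ := exists_polynomial_rawHermite n
  rw [funext hP]
  have h : ContDiff ℝ ∞ fun x => P.eval x := by
    simpa using P.contDiff_aeval (𝕜 := ℝ) ∞
  exact h.mul (by fun_prop)

end Hermite

/-! ### Polynomials times a Gaussian in the plane -/

section PolyGauss

/-- The quadratic form `a x² + 2 b x y + c y²` with complex coefficients. -/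
def quadForm (a b c : ℂ) (q : ℝ × ℝ) : ℂ := a * q.1 ^ 2 + 2 * b * q.1 * q.2 + c * q.2 ^ 2

/-- The real part of the quadratic form is negative definite. -/
def IsNegQuad (a b c : ℂ) : Prop :=
  ∃ ε > 0, ∀ q : ℝ × ℝ, (quadForm a b c q).re ≤ -ε * (q.1 ^ 2 + q.2 ^ 2)

/-- The products of the Gaussian `exp (a x² + 2 b x y + c y²)` with polynomials in `x`, `y`. -/
inductive PolyGauss (a b c : ℂ) : (ℝ × ℝ → ℂ) → Prop
  | base : PolyGauss a b c fun q => Complex.exp (quadForm a b c q)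
  | add {f g : ℝ × ℝ → ℂ} : PolyGauss a b c f → PolyGauss a b c g →
      PolyGauss a b c fun q => f q + g q
  | const_mul (k : ℂ) {f : ℝ × ℝ → ℂ} : PolyGauss a b c f → PolyGauss a b c fun q => k * f q
  | fst_mul {f : ℝ × ℝ → ℂ} : PolyGauss a b c f → PolyGauss a b c fun q => (q.1 : ℂ) * f q
  | snd_mul {f : ℝ × ℝ → ℂ} : PolyGauss a b c f → PolyGauss a b c fun q => (q.2 : ℂ) * f q

variable {a b c : ℂ} {f : ℝ × ℝ → ℂ}

theorem PolyGauss.contDiff (hf : PolyGauss a b c f) : ContDiff ℝ ∞ f := by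
  have h1 : ContDiff ℝ ∞ fun q : ℝ × ℝ => (q.1 : ℂ) := Complex.ofRealCLM.contDiff.comp contDiff_fst
  have h2 : ContDiff ℝ ∞ fun q : ℝ × ℝ => (q.2 : ℂ) := Complex.ofRealCLM.contDiff.comp contDiff_snd
  induction hf with
  | base => unfold quadForm; fun_prop
  | add _ _ h h' => exact h.add h'
  | const_mul k _ h => exact contDiff_const.mul h
  | fst_mul _ h => exact h1.mul h
  | snd_mul _ h => exact h2.mul h

theorem PolyGauss.exists_hasDerivAt_fst (hf : PolyGauss a b c f) : ∃ f', PolyGauss a b c f' ∧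
    ∀ x y, HasDerivAt (fun s : ℝ => f (s, y)) (f' (x, y)) x := by
  induction hf with
  | base =>
    refine ⟨_, ((PolyGauss.base.fst_mul).const_mul (2 * a)).add
      ((PolyGauss.base.snd_mul).const_mul (2 * b)), fun x y => ?_⟩
    have hx : HasDerivAt (fun s : ℝ => (s : ℂ)) 1 x := Complex.ofRealCLM.hasDerivAt
    have h := ((((hx.pow 2).const_mul a).add (((hx.const_mul (2 * b)).mul_const (y : ℂ)))).add_const
      (c * (y : ℂ) ^ 2)).cexp
    refine h.congr_deriv ?_
    simp only [quadForm, Pi.add_apply, Pi.pow_apply]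
    push_cast
    ring
  | add _ _ h h' =>
    obtain ⟨f', h1, h2⟩ := h
    obtain ⟨g', h3, h4⟩ := h'
    exact ⟨_, h1.add h3, fun x y => (h2 x y).add (h4 x y)⟩
  | const_mul k _ h =>
    obtain ⟨f', h1, h2⟩ := h
    exact ⟨_, h1.const_mul k, fun x y => (h2 x y).const_mul k⟩
  | fst_mul hf h =>
    obtain ⟨f', h1, h2⟩ := h
    refine ⟨_, hf.add h1.fst_mul, fun x y => ?_⟩
    have hx : HasDerivAt (fun s : ℝ => (s : ℂ)) 1 x := Complex.ofRealCLM.hasDerivAt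
    refine (hx.mul (h2 x y)).congr_deriv ?_
    rw [one_mul]
  | snd_mul _ h =>
    obtain ⟨f', h1, h2⟩ := h
    exact ⟨_, h1.snd_mul, fun x y => (h2 x y).const_mul (y : ℂ)⟩

theorem PolyGauss.exists_hasDerivAt_snd (hf : PolyGauss a b c f) : ∃ f', PolyGauss a b c f' ∧
    ∀ x y, HasDerivAt (fun s : ℝ => f (x, s)) (f' (x, y)) y := by
  induction hf with
  | base =>
    refine ⟨_, ((PolyGauss.base.fst_mul).const_mul (2 * b)).add
      ((PolyGauss.base.snd_mul).const_mul (2 * c)), fun x y => ?_⟩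
    have hx : HasDerivAt (fun s : ℝ => (s : ℂ)) 1 y := Complex.ofRealCLM.hasDerivAt
    have h := (((hx.const_mul (2 * b * (x : ℂ))).const_add (a * (x : ℂ) ^ 2)).add
      ((hx.pow 2).const_mul c)).cexp
    refine h.congr_deriv ?_
    simp only [quadForm, Pi.add_apply, Pi.pow_apply]
    push_cast
    ring
  | add _ _ h h' =>
    obtain ⟨f', h1, h2⟩ := h
    obtain ⟨g', h3, h4⟩ := h'
    exact ⟨_, h1.add h3, fun x y => (h2 x y).add (h4 x y)⟩
  | const_mul k _ h =>
    obtain ⟨f', h1, h2⟩ := h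
    exact ⟨_, h1.const_mul k, fun x y => (h2 x y).const_mul k⟩
  | fst_mul _ h =>
    obtain ⟨f', h1, h2⟩ := h
    exact ⟨_, h1.fst_mul, fun x y => (h2 x y).const_mul (x : ℂ)⟩
  | snd_mul hf h =>
    obtain ⟨f', h1, h2⟩ := h
    refine ⟨_, hf.add h1.snd_mul, fun x y => ?_⟩
    have hx : HasDerivAt (fun s : ℝ => (s : ℂ)) 1 y := Complex.ofRealCLM.hasDerivAt
    refine (hx.mul (h2 x y)).congr_deriv ?_
    rw [one_mul]

/-- A linear factor is absorbed by half of the Gaussian. -/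
theorem abs_mul_exp_le {ε : ℝ} (hε : 0 < ε) (s r : ℝ) (h : s ^ 2 ≤ r) :
    |s| * Real.exp (-ε * r) ≤ (1 + 2 / ε) * Real.exp (-(ε / 2) * r) := by
  have h1 : |s| ≤ 1 + s ^ 2 := by
    rcases abs_cases s with ⟨h, _⟩ | ⟨h, _⟩ <;> rw [h] <;> nlinarith
  have h2 : ε / 2 * r + 1 ≤ Real.exp (ε / 2 * r) := Real.add_one_le_exp _
  have h3 : (0 : ℝ) ≤ r := (sq_nonneg s).trans h
  have h4 : |s| ≤ (1 + 2 / ε) * Real.exp (ε / 2 * r) := by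
    calc |s| ≤ 1 + r := h1.trans (by linarith)
      _ ≤ (1 + 2 / ε) * (ε / 2 * r + 1) := by
          have : (1 + 2 / ε) * (ε / 2 * r + 1) = 1 + r + (ε / 2 * r + 2 / ε) := by
            field_simp; ring
          rw [this]
          have : 0 ≤ ε / 2 * r + 2 / ε := by positivity
          linarith
      _ ≤ _ := by gcongr
  calc |s| * Real.exp (-ε * r) ≤ (1 + 2 / ε) * Real.exp (ε / 2 * r) * Real.exp (-ε * r) := by gcongr
    _ = _ := by rw [mul_assoc, ← Real.exp_add]; congr 2; ring

theorem PolyGauss.exists_norm_le (h : IsNegQuad a b c) (hf : PolyGauss a b c f) :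
    ∃ ε > 0, ∃ C, 0 ≤ C ∧ ∀ q : ℝ × ℝ, ‖f q‖ ≤ C * Real.exp (-ε * (q.1 ^ 2 + q.2 ^ 2)) := by
  induction hf with
  | base =>
    obtain ⟨ε, hε, hq⟩ := h
    refine ⟨ε, hε, 1, zero_le_one, fun q => ?_⟩
    rw [Complex.norm_exp, one_mul]
    exact Real.exp_le_exp.2 (hq q)
  | add _ _ h h' =>
    obtain ⟨ε, hε, C, hC, h1⟩ := h
    obtain ⟨δ, hδ, D, hD, h2⟩ := h'
    refine ⟨min ε δ, lt_min hε hδ, C + D, by positivity, fun q => (norm_add_le _ _).trans ?_⟩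
    rw [add_mul]
    have hr : 0 ≤ q.1 ^ 2 + q.2 ^ 2 := by positivity
    have hm1 : min ε δ ≤ ε := min_le_left _ _
    have hm2 : min ε δ ≤ δ := min_le_right _ _
    refine add_le_add ((h1 q).trans ?_) ((h2 q).trans ?_) <;> gcongr
  | const_mul k _ h =>
    obtain ⟨ε, hε, C, hC, h1⟩ := h
    refine ⟨ε, hε, ‖k‖ * C, by positivity, fun q => ?_⟩
    rw [norm_mul, mul_assoc]
    exact mul_le_mul_of_nonneg_left (h1 q) (norm_nonneg _)
  | fst_mul _ h =>
    obtain ⟨ε, hε, C, hC, h1⟩ := h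
    refine ⟨ε / 2, by positivity, C * (1 + 2 / ε), by positivity, fun q => ?_⟩
    rw [norm_mul, Complex.norm_real, Real.norm_eq_abs]
    calc |q.1| * ‖_‖ ≤ |q.1| * (C * Real.exp (-ε * (q.1 ^ 2 + q.2 ^ 2))) := by gcongr; exact h1 q
      _ = C * (|q.1| * Real.exp (-ε * (q.1 ^ 2 + q.2 ^ 2))) := by ring
      _ ≤ C * ((1 + 2 / ε) * Real.exp (-(ε / 2) * (q.1 ^ 2 + q.2 ^ 2))) := by
          exact mul_le_mul_of_nonneg_left (abs_mul_exp_le hε q.1 (q.1 ^ 2 + q.2 ^ 2) (by nlinarith [sq_nonneg q.2])) hC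
      _ = _ := by ring
  | snd_mul _ h =>
    obtain ⟨ε, hε, C, hC, h1⟩ := h
    refine ⟨ε / 2, by positivity, C * (1 + 2 / ε), by positivity, fun q => ?_⟩
    rw [norm_mul, Complex.norm_real, Real.norm_eq_abs]
    calc |q.2| * ‖_‖ ≤ |q.2| * (C * Real.exp (-ε * (q.1 ^ 2 + q.2 ^ 2))) := by gcongr; exact h1 q
      _ = C * (|q.2| * Real.exp (-ε * (q.1 ^ 2 + q.2 ^ 2))) := by ring
      _ ≤ C * ((1 + 2 / ε) * Real.exp (-(ε / 2) * (q.1 ^ 2 + q.2 ^ 2))) := by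
          exact mul_le_mul_of_nonneg_left (abs_mul_exp_le hε q.2 (q.1 ^ 2 + q.2 ^ 2) (by nlinarith [sq_nonneg q.1])) hC
      _ = _ := by ring

theorem integrable_exp_neg_sq_add_sq {ε : ℝ} (hε : 0 < ε) :
    Integrable fun q : ℝ × ℝ => Real.exp (-ε * (q.1 ^ 2 + q.2 ^ 2)) := by
  refine ((integrable_exp_neg_mul_sq hε).mul_prod (integrable_exp_neg_mul_sq hε)).congr
    (ae_of_all _ fun q => ?_)
  simp only [← Real.exp_add]
  congr 1; ring

theorem PolyGauss.memLp_two (h : IsNegQuad a b c) (hf : PolyGauss a b c f) : MemLp f 2 := by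
  obtain ⟨ε, hε, C, hC, h1⟩ := hf.exists_norm_le h
  have hm : AEStronglyMeasurable f := hf.contDiff.continuous.aestronglyMeasurable
  rw [memLp_two_iff_integrable_sq_norm hm]
  refine ((integrable_exp_neg_sq_add_sq (ε := 2 * ε) (by positivity)).const_mul (C ^ 2)).mono'
    (hm.norm.pow 2) (ae_of_all _ fun q => ?_)
  rw [Real.norm_of_nonneg (by positivity)]
  calc ‖f q‖ ^ 2 ≤ (C * Real.exp (-ε * (q.1 ^ 2 + q.2 ^ 2))) ^ 2 := by gcongr; exact h1 q
    _ = _ := by rw [mul_pow, ← Real.exp_nat_mul]; congr 2; push_cast; ring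

theorem PolyGauss.exists_norm_le_snd (h : IsNegQuad a b c) (hf : PolyGauss a b c f) :
    ∃ ε > 0, ∃ C, 0 ≤ C ∧ ∀ x y, ‖f (x, y)‖ ≤ C * Real.exp (-ε * y ^ 2) := by
  obtain ⟨ε, hε, C, hC, h1⟩ := hf.exists_norm_le h
  refine ⟨ε, hε, C, hC, fun x y => (h1 (x, y)).trans ?_⟩
  refine mul_le_mul_of_nonneg_left (Real.exp_le_exp.2 ?_) hC
  simp only
  nlinarith [mul_nonneg hε.le (sq_nonneg x)]

theorem PolyGauss.continuous_slice (hf : PolyGauss a b c f) (x : ℝ) :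
    Continuous fun z : ℝ => f (x, z) :=
  hf.contDiff.continuous.comp (by fun_prop)

theorem PolyGauss.integrable_slice (h : IsNegQuad a b c) (hf : PolyGauss a b c f) (x : ℝ) :
    Integrable fun z : ℝ => f (x, z) := by
  obtain ⟨ε, hε, C, hC, h1⟩ := hf.exists_norm_le_snd h
  exact ((integrable_exp_neg_mul_sq hε).const_mul C).mono'
    (hf.continuous_slice x).aestronglyMeasurable (ae_of_all _ fun z => h1 x z)

theorem PolyGauss.memLp_slice (h : IsNegQuad a b c) (hf : PolyGauss a b c f) (x : ℝ) :
    MemLp (fun z : ℝ => f (x, z)) 2 := by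
  obtain ⟨ε, hε, C, hC, h1⟩ := hf.exists_norm_le_snd h
  have hm := (hf.continuous_slice x).aestronglyMeasurable (μ := volume)
  rw [memLp_two_iff_integrable_sq_norm hm]
  refine ((integrable_exp_neg_mul_sq (b := 2 * ε) (by positivity)).const_mul (C ^ 2)).mono'
    (hm.norm.pow 2) (ae_of_all _ fun z => ?_)
  rw [Real.norm_of_nonneg (by positivity)]
  calc ‖f (x, z)‖ ^ 2 ≤ (C * Real.exp (-ε * z ^ 2)) ^ 2 := by gcongr; exact h1 x z
    _ = _ := by rw [mul_pow, ← Real.exp_nat_mul]; congr 2; push_cast; ring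

theorem PolyGauss.zero : PolyGauss a b c fun _ => 0 := by
  simpa using (PolyGauss.base (a := a) (b := b) (c := c)).const_mul 0

end PolyGauss

/-! ### The partial Fourier transform in the plane -/

section PlaneFT

/-- The Fourier integral in the second variable, at frequency `κ y`. -/
def planeFT (κ : ℝ) (h : ℝ × ℝ → ℂ) (q : ℝ × ℝ) : ℂ := lineFT (fun z => h (q.1, z)) (κ * q.2)

theorem opT_eq_planeFT (l κ : ℝ) (h : ℝ × ℝ → ℂ) (q : ℝ × ℝ) :
    opT l κ h q = (√(|κ| / (2 * Real.pi)) : ℝ) *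
      Complex.exp (Complex.I * (l / 2 * q.1 * q.2 : ℝ)) * planeFT κ h q := rfl

theorem norm_exp_neg_I_mul (r : ℝ) : ‖Complex.exp (-Complex.I * (r : ℂ))‖ = 1 := by
  rw [neg_mul, mul_comm, ← neg_mul, ← Complex.ofReal_neg, Complex.norm_exp_ofReal_mul_I]

theorem hasDerivAt_lineFT {f : ℝ → ℂ} (hf : Integrable f) (hf' : Integrable fun t : ℝ => (t : ℂ) * f t)
    (l : ℝ) : HasDerivAt (lineFT f) (lineFT (fun t : ℝ => -Complex.I * ((t : ℂ) * f t)) l) l := by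
  have h := hasDerivAt_integral_of_dominated_loc_of_deriv_le (μ := volume) (s := Set.univ)
    (F := fun l t : ℝ => Complex.exp (-Complex.I * (l * t : ℝ)) * f t)
    (F' := fun l t : ℝ => Complex.exp (-Complex.I * (l * t : ℝ)) * (-Complex.I * ((t : ℂ) * f t)))
    (x₀ := l) (bound := fun t : ℝ => ‖(t : ℂ) * f t‖) univ_mem
    (Eventually.of_forall fun l => (integrable_exp_mul hf l).aestronglyMeasurable)
    (integrable_exp_mul hf l)
    (integrable_exp_mul (hf'.const_mul _) l).aestronglyMeasurable
    (ae_of_all _ fun t l _ => by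
      rw [norm_mul, norm_exp_neg_I_mul, one_mul, norm_mul, norm_neg, Complex.norm_I, one_mul])
    hf'.norm
    (ae_of_all _ fun t l _ => by
      have h1 : HasDerivAt (fun l : ℝ => ((l * t : ℝ) : ℂ)) (t : ℂ) l := by
        have := ((hasDerivAt_id l).mul_const t).ofReal_comp
        simpa using this
      refine (((h1.const_mul (-Complex.I)).cexp).mul_const (f t)).congr_deriv ?_
      ring)
  exact h.2

theorem lineFT_deriv {f f' : ℝ → ℂ} (hf : Integrable f) (hf' : Integrable f')
    (hd : ∀ t, HasDerivAt f (f' t) t) (l : ℝ) :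
    lineFT f' l = Complex.I * l * lineFT f l := by
  have h1 : ∀ t : ℝ, HasDerivAt (fun t : ℝ => Complex.exp (-Complex.I * (l * t : ℝ)))
      (Complex.exp (-Complex.I * (l * t : ℝ)) * (-Complex.I * l)) t := fun t => by
    have h1 : HasDerivAt (fun t : ℝ => ((l * t : ℝ) : ℂ)) (l : ℂ) t := by
      have := ((hasDerivAt_id t).const_mul l).ofReal_comp
      simpa using this
    exact (h1.const_mul (-Complex.I)).cexp
  have h2 := integral_mul_deriv_eq_deriv_mul_of_integrable (fun t _ => h1 t) (fun t _ => hd t)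
    (integrable_exp_mul hf' l)
    (((integrable_exp_mul hf l).const_mul (-Complex.I * l)).congr
      (ae_of_all _ fun t => by simp only [Pi.mul_apply]; ring))
    (integrable_exp_mul hf l)
  rw [lineFT, h2, lineFT, ← integral_neg, ← integral_const_mul]
  refine integral_congr_ae (ae_of_all _ fun t => ?_)
  simp only; ring

variable {a b c : ℂ} {f g : ℝ × ℝ → ℂ} {κ : ℝ}

theorem planeFT_add (h : IsNegQuad a b c) (hf : PolyGauss a b c f) (hg : PolyGauss a b c g)
    (q : ℝ × ℝ) : planeFT κ (fun q => f q + g q) q = planeFT κ f q + planeFT κ g q := by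
  simp only [planeFT, lineFT]
  rw [← integral_add (integrable_exp_mul (hf.integrable_slice h _) _)
    (integrable_exp_mul (hg.integrable_slice h _) _)]
  simp only [mul_add]

theorem planeFT_const_mul (k : ℂ) (f : ℝ × ℝ → ℂ) (q : ℝ × ℝ) :
    planeFT κ (fun q => k * f q) q = k * planeFT κ f q := by
  simp only [planeFT, lineFT]
  rw [← integral_const_mul]
  refine integral_congr_ae (ae_of_all _ fun t => ?_)
  simp only; ring

theorem planeFT_fst_mul (f : ℝ × ℝ → ℂ) (q : ℝ × ℝ) :
    planeFT κ (fun q => (q.1 : ℂ) * f q) q = q.1 * planeFT κ f q :=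
  planeFT_const_mul (q.1 : ℂ) f q

theorem hasDerivAt_planeFT_snd (h : IsNegQuad a b c) (hf : PolyGauss a b c f) (x y : ℝ) :
    HasDerivAt (fun s : ℝ => planeFT κ f (x, s))
      (planeFT κ (fun q => -Complex.I * κ * ((q.2 : ℂ) * f q)) (x, y)) y := by
  have h1 := hasDerivAt_lineFT (hf.integrable_slice h x) (hf.snd_mul.integrable_slice h x) (κ * y)
  have h2 : HasDerivAt (fun s : ℝ => κ * s) κ y := by
    simpa using (hasDerivAt_id y).const_mul κ
  refine (h1.scomp y h2).congr_deriv ?_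
  simp only [planeFT, lineFT]
  rw [Complex.real_smul, ← integral_const_mul]
  refine integral_congr_ae (ae_of_all _ fun t => ?_)
  simp only; ring

theorem hasDerivAt_planeFT_fst (h : IsNegQuad a b c) (hf : PolyGauss a b c f)
    (hg : PolyGauss a b c g) (hd : ∀ x y, HasDerivAt (fun s : ℝ => f (s, y)) (g (x, y)) x)
    (x y : ℝ) : HasDerivAt (fun s : ℝ => planeFT κ f (s, y)) (planeFT κ g (x, y)) x := by
  obtain ⟨ε, hε, C, hC, h1⟩ := hg.exists_norm_le_snd h
  have h2 := hasDerivAt_integral_of_dominated_loc_of_deriv_le (μ := volume) (s := Set.univ)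
    (F := fun s t : ℝ => Complex.exp (-Complex.I * (κ * y * t : ℝ)) * f (s, t))
    (F' := fun s t : ℝ => Complex.exp (-Complex.I * (κ * y * t : ℝ)) * g (s, t))
    (x₀ := x) (bound := fun t => C * Real.exp (-ε * t ^ 2)) univ_mem
    (Eventually.of_forall fun s =>
      (integrable_exp_mul (hf.integrable_slice h s) _).aestronglyMeasurable)
    (integrable_exp_mul (hf.integrable_slice h x) _)
    (integrable_exp_mul (hg.integrable_slice h x) _).aestronglyMeasurable
    (ae_of_all _ fun t s _ => by
      rw [norm_mul, norm_exp_neg_I_mul, one_mul]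
      exact h1 s t)
    ((integrable_exp_neg_mul_sq hε).const_mul C)
    (ae_of_all _ fun t s _ => (hd s t).const_mul _)
  exact h2.2

theorem planeFT_deriv_snd (h : IsNegQuad a b c) (hf : PolyGauss a b c f)
    (hg : PolyGauss a b c g) (hd : ∀ x y, HasDerivAt (fun s : ℝ => f (x, s)) (g (x, y)) y)
    (q : ℝ × ℝ) : planeFT κ g q = Complex.I * κ * q.2 * planeFT κ f q := by
  have := lineFT_deriv (hf.integrable_slice h q.1) (hg.integrable_slice h q.1)
    (fun t => hd q.1 t) (κ * q.2)
  rw [planeFT, this, planeFT]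
  push_cast; ring

/-- The partial Fourier transform of a Gaussian is a Gaussian. -/
theorem planeFT_gauss (hc : c.re < 0) (q : ℝ × ℝ) :
    planeFT κ (fun q => Complex.exp (quadForm a b c q)) q =
      (Real.pi / -c) ^ (1 / 2 : ℂ) * Complex.exp
        (quadForm (a - b ^ 2 / c) (Complex.I * κ * b / (2 * c)) (κ ^ 2 / (4 * c)) q) := by
  have hc0 : c ≠ 0 := fun h => by simp [h] at hc
  have h := integral_cexp_quadratic hc (2 * b * q.1 - Complex.I * κ * q.2) (a * (q.1 : ℂ) ^ 2)
  have e : planeFT κ (fun q => Complex.exp (quadForm a b c q)) q =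
      ∫ x : ℝ, Complex.exp (c * (x : ℂ) ^ 2 + (2 * b * q.1 - Complex.I * κ * q.2) * x +
        a * (q.1 : ℂ) ^ 2) := by
    simp only [planeFT, lineFT, ← Complex.exp_add, quadForm]
    refine integral_congr_ae (ae_of_all _ fun t => ?_)
    simp only
    congr 1
    push_cast; ring
  rw [e, h, quadForm]
  congr 2
  field_simp
  linear_combination (-(κ : ℂ) ^ 2 * (q.2 : ℂ) ^ 2) * Complex.I_sq

variable {a' b' c' K : ℂ}

/-- If the partial Fourier transform carries one Gaussian to another, it carries polynomial
multiples of the one to polynomial multiples of the other. -/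
theorem PolyGauss.planeFT (h : IsNegQuad a b c) (hκ : κ ≠ 0)
    (h0 : ∀ q, planeFT κ (fun q => Complex.exp (quadForm a b c q)) q =
      K * Complex.exp (quadForm a' b' c' q)) (hf : PolyGauss a b c f) :
    PolyGauss a' b' c' (planeFT κ f) := by
  induction hf with
  | base => rw [funext h0]; exact PolyGauss.base.const_mul K
  | add hf hg h1 h2 => rw [funext (planeFT_add h hf hg)]; exact h1.add h2
  | const_mul k _ h1 => rw [funext (planeFT_const_mul k _)]; exact h1.const_mul k
  | fst_mul _ h1 => rw [funext (planeFT_fst_mul _)]; exact h1.fst_mul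
  | @snd_mul f hf h1 =>
    obtain ⟨g, hg, hd⟩ := h1.exists_hasDerivAt_snd
    have e : _root_.planeFT κ (fun q => (q.2 : ℂ) * f q) = fun q => (Complex.I / κ) * g q := by
      funext q
      have h3 := (hasDerivAt_planeFT_snd (κ := κ) h hf q.1 q.2).unique (hd q.1 q.2)
      rw [planeFT_const_mul] at h3
      rw [← h3]
      have : (κ : ℂ) ≠ 0 := by exact_mod_cast hκ
      field_simp
      rw [Complex.I_sq]; simp
    rw [e]
    exact hg.const_mul _

/-- Every polynomial multiple of the transformed Gaussian is the partial Fourier transform of a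
polynomial multiple of the Gaussian. -/
theorem PolyGauss.exists_planeFT_eq (h : IsNegQuad a b c) (hκ : κ ≠ 0) (hK : K ≠ 0)
    (h0 : ∀ q, _root_.planeFT κ (fun q => Complex.exp (quadForm a b c q)) q =
      K * Complex.exp (quadForm a' b' c' q)) (hf : PolyGauss a' b' c' f) :
    ∃ g, PolyGauss a b c g ∧ _root_.planeFT κ g = f := by
  induction hf with
  | base =>
    refine ⟨_, PolyGauss.base.const_mul K⁻¹, funext fun q => ?_⟩
    rw [planeFT_const_mul, h0, inv_mul_cancel_left₀ hK]
  | add _ _ h1 h2 =>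
    obtain ⟨g, hg, rfl⟩ := h1
    obtain ⟨g', hg', rfl⟩ := h2
    exact ⟨_, hg.add hg', funext fun q => planeFT_add h hg hg' q⟩
  | const_mul k _ h1 =>
    obtain ⟨g, hg, rfl⟩ := h1
    exact ⟨_, hg.const_mul k, funext fun q => planeFT_const_mul k g q⟩
  | fst_mul _ h1 =>
    obtain ⟨g, hg, rfl⟩ := h1
    exact ⟨_, hg.fst_mul, funext fun q => planeFT_fst_mul g q⟩
  | snd_mul _ h1 =>
    obtain ⟨g, hg, rfl⟩ := h1
    obtain ⟨g', hg', hd⟩ := hg.exists_hasDerivAt_snd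
    refine ⟨_, hg'.const_mul (-Complex.I / κ), funext fun q => ?_⟩
    rw [planeFT_const_mul, planeFT_deriv_snd h hg hg' hd]
    have : (κ : ℂ) ≠ 0 := by exact_mod_cast hκ
    field_simp
    linear_combination (-(q.2 : ℂ) * _root_.planeFT κ g q) * Complex.I_sq

/-- Plancherel's identity for the partial transform, slice by slice; the factor is that of the
kernel `e^{-iκyz}`. -/
theorem integral_conj_planeFT_mul_planeFT (h : IsNegQuad a b c) (hκ : κ ≠ 0)
    (hf : PolyGauss a b c f) (hg : PolyGauss a b c g) (x : ℝ) :
    ∫ y, conj (planeFT κ f (x, y)) * planeFT κ g (x, y) =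
      (2 * Real.pi / |κ| : ℝ) * ∫ z, conj (f (x, z)) * g (x, z) := by
  have h1 := integral_conj_lineFT_mul_lineFT (hf.integrable_slice h x) (hf.memLp_slice h x)
    (hg.integrable_slice h x) (hg.memLp_slice h x)
  have h2 := Measure.integral_comp_mul_left (fun y => conj (lineFT (fun z => f (x, z)) y) *
    lineFT (fun z => g (x, z)) y) κ
  simp only [planeFT]
  rw [h2, h1, Complex.real_smul, Complex.real_smul, ← mul_assoc, ← Complex.ofReal_mul, abs_inv]
  congr 2
  field_simp

end PlaneFT

/-! ### Completeness of the polynomial multiples of a Gaussian -/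

section Completeness

/-- Injectivity of the Fourier transform on integrable functions of the plane. -/
theorem ae_eq_zero_of_integral_mul_cexp_eq_zero {k : ℝ × ℝ → ℝ} (hk : Integrable k)
    (h : ∀ ξ η : ℝ, ∫ q : ℝ × ℝ, (k q : ℂ) *
      Complex.exp (((ξ * q.1 + η * q.2 : ℝ) : ℂ) * Complex.I) = 0) : k =ᵐ[volume] 0 := by
  -- the positive and the negative part of `k` define measures with equal characteristic functions
  have hfin1 := isFiniteMeasure_withDensity_ofReal hk.2
  have hfin2 := isFiniteMeasure_withDensity_ofReal hk.neg.2
  have key : volume.withDensity (fun q => ENNReal.ofReal (k q)) =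
      volume.withDensity (fun q => ENNReal.ofReal ((-k) q)) := by
    refine Measure.ext_of_charFunDual (funext fun L => ?_)
    have hm1 : AEMeasurable (fun q => ENNReal.ofReal (k q)) := hk.1.aemeasurable.ennreal_ofReal
    have hm2 : AEMeasurable (fun q => ENNReal.ofReal ((-k) q)) :=
      hk.neg.1.aemeasurable.ennreal_ofReal
    rw [charFunDual_apply, charFunDual_apply,
      integral_withDensity_eq_integral_toReal_smul₀ hm1 (by simp),
      integral_withDensity_eq_integral_toReal_smul₀ hm2 (by simp), ← sub_eq_zero]
    have hL : ∀ q : ℝ × ℝ, L q = L (1, 0) * q.1 + L (0, 1) * q.2 := fun q => by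
      have : q = q.1 • ((1 : ℝ), (0 : ℝ)) + q.2 • ((0 : ℝ), (1 : ℝ)) := by ext <;> simp
      conv_lhs => rw [this, map_add, map_smul, map_smul]
      simp only [smul_eq_mul]; ring
    have hb : ∀ q : ℝ × ℝ, ‖Complex.exp ((L q : ℂ) * Complex.I)‖ ≤ 1 := fun q => by
      rw [Complex.norm_exp_ofReal_mul_I]
    have hc : Continuous fun q : ℝ × ℝ => Complex.exp ((L q : ℂ) * Complex.I) := by fun_prop
    have hi : ∀ k' : ℝ × ℝ → ℝ, Integrable k' → Integrable fun q =>
        (ENNReal.ofReal (k' q)).toReal • Complex.exp ((L q : ℂ) * Complex.I) := fun k' hk' => by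
      have h1 : Integrable fun q => (ENNReal.ofReal (k' q)).toReal := by
        simp only [ENNReal.toReal_ofReal']
        exact hk'.pos_part
      exact h1.smul_bdd 1 hc.aestronglyMeasurable (ae_of_all _ hb)
    rw [← integral_sub (hi _ hk) (hi _ hk.neg), ← h (L (1, 0)) (L (0, 1))]
    refine integral_congr_ae (ae_of_all _ fun q => ?_)
    simp only [← hL, Complex.real_smul]
    simp only [ENNReal.toReal_ofReal', Pi.neg_apply]
    rcases le_total 0 (k q) with h0 | h0
    · rw [max_eq_left h0, max_eq_right (by linarith)]; simp
    · rw [max_eq_right h0, max_eq_left (by linarith)]; simp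
  rw [withDensity_eq_iff hk.1.aemeasurable.ennreal_ofReal hk.neg.1.aemeasurable.ennreal_ofReal
    (by
      have := (lintegral_mono fun q => Real.ofReal_le_enorm (k q)).trans_lt hk.2
      exact this.ne)] at key
  filter_upwards [key] with q hq
  rcases le_total 0 (k q) with h0 | h0
  · have h1 : ENNReal.ofReal ((-k) q) = 0 := ENNReal.ofReal_eq_zero.2 (by simpa using h0)
    rw [h1, ENNReal.ofReal_eq_zero] at hq
    exact le_antisymm hq h0
  · rw [ENNReal.ofReal_eq_zero.2 h0, eq_comm, ENNReal.ofReal_eq_zero] at hq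
    have h1 : -k q ≤ 0 := hq
    exact le_antisymm h0 (neg_nonpos.1 h1)

/-- A function with exponential moments all of whose moments vanish is zero. -/
theorem ae_eq_zero_of_moments {k : ℝ × ℝ → ℝ} (hk : AEStronglyMeasurable k)
    (hexp : ∀ ξ η : ℝ, Integrable fun q : ℝ × ℝ => |k q| * Real.exp |ξ * q.1 + η * q.2|)
    (hmom : ∀ (ξ η : ℝ) (n : ℕ), ∫ q : ℝ × ℝ, k q * (ξ * q.1 + η * q.2) ^ n = 0) :
    k =ᵐ[volume] 0 := by
  have hint : Integrable k := by
    have := hexp 0 0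
    simp only [zero_mul, add_zero, abs_zero, Real.exp_zero, mul_one] at this
    exact (integrable_norm_iff hk).1 this
  refine ae_eq_zero_of_integral_mul_cexp_eq_zero hint fun ξ η => ?_
  have hs : ∀ r : ℝ, HasSum (fun n : ℕ => r ^ n / n.factorial) (Real.exp r) := fun r => by
    rw [Real.exp_eq_exp_ℝ]
    exact NormedSpace.expSeries_div_hasSum_exp r
  have hsc : ∀ r : ℂ, HasSum (fun n : ℕ => r ^ n / n.factorial) (Complex.exp r) := fun r => by
    rw [Complex.exp_eq_exp_ℂ]
    exact NormedSpace.expSeries_div_hasSum_exp r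
  have h1 := hasSum_integral_of_dominated_convergence (μ := (volume : Measure (ℝ × ℝ)))
    (F := fun (n : ℕ) (q : ℝ × ℝ) =>
      (k q : ℂ) * ((((ξ * q.1 + η * q.2 : ℝ) : ℂ) * Complex.I) ^ n / n.factorial))
    (f := fun q => (k q : ℂ) * Complex.exp (((ξ * q.1 + η * q.2 : ℝ) : ℂ) * Complex.I))
    (bound := fun n q => |k q| * (|ξ * q.1 + η * q.2| ^ n / n.factorial))
    (fun n => (Complex.continuous_ofReal.comp_aestronglyMeasurable hk).mul
      (by fun_prop))
    (fun n => ae_of_all _ fun q => by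
      rw [norm_mul, norm_div, norm_pow, norm_mul, Complex.norm_I, mul_one, Complex.norm_real,
        Complex.norm_real, Real.norm_eq_abs, Real.norm_eq_abs, Complex.norm_natCast])
    (ae_of_all _ fun q => ((hs _).summable.mul_left _))
    ((hexp ξ η).congr (ae_of_all _ fun q => by
      simp only
      rw [tsum_mul_left, (hs _).tsum_eq]))
    (ae_of_all _ fun q => (hsc _).mul_left _)
  have h2 : ∀ n : ℕ, ∫ q : ℝ × ℝ,
      (k q : ℂ) * ((((ξ * q.1 + η * q.2 : ℝ) : ℂ) * Complex.I) ^ n / n.factorial) = 0 := fun n => by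
    have e : ∀ q : ℝ × ℝ, (k q : ℂ) * ((((ξ * q.1 + η * q.2 : ℝ) : ℂ) * Complex.I) ^ n /
        n.factorial) = (Complex.I ^ n / n.factorial) *
          ((k q * (ξ * q.1 + η * q.2) ^ n : ℝ) : ℂ) := fun q => by
      push_cast; rw [mul_pow]; ring
    simp only [e]
    rw [integral_const_mul, integral_complex_ofReal, hmom, Complex.ofReal_zero, mul_zero]
  simp only [h2] at h1
  exact h1.unique hasSum_zero

variable {a b c : ℂ}

theorem PolyGauss.linear_pow_mul {f : ℝ × ℝ → ℂ} (hf : PolyGauss a b c f) (ξ η : ℝ) (n : ℕ) :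
    PolyGauss a b c fun q => ((ξ * q.1 + η * q.2 : ℝ) : ℂ) ^ n * f q := by
  induction n with
  | zero => simpa using hf
  | succ n ih =>
    have h := (ih.fst_mul.const_mul ξ).add (ih.snd_mul.const_mul η)
    convert h using 2 with q
    push_cast; ring

theorem PolyGauss.continuous_exp_abs_mul (ξ η : ℝ) :
    Continuous fun q : ℝ × ℝ => Real.exp |ξ * q.1 + η * q.2| := by fun_prop

theorem memLp_exp_abs_mul_gauss (h : IsNegQuad a b c) (ξ η : ℝ) :
    MemLp (fun q : ℝ × ℝ => Real.exp |ξ * q.1 + η * q.2| *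
      ‖Complex.exp (quadForm a b c q)‖) 2 := by
  obtain ⟨ε, hε, hq⟩ := h
  have hc : Continuous fun q : ℝ × ℝ => Real.exp |ξ * q.1 + η * q.2| *
      ‖Complex.exp (quadForm a b c q)‖ := by unfold quadForm; fun_prop
  rw [memLp_two_iff_integrable_sq_norm hc.aestronglyMeasurable]
  refine ((integrable_exp_neg_sq_add_sq hε).const_mul
    (Real.exp ((ξ ^ 2 + η ^ 2) / ε) ^ 2)).mono' (hc.norm.pow 2).aestronglyMeasurable
    (ae_of_all _ fun q => ?_)
  rw [Real.norm_of_nonneg (by positivity), norm_mul, norm_norm, Real.norm_of_nonneg (by positivity),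
    Complex.norm_exp, ← Real.exp_add, ← Real.exp_nat_mul, ← Real.exp_nat_mul, ← Real.exp_add]
  refine Real.exp_le_exp.2 ?_
  -- `|ξ x| ≤ ξ² / ε + ε x² / 4`
  have h1 : ∀ u v : ℝ, u * v ≤ u ^ 2 / ε + ε / 4 * v ^ 2 := fun u v => by
    have : u ^ 2 / ε + ε / 4 * v ^ 2 - u * v = (u / ε - v / 2) ^ 2 * ε := by field_simp; ring
    nlinarith [mul_nonneg (sq_nonneg (u / ε - v / 2)) hε.le]
  have h2 : |ξ * q.1 + η * q.2| ≤ (ξ ^ 2 + η ^ 2) / ε + ε / 4 * (q.1 ^ 2 + q.2 ^ 2) := by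
    rw [abs_le]
    constructor
    · have := h1 (-ξ) q.1
      have := h1 (-η) q.2
      rw [neg_sq] at *
      rw [add_div]
      linarith
    · have := h1 ξ q.1
      have := h1 η q.2
      rw [add_div]
      linarith
  have h3 := hq q
  push_cast
  nlinarith [sq_nonneg q.1, sq_nonneg q.2]

/-- The polynomial multiples of a Gaussian are total in `L²`. -/
theorem ae_eq_zero_of_integral_mul_polyGauss_eq_zero (h : IsNegQuad a b c) {G : ℝ × ℝ → ℂ}
    (hG : MemLp G 2) (h0 : ∀ f, PolyGauss a b c f → ∫ q, G q * f q = 0) : G =ᵐ[volume] 0 := by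
  have hbase := (PolyGauss.base (a := a) (b := b) (c := c))
  have hint : ∀ f, PolyGauss a b c f → Integrable fun q => G q * f q := fun f hf =>
    hG.integrable_mul (hf.memLp_two h)
  -- real and imaginary parts of `G` times the Gaussian have vanishing moments
  have key : ∀ T : ℂ →L[ℝ] ℝ, (∀ z, |T z| ≤ ‖z‖) →
      (fun q => T (G q * Complex.exp (quadForm a b c q))) =ᵐ[volume] 0 := fun T hT => by
    refine ae_eq_zero_of_moments (T.continuous.comp_aestronglyMeasurable (hint _ hbase).1) ?_ ?_
    · intro ξ η
      have h1 := hG.norm.integrable_mul (memLp_exp_abs_mul_gauss h ξ η)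
      refine h1.mono' ?_ (ae_of_all _ fun q => ?_)
      · exact ((T.continuous.comp_aestronglyMeasurable (hint _ hbase).1).norm).mul
          (PolyGauss.continuous_exp_abs_mul ξ η).aestronglyMeasurable
      · rw [Real.norm_of_nonneg (by positivity), Pi.mul_apply]
        calc |T (G q * Complex.exp (quadForm a b c q))| * Real.exp |ξ * q.1 + η * q.2|
            ≤ ‖G q * Complex.exp (quadForm a b c q)‖ * Real.exp |ξ * q.1 + η * q.2| :=
              mul_le_mul_of_nonneg_right (hT _) (Real.exp_pos _).le
          _ = _ := by rw [norm_mul]; ring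
    · intro ξ η n
      have hf := hbase.linear_pow_mul ξ η n
      have h1 := T.integral_comp_comm (hint _ hf)
      rw [h0 _ hf, map_zero] at h1
      rw [← h1]
      refine integral_congr_ae (ae_of_all _ fun q => ?_)
      simp only
      have e : G q * (((ξ * q.1 + η * q.2 : ℝ) : ℂ) ^ n * Complex.exp (quadForm a b c q)) =
          ((ξ * q.1 + η * q.2) ^ n : ℝ) • (G q * Complex.exp (quadForm a b c q)) := by
        rw [Complex.real_smul]; push_cast; ring
      rw [e, map_smul, smul_eq_mul, mul_comm]
  filter_upwards [key Complex.reCLM Complex.abs_re_le_norm, key Complex.imCLM Complex.abs_im_le_norm]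
    with q h1 h2
  have h3 : G q * Complex.exp (quadForm a b c q) = 0 := Complex.ext h1 h2
  exact (mul_eq_zero.1 h3).resolve_right (Complex.exp_ne_zero _)

end Completeness

/-! ### Diagonalisation of the quadratic form -/

section Frame

/-- The linear forms `ξ = α·u` and `η = β·u` diagonalise the quadratic form
`(l x - κ z)² + κ² x²` simultaneously with the Euclidean one, with the normalisation for which
`f(ξ) g(η)` is an eigenfunction of `-∂ₓ² - ∂_z² + (l x - κ z)² + κ² x²` whenever `f` and `g` are
Hermite functions. -/
structure IsHermiteFrame (l κ : ℝ) (α β : ℝ × ℝ) : Prop where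
  orth : α.1 * β.1 + α.2 * β.2 = 0
  xx : (α.1 ^ 2 + α.2 ^ 2) * α.1 ^ 2 + (β.1 ^ 2 + β.2 ^ 2) * β.1 ^ 2 = l ^ 2 + κ ^ 2
  xz : (α.1 ^ 2 + α.2 ^ 2) * (α.1 * α.2) + (β.1 ^ 2 + β.2 ^ 2) * (β.1 * β.2) = -(l * κ)
  zz : (α.1 ^ 2 + α.2 ^ 2) * α.2 ^ 2 + (β.1 ^ 2 + β.2 ^ 2) * β.2 ^ 2 = κ ^ 2
  det : (α.1 * β.2 - α.2 * β.1) ^ 2 = κ ^ 2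

theorem rpow_quarter_sq {x : ℝ} (hx : 0 ≤ x) : (x ^ (1 / 4 : ℝ)) ^ 2 = √x := by
  rw [Real.sqrt_eq_rpow, ← Real.rpow_natCast, ← Real.rpow_mul hx]
  norm_num

/-- The columns of `k_λ` scaled by `μ_±^{1/4}` form a Hermite frame, since they are orthonormal
eigenvectors of the quadratic form. The entries of `k_λ` are left general, which treats `λ₁ = 0` and
`λ₁ ≠ 0` together. -/
theorem exists_isHermiteFrame_of_kMat {l κ p r s t : ℝ} (hk : kMat l κ = !![p, s; r, t])
    (h1 : p ^ 2 + r ^ 2 = 1) (h2 : s ^ 2 + t ^ 2 = 1) (h3 : p * s + r * t = 0)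
    (hp : 0 ≤ muEig 1 l κ) (hm : 0 ≤ muEig (-1) l κ)
    (xx : muEig 1 l κ * p ^ 2 + muEig (-1) l κ * s ^ 2 = l ^ 2 + κ ^ 2)
    (xz : muEig 1 l κ * (p * r) + muEig (-1) l κ * (s * t) = -(l * κ))
    (zz : muEig 1 l κ * r ^ 2 + muEig (-1) l κ * t ^ 2 = κ ^ 2) :
    ∃ α β, IsHermiteFrame l κ α β ∧
      (∀ m u, hEig l κ m u = √|κ| * hermiteFun m.1 (α.1 * u.1 + α.2 * u.2) *
        hermiteFun m.2 (β.1 * u.1 + β.2 * u.2)) ∧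
      ∀ m, nuEig l κ m = (α.1 ^ 2 + α.2 ^ 2) * (2 * m.1 + 1) +
        (β.1 ^ 2 + β.2 ^ 2) * (2 * m.2 + 1) := by
  have hA := rpow_quarter_sq hp
  have hB := rpow_quarter_sq hm
  have hA2 := Real.sq_sqrt hp
  have hB2 := Real.sq_sqrt hm
  have hd : (p * t - r * s) ^ 2 = 1 := by
    linear_combination h1 * (s ^ 2 + t ^ 2) + h2 - h3 * (p * s + r * t)
  have hμ : muEig 1 l κ * muEig (-1) l κ = (κ ^ 2) ^ 2 := by
    have e : (muEig 1 l κ * p ^ 2 + muEig (-1) l κ * s ^ 2) *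
        (muEig 1 l κ * r ^ 2 + muEig (-1) l κ * t ^ 2) -
        (muEig 1 l κ * (p * r) + muEig (-1) l κ * (s * t)) ^ 2 =
        muEig 1 l κ * muEig (-1) l κ * (p * t - r * s) ^ 2 := by ring
    rw [xx, xz, zz, hd] at e
    linear_combination -e
  have hs : √(muEig 1 l κ) * √(muEig (-1) l κ) = κ ^ 2 := by
    rw [← Real.sqrt_mul hp, hμ, Real.sqrt_sq (sq_nonneg κ)]
  set A := muEig 1 l κ ^ (1 / 4 : ℝ) with hAd
  set B := muEig (-1) l κ ^ (1 / 4 : ℝ) with hBd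
  have hα : (A * p) ^ 2 + (A * r) ^ 2 = √(muEig 1 l κ) := by
    linear_combination A ^ 2 * h1 + hA
  have hβ : (B * s) ^ 2 + (B * t) ^ 2 = √(muEig (-1) l κ) := by
    linear_combination B ^ 2 * h2 + hB
  refine ⟨(A * p, A * r), (B * s, B * t), ⟨?_, ?_, ?_, ?_, ?_⟩, fun m u => ?_, fun m => ?_⟩
  · simp only
    linear_combination A * B * h3
  · simp only [hα, hβ]
    linear_combination √(muEig 1 l κ) * p ^ 2 * hA + √(muEig (-1) l κ) * s ^ 2 * hB +
      p ^ 2 * hA2 + s ^ 2 * hB2 + xx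
  · simp only [hα, hβ]
    linear_combination √(muEig 1 l κ) * p * r * hA + √(muEig (-1) l κ) * s * t * hB +
      p * r * hA2 + s * t * hB2 + xz
  · simp only [hα, hβ]
    linear_combination √(muEig 1 l κ) * r ^ 2 * hA + √(muEig (-1) l κ) * t ^ 2 * hB +
      r ^ 2 * hA2 + t ^ 2 * hB2 + zz
  · simp only
    linear_combination A ^ 2 * B ^ 2 * hd + B ^ 2 * hA + √(muEig 1 l κ) * hB + hs
  · have e1 : A * (p * u.1 + r * u.2) = A * p * u.1 + A * r * u.2 := by ring
    have e2 : B * (s * u.1 + t * u.2) = B * s * u.1 + B * t * u.2 := by ring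
    rw [← e1, ← e2]
    simp [hEig, hk, Matrix.mulVec, dotProduct, Fin.sum_univ_two, hAd, hBd]
  · simp only [hα, hβ]; rfl

/-- The functions `h_{λ,m}` are products of Hermite functions in a Hermite frame, and `ν_{λ,m}` is
the corresponding eigenvalue. -/
theorem exists_isHermiteFrame {κ : ℝ} (hκ : κ ≠ 0) (l : ℝ) :
    ∃ α β, IsHermiteFrame l κ α β ∧
      (∀ m u, hEig l κ m u = √|κ| * hermiteFun m.1 (α.1 * u.1 + α.2 * u.2) *
        hermiteFun m.2 (β.1 * u.1 + β.2 * u.2)) ∧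
      ∀ m, nuEig l κ m = (α.1 ^ 2 + α.2 ^ 2) * (2 * m.1 + 1) +
        (β.1 ^ 2 + β.2 ^ 2) * (2 * m.2 + 1) := by
  have hκ2 : 0 < κ ^ 2 := by positivity
  by_cases hl : l = 0
  · subst hl
    have e : ∀ ε, muEig ε 0 κ = κ ^ 2 := fun ε => by simp [muEig]
    refine exists_isHermiteFrame_of_kMat (p := 1) (r := 0) (s := 0) (t := 1) ?_ (by norm_num)
      (by norm_num) (by norm_num) ?_ ?_ ?_ ?_ ?_
    · rw [kMat, if_pos rfl, Matrix.one_fin_two]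
    all_goals simp only [e]
    · exact hκ2.le
    · exact hκ2.le
    all_goals ring
  · have hS := Real.sq_sqrt (show 0 ≤ l ^ 2 + 4 * κ ^ 2 by positivity)
    have hS0 : 0 < √(l ^ 2 + 4 * κ ^ 2) := Real.sqrt_pos.2 (by positivity)
    have hl0 : 0 < |l| := abs_pos.2 hl
    have hl2 := sq_abs l
    have hkm := kMat.eq_1 l κ
    rw [if_neg hl] at hkm
    simp only at hkm
    set S := √(l ^ 2 + 4 * κ ^ 2) with hSd
    set a := (l ^ 2 - |l| * S) / 2 with ha
    set b := (l ^ 2 + |l| * S) / 2 with hb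
    have hab : a * b = -(l * κ) ^ 2 := by
      rw [ha, hb]; linear_combination (-S ^ 2 / 4) * hl2 - l ^ 2 / 4 * hS
    have hba : 0 < b - a := by
      have : b - a = |l| * S := by rw [ha, hb]; ring
      rw [this]; positivity
    have hsum : a + b = l ^ 2 := by rw [ha, hb]; ring
    have hμp : muEig 1 l κ = κ ^ 2 + b := by rw [muEig, ← hSd, hb]; ring
    have hμm : muEig (-1) l κ = κ ^ 2 + a := by rw [muEig, ← hSd, ha]; ring
    have hlκ : 0 < (l * κ) ^ 2 := by positivity
    have hb0 : 0 < b := by rw [hb]; positivity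
    have hN1 := Real.sq_sqrt (show 0 ≤ (l * κ) ^ 2 + a ^ 2 by positivity)
    have hN2 := Real.sq_sqrt (show 0 ≤ (l * κ) ^ 2 + b ^ 2 by positivity)
    have hN1' : 0 < √((l * κ) ^ 2 + a ^ 2) := Real.sqrt_pos.2 (by positivity)
    have hN2' : 0 < √((l * κ) ^ 2 + b ^ 2) := Real.sqrt_pos.2 (by positivity)
    set N := √((l * κ) ^ 2 + a ^ 2)
    set M := √((l * κ) ^ 2 + b ^ 2)
    -- the squared norms of the two columns are `a (a - b)` and `b (b - a)`
    have hN : N ^ 2 = -a * (b - a) := by rw [hN1]; linear_combination hab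
    have hM : M ^ 2 = b * (b - a) := by rw [hN2]; linear_combination hab
    have ha0 : a ≠ 0 := fun h => by
      rw [h, neg_zero, zero_mul] at hN
      exact hN1'.ne' (pow_eq_zero_iff two_ne_zero |>.1 hN)
    have ep : (l * κ / N) ^ 2 = b / (b - a) := by
      rw [div_pow, hN, div_eq_div_iff (mul_ne_zero (neg_ne_zero.2 ha0) hba.ne') hba.ne']
      linear_combination (b - a) * hab
    have er : (a / N) ^ 2 = -a / (b - a) := by
      rw [div_pow, hN, div_eq_div_iff (mul_ne_zero (neg_ne_zero.2 ha0) hba.ne') hba.ne']; ring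
    have es : (l * κ / M) ^ 2 = -a / (b - a) := by
      rw [div_pow, hM, div_eq_div_iff (mul_ne_zero hb0.ne' hba.ne') hba.ne']
      linear_combination (b - a) * hab
    have et : (b / M) ^ 2 = b / (b - a) := by
      rw [div_pow, hM, div_eq_div_iff (mul_ne_zero hb0.ne' hba.ne') hba.ne']; ring
    have epr : l * κ / N * (a / N) = -(l * κ) / (b - a) := by
      rw [div_mul_div_comm, ← sq N, hN,
        div_eq_div_iff (mul_ne_zero (neg_ne_zero.2 ha0) hba.ne') hba.ne']; ring
    have est : l * κ / M * (b / M) = l * κ / (b - a) := by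
      rw [div_mul_div_comm, ← sq M, hM,
        div_eq_div_iff (mul_ne_zero hb0.ne' hba.ne') hba.ne']; ring
    have hμprod : (κ ^ 2 + b) * (κ ^ 2 + a) = (κ ^ 2) ^ 2 := by
      linear_combination hab + κ ^ 2 * hsum
    have hbp : 0 < κ ^ 2 + b := by positivity
    refine exists_isHermiteFrame_of_kMat hkm ?_ ?_ ?_ ?_ ?_ ?_ ?_ ?_
    · rw [ep, er]; field_simp; ring
    · rw [es, et]; field_simp; ring
    · rw [div_mul_div_comm, div_mul_div_comm, ← add_div, hab]; ring
    · rw [hμp]; exact hbp.le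
    · rw [hμm]
      exact nonneg_of_mul_nonneg_right (by rw [hμprod]; positivity) hbp
    · rw [hμp, hμm, ep, es]; field_simp; linear_combination (b - a) * hsum
    · rw [hμp, hμm, epr, est]; field_simp; ring
    · rw [hμp, hμm, er, et]; field_simp; ring

end Frame

/-! ### Products of Hermite functions in a frame -/

section HermiteProd

variable {l κ : ℝ} {α β : ℝ × ℝ}

/-- The product of two unnormalised Hermite functions in the linear forms `α·u` and `β·u`. -/
def hermiteProd (α β : ℝ × ℝ) (m : ℕ × ℕ) (u : ℝ × ℝ) : ℂ :=
  (rawHermite m.1 (α.1 * u.1 + α.2 * u.2) * rawHermite m.2 (β.1 * u.1 + β.2 * u.2) : ℝ)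

/-- The class of products of polynomials with the Gaussian `exp (-((α·u)² + (β·u)²) / 2)`. -/
abbrev FrameGauss (α β : ℝ × ℝ) : (ℝ × ℝ → ℂ) → Prop :=
  PolyGauss ((-(α.1 ^ 2 + β.1 ^ 2) / 2 : ℝ) : ℂ) ((-(α.1 * α.2 + β.1 * β.2) / 2 : ℝ) : ℂ)
    ((-(α.2 ^ 2 + β.2 ^ 2) / 2 : ℝ) : ℂ)

theorem PolyGauss.linear_mul {a b c : ℂ} {f : ℝ × ℝ → ℂ} (hf : PolyGauss a b c f) (ξ η : ℝ) :
    PolyGauss a b c fun q => ((ξ * q.1 + η * q.2 : ℝ) : ℂ) * f q := by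
  simpa using hf.linear_pow_mul ξ η 1

theorem hermiteProd_succ_fst (m : ℕ × ℕ) (u : ℝ × ℝ) :
    hermiteProd α β (m.1 + 1, m.2) u =
      2 * (((α.1 * u.1 + α.2 * u.2 : ℝ) : ℂ) * hermiteProd α β m u) +
        (-(2 * m.1 : ℂ)) * hermiteProd α β (m.1 - 1, m.2) u := by
  simp only [hermiteProd, rawHermite_succ]
  push_cast; ring

theorem hermiteProd_succ_snd (m : ℕ × ℕ) (u : ℝ × ℝ) :
    hermiteProd α β (m.1, m.2 + 1) u =
      2 * (((β.1 * u.1 + β.2 * u.2 : ℝ) : ℂ) * hermiteProd α β m u) +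
        (-(2 * m.2 : ℂ)) * hermiteProd α β (m.1, m.2 - 1) u := by
  simp only [hermiteProd, rawHermite_succ]
  push_cast; ring

theorem hermiteProd_zero :
    hermiteProd α β (0, 0) = fun u => Complex.exp (quadForm
      ((-(α.1 ^ 2 + β.1 ^ 2) / 2 : ℝ) : ℂ) ((-(α.1 * α.2 + β.1 * β.2) / 2 : ℝ) : ℂ)
      ((-(α.2 ^ 2 + β.2 ^ 2) / 2 : ℝ) : ℂ) u) := by
  funext u
  simp only [hermiteProd, rawHermite_zero]
  rw [← Real.exp_add, Complex.ofReal_exp, quadForm]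
  congr 1; push_cast; ring

theorem frameGauss_hermiteProd (α β : ℝ × ℝ) (m : ℕ × ℕ) :
    FrameGauss α β (hermiteProd α β m) := by
  obtain ⟨m, n⟩ := m
  induction n using Nat.strong_induction_on generalizing m with
  | _ n ihn =>
    rcases n with _ | n
    · induction m using Nat.strong_induction_on with
      | _ m ihm =>
        rcases m with _ | m
        · rw [hermiteProd_zero]; exact PolyGauss.base
        · rw [funext (hermiteProd_succ_fst (m, 0))]
          exact (((ihm m (by omega)).linear_mul _ _).const_mul _).add
            ((ihm (m - 1) (by omega)).const_mul _)
    · rw [funext (hermiteProd_succ_snd (m, n))]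
      exact (((ihn n (by omega) m).linear_mul _ _).const_mul _).add
        ((ihn (n - 1) (by omega) m).const_mul _)

theorem IsHermiteFrame.det_ne_zero (h : IsHermiteFrame l κ α β) (hκ : κ ≠ 0) :
    α.1 * β.2 - α.2 * β.1 ≠ 0 := fun h0 => by
  have := h.det
  rw [h0] at this
  exact hκ (pow_eq_zero_iff two_ne_zero |>.1 (by rw [← this]; norm_num))

theorem mul_mem_span_range {X ι : Type*} {v : ι → X → ℂ} {g : X → ℂ}
    (h : ∀ m, (fun u => g u * v m u) ∈ Submodule.span ℂ (Set.range v)) {f : X → ℂ}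
    (hf : f ∈ Submodule.span ℂ (Set.range v)) :
    (fun u => g u * f u) ∈ Submodule.span ℂ (Set.range v) := by
  have h1 : Submodule.span ℂ (Set.range v) ≤
      (Submodule.span ℂ (Set.range v)).comap (LinearMap.mulLeft ℂ g) := by
    rw [Submodule.span_le]
    rintro _ ⟨m, rfl⟩
    exact h m
  exact h1 hf

/-- In a Hermite frame every polynomial multiple of the Gaussian is a combination of products of
Hermite functions. -/
theorem IsHermiteFrame.mem_span (h : IsHermiteFrame l κ α β) (hκ : κ ≠ 0) {f : ℝ × ℝ → ℂ}
    (hf : FrameGauss α β f) : f ∈ Submodule.span ℂ (Set.range (hermiteProd α β)) := by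
  set V := Submodule.span ℂ (Set.range (hermiteProd α β))
  have hmem : ∀ m, hermiteProd α β m ∈ V := fun m => Submodule.subset_span ⟨m, rfl⟩
  have hξ : ∀ f ∈ V, (fun u : ℝ × ℝ => ((α.1 * u.1 + α.2 * u.2 : ℝ) : ℂ) * f u) ∈ V := by
    refine fun f hf => mul_mem_span_range (fun m => ?_) hf
    have e : (fun u : ℝ × ℝ => ((α.1 * u.1 + α.2 * u.2 : ℝ) : ℂ) * hermiteProd α β m u) =
        (1 / 2 : ℂ) • hermiteProd α β (m.1 + 1, m.2) +
          (m.1 : ℂ) • hermiteProd α β (m.1 - 1, m.2) := by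
      funext u
      simp only [Pi.add_apply, Pi.smul_apply, smul_eq_mul, hermiteProd_succ_fst]
      ring
    rw [e]
    exact V.add_mem (V.smul_mem _ (hmem _)) (V.smul_mem _ (hmem _))
  have hη : ∀ f ∈ V, (fun u : ℝ × ℝ => ((β.1 * u.1 + β.2 * u.2 : ℝ) : ℂ) * f u) ∈ V := by
    refine fun f hf => mul_mem_span_range (fun m => ?_) hf
    have e : (fun u : ℝ × ℝ => ((β.1 * u.1 + β.2 * u.2 : ℝ) : ℂ) * hermiteProd α β m u) =
        (1 / 2 : ℂ) • hermiteProd α β (m.1, m.2 + 1) +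
          (m.2 : ℂ) • hermiteProd α β (m.1, m.2 - 1) := by
      funext u
      simp only [Pi.add_apply, Pi.smul_apply, smul_eq_mul, hermiteProd_succ_snd]
      ring
    rw [e]
    exact V.add_mem (V.smul_mem _ (hmem _)) (V.smul_mem _ (hmem _))
  have hD : ((α.1 * β.2 - α.2 * β.1 : ℝ) : ℂ) ≠ 0 := Complex.ofReal_ne_zero.2 (h.det_ne_zero hκ)
  induction hf with
  | base => rw [← hermiteProd_zero]; exact hmem _
  | add _ _ h1 h2 => exact V.add_mem h1 h2
  | const_mul k _ h1 => exact V.smul_mem k h1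
  | @fst_mul f _ h1 =>
    convert V.add_mem (V.smul_mem ((β.2 : ℂ) / ((α.1 * β.2 - α.2 * β.1 : ℝ) : ℂ)) (hξ _ h1))
      (V.smul_mem (-(α.2 : ℂ) / ((α.1 * β.2 - α.2 * β.1 : ℝ) : ℂ)) (hη _ h1)) using 1
    funext u
    simp only [Pi.add_apply, Pi.smul_apply, smul_eq_mul]
    field_simp
    push_cast; ring
  | @snd_mul f _ h1 =>
    convert V.add_mem (V.smul_mem (-(β.1 : ℂ) / ((α.1 * β.2 - α.2 * β.1 : ℝ) : ℂ)) (hξ _ h1))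
      (V.smul_mem ((α.1 : ℂ) / ((α.1 * β.2 - α.2 * β.1 : ℝ) : ℂ)) (hη _ h1)) using 1
    funext u
    simp only [Pi.add_apply, Pi.smul_apply, smul_eq_mul]
    field_simp
    push_cast; ring

theorem re_quadForm_ofReal (a b c : ℝ) (q : ℝ × ℝ) :
    (quadForm a b c q).re = a * q.1 ^ 2 + 2 * b * q.1 * q.2 + c * q.2 ^ 2 := by
  rw [← Complex.ofReal_re (a * q.1 ^ 2 + 2 * b * q.1 * q.2 + c * q.2 ^ 2), quadForm]
  push_cast; rfl

theorem IsHermiteFrame.isNegQuad (h : IsHermiteFrame l κ α β) (hκ : κ ≠ 0) :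
    IsNegQuad ((-(α.1 ^ 2 + β.1 ^ 2) / 2 : ℝ) : ℂ) ((-(α.1 * α.2 + β.1 * β.2) / 2 : ℝ) : ℂ)
      ((-(α.2 ^ 2 + β.2 ^ 2) / 2 : ℝ) : ℂ) := by
  have hκ2 : 0 < κ ^ 2 := by positivity
  have hs : 0 < α.1 ^ 2 + α.2 ^ 2 + β.1 ^ 2 + β.2 ^ 2 := by
    by_contra h0
    have h1 : α.1 = 0 := by nlinarith [sq_nonneg α.1, sq_nonneg α.2, sq_nonneg β.1, sq_nonneg β.2]
    have h2 : α.2 = 0 := by nlinarith [sq_nonneg α.1, sq_nonneg α.2, sq_nonneg β.1, sq_nonneg β.2]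
    exact h.det_ne_zero hκ (by rw [h1, h2]; ring)
  refine ⟨κ ^ 2 / (2 * (α.1 ^ 2 + α.2 ^ 2 + β.1 ^ 2 + β.2 ^ 2)), by positivity, fun q => ?_⟩
  rw [re_quadForm_ofReal]
  set ξ := α.1 * q.1 + α.2 * q.2 with hξ
  set η := β.1 * q.1 + β.2 * q.2 with hη
  -- `q` is recovered from `ξ` and `η` by Cramer's rule
  have e1 : κ ^ 2 * (q.1 ^ 2 + q.2 ^ 2) =
      ξ ^ 2 * (β.1 ^ 2 + β.2 ^ 2) + η ^ 2 * (α.1 ^ 2 + α.2 ^ 2) := by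
    rw [← h.det, hξ, hη]
    linear_combination (-2) * (α.1 * q.1 + α.2 * q.2) * (β.1 * q.1 + β.2 * q.2) * h.orth
  have e2 : κ ^ 2 * (q.1 ^ 2 + q.2 ^ 2) ≤
      (ξ ^ 2 + η ^ 2) * (α.1 ^ 2 + α.2 ^ 2 + β.1 ^ 2 + β.2 ^ 2) := by
    rw [e1]
    nlinarith [mul_nonneg (sq_nonneg ξ) (add_nonneg (sq_nonneg α.1) (sq_nonneg α.2)),
      mul_nonneg (sq_nonneg η) (add_nonneg (sq_nonneg β.1) (sq_nonneg β.2))]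
  have e3 : κ ^ 2 / (2 * (α.1 ^ 2 + α.2 ^ 2 + β.1 ^ 2 + β.2 ^ 2)) * (q.1 ^ 2 + q.2 ^ 2) ≤
      (ξ ^ 2 + η ^ 2) / 2 := by
    rw [div_mul_eq_mul_div, div_le_div_iff₀ (by positivity) two_pos]
    nlinarith
  have e4 : -(α.1 ^ 2 + β.1 ^ 2) / 2 * q.1 ^ 2 + 2 * (-(α.1 * α.2 + β.1 * β.2) / 2) * q.1 * q.2 +
      -(α.2 ^ 2 + β.2 ^ 2) / 2 * q.2 ^ 2 = -((ξ ^ 2 + η ^ 2) / 2) := by rw [hξ, hη]; ring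
  rw [e4, neg_mul]
  linarith

/-- The eigenvalue equation
`∂ₓ² h + ∂_z² h = ((l x - κ z)² + κ² x² - ν) h` for a product of Hermite functions. -/
theorem IsHermiteFrame.exists_derivs (h : IsHermiteFrame l κ α β) (m : ℕ × ℕ) :
    ∃ h1 h11 h2 h22 : ℝ × ℝ → ℂ, FrameGauss α β h1 ∧ FrameGauss α β h11 ∧ FrameGauss α β h2 ∧
      FrameGauss α β h22 ∧
      (∀ x y, HasDerivAt (fun s : ℝ => hermiteProd α β m (s, y)) (h1 (x, y)) x) ∧
      (∀ x y, HasDerivAt (fun s : ℝ => h1 (s, y)) (h11 (x, y)) x) ∧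
      (∀ x y, HasDerivAt (fun s : ℝ => hermiteProd α β m (x, s)) (h2 (x, y)) y) ∧
      (∀ x y, HasDerivAt (fun s : ℝ => h2 (x, s)) (h22 (x, y)) y) ∧
      ∀ q, h11 q + h22 q = (((l * q.1 - κ * q.2) ^ 2 + κ ^ 2 * q.1 ^ 2 -
        ((α.1 ^ 2 + α.2 ^ 2) * (2 * m.1 + 1) + (β.1 ^ 2 + β.2 ^ 2) * (2 * m.2 + 1)) : ℝ) : ℂ) *
          hermiteProd α β m q := by
  have hf := frameGauss_hermiteProd α β m
  obtain ⟨h1, hf1, hd1⟩ := hf.exists_hasDerivAt_fst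
  obtain ⟨h11, hf11, hd11⟩ := hf1.exists_hasDerivAt_fst
  obtain ⟨h2, hf2, hd2⟩ := hf.exists_hasDerivAt_snd
  obtain ⟨h22, hf22, hd22⟩ := hf2.exists_hasDerivAt_snd
  refine ⟨h1, h11, h2, h22, hf1, hf11, hf2, hf22, hd1, hd11, hd2, hd22, fun q => ?_⟩
  -- the first and second derivative along a line of `f(ξ) g(η)`, with
  -- `f' = F`, `F' = (ξ² - (2 m + 1)) f`, and the same for `g`
  have key : ∀ (p r ξ0 η0 s : ℝ), HasDerivAt (fun s : ℝ =>
      ((rawHermite m.1 (p * s + ξ0) * rawHermite m.2 (r * s + η0) : ℝ) : ℂ))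
      ((p * ((p * s + ξ0) * rawHermite m.1 (p * s + ξ0) - rawHermite (m.1 + 1) (p * s + ξ0)) *
        rawHermite m.2 (r * s + η0) + r * rawHermite m.1 (p * s + ξ0) *
        ((r * s + η0) * rawHermite m.2 (r * s + η0) - rawHermite (m.2 + 1) (r * s + η0)) : ℝ) : ℂ)
        s := fun p r ξ0 η0 s => by
    have a1 : HasDerivAt (fun s : ℝ => p * s + ξ0) p s := by
      simpa using ((hasDerivAt_id s).const_mul p).add_const ξ0
    have a2 : HasDerivAt (fun s : ℝ => r * s + η0) r s := by
      simpa using ((hasDerivAt_id s).const_mul r).add_const η0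
    have := ((hasDerivAt_rawHermite m.1 (p * s + ξ0)).comp s a1).mul
      ((hasDerivAt_rawHermite m.2 (r * s + η0)).comp s a2)
    refine (this.ofReal_comp).congr_deriv ?_
    congr 1
    simp only [Function.comp_apply]; ring
  have key2 : ∀ (p r ξ0 η0 s : ℝ), HasDerivAt (fun s : ℝ =>
      ((p * ((p * s + ξ0) * rawHermite m.1 (p * s + ξ0) - rawHermite (m.1 + 1) (p * s + ξ0)) *
        rawHermite m.2 (r * s + η0) + r * rawHermite m.1 (p * s + ξ0) *
        ((r * s + η0) * rawHermite m.2 (r * s + η0) - rawHermite (m.2 + 1) (r * s + η0)) : ℝ) : ℂ))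
      ((p ^ 2 * ((p * s + ξ0) ^ 2 - (2 * m.1 + 1)) *
          (rawHermite m.1 (p * s + ξ0) * rawHermite m.2 (r * s + η0)) +
        r ^ 2 * ((r * s + η0) ^ 2 - (2 * m.2 + 1)) *
          (rawHermite m.1 (p * s + ξ0) * rawHermite m.2 (r * s + η0)) +
        2 * (p * r) * (((p * s + ξ0) * rawHermite m.1 (p * s + ξ0) -
          rawHermite (m.1 + 1) (p * s + ξ0)) *
          ((r * s + η0) * rawHermite m.2 (r * s + η0) - rawHermite (m.2 + 1) (r * s + η0))) :
          ℝ) : ℂ) s := fun p r ξ0 η0 s => by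
    have a1 : HasDerivAt (fun s : ℝ => p * s + ξ0) p s := by
      simpa using ((hasDerivAt_id s).const_mul p).add_const ξ0
    have a2 : HasDerivAt (fun s : ℝ => r * s + η0) r s := by
      simpa using ((hasDerivAt_id s).const_mul r).add_const η0
    have b1 := (hasDerivAt_rawHermite m.1 (p * s + ξ0)).comp s a1
    have b2 := (hasDerivAt_rawHermite m.2 (r * s + η0)).comp s a2
    have c1 := (hasDerivAt_deriv_rawHermite m.1 (p * s + ξ0)).comp s a1
    have c2 := (hasDerivAt_deriv_rawHermite m.2 (r * s + η0)).comp s a2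
    have := ((c1.const_mul p).mul b2).add ((b1.const_mul r).mul c2)
    refine (this.ofReal_comp).congr_deriv ?_
    congr 1
    simp only [Function.comp_apply]; ring
  obtain ⟨x, z⟩ := q
  have e11 : (fun s : ℝ => h1 (s, z)) = _ := funext fun s => (hd1 s z).unique
    (by simpa only [hermiteProd] using key α.1 β.1 (α.2 * z) (β.2 * z) s)
  have e22 : (fun s : ℝ => h2 (x, s)) = _ := funext fun s => (hd2 x s).unique
    (by simpa only [hermiteProd, add_comm] using key α.2 β.2 (α.1 * x) (β.1 * x) s)
  have f11 := hd11 x z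
  have f22 := hd22 x z
  rw [e11] at f11
  rw [e22] at f22
  rw [f11.unique (key2 α.1 β.1 (α.2 * z) (β.2 * z) x),
    f22.unique (by simpa only [add_comm] using key2 α.2 β.2 (α.1 * x) (β.1 * x) z)]
  simp only [hermiteProd]
  rw [← Complex.ofReal_add, ← Complex.ofReal_mul]
  congr 1
  linear_combination rawHermite m.1 (α.1 * x + α.2 * z) * rawHermite m.2 (β.1 * x + β.2 * z) *
      (x ^ 2 * h.xx + 2 * x * z * h.xz + z ^ 2 * h.zz) +
    2 * ((α.1 * x + α.2 * z) * rawHermite m.1 (α.1 * x + α.2 * z) -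
      rawHermite (m.1 + 1) (α.1 * x + α.2 * z)) *
    ((β.1 * x + β.2 * z) * rawHermite m.2 (β.1 * x + β.2 * z) -
      rawHermite (m.2 + 1) (β.1 * x + β.2 * z)) * h.orth

/-- The area-preserving change of variables `u ↦ (α·u, β·u)`, up to the Jacobian `|κ|`. -/
theorem IsHermiteFrame.integral_comp (h : IsHermiteFrame l κ α β) (hκ : κ ≠ 0) {φ : ℝ × ℝ → ℂ}
    (hφ : Continuous φ) :
    |κ| * ∫ u : ℝ × ℝ, φ (α.1 * u.1 + α.2 * u.2, β.1 * u.1 + β.2 * u.2) = ∫ u, φ u := by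
  set T : ℝ × ℝ →ₗ[ℝ] ℝ × ℝ := Matrix.toLin (Module.Basis.finTwoProd ℝ) (Module.Basis.finTwoProd ℝ)
    !![α.1, α.2; β.1, β.2] with hT
  have hTa : ∀ u, T u = (α.1 * u.1 + α.2 * u.2, β.1 * u.1 + β.2 * u.2) := fun u => by
    rw [hT, Matrix.toLin_finTwoProd_apply]
  have hdet : LinearMap.det T = α.1 * β.2 - α.2 * β.1 := by
    rw [hT, LinearMap.det_toLin, Matrix.det_fin_two_of]
  have habs : |LinearMap.det T| = |κ| := by
    rw [hdet, ← Real.sqrt_sq_eq_abs, h.det, Real.sqrt_sq_eq_abs]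
  have hd0 : LinearMap.det T ≠ 0 := by rw [hdet]; exact h.det_ne_zero hκ
  have hmap := Measure.map_linearMap_addHaar_eq_smul_addHaar (volume : Measure (ℝ × ℝ)) hd0
  have hTc : Continuous T := LinearMap.continuous_of_finiteDimensional T
  have h1 := integral_map (μ := (volume : Measure (ℝ × ℝ))) hTc.aemeasurable
    (f := φ) hφ.aestronglyMeasurable
  rw [hmap, integral_smul_measure, ENNReal.toReal_ofReal (abs_nonneg _), abs_inv, habs] at h1
  simp only [hTa] at h1
  rw [← h1, Complex.real_smul, Complex.ofReal_inv, mul_inv_cancel_left₀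
    (Complex.ofReal_ne_zero.2 (abs_ne_zero.2 hκ))]

end HermiteProd

/-! ### The functions `T_λ h_{λ,m}` -/

section ThEig

/-- Completing the square in the second variable, the partial transform of `exp (a x² + 2 b x z + c
z²)` is a Gaussian again; its real part is negative definite because `a - b² / c` and `κ² / (4 c)`
are negative and the mixed coefficient is imaginary. -/
theorem IsNegQuad.planeFT {a b c κ : ℝ} (hκ : κ ≠ 0) (h : IsNegQuad a b c) :
    (c : ℂ).re < 0 ∧ IsNegQuad ((a : ℂ) - (b : ℂ) ^ 2 / c) (Complex.I * κ * b / (2 * c))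
      ((κ : ℂ) ^ 2 / (4 * c)) := by
  obtain ⟨ε, hε, hq⟩ := h
  have hc : c ≤ -ε := by simpa [re_quadForm_ofReal] using hq (0, 1)
  have hc0 : c < 0 := by linarith
  have ha : a - b ^ 2 / c ≤ -ε := by
    have h1 := hq (1, -b / c)
    rw [re_quadForm_ofReal] at h1
    simp only at h1
    have e : a * 1 ^ 2 + 2 * b * 1 * (-b / c) + c * (-b / c) ^ 2 = a - b ^ 2 / c := by
      field_simp; ring
    rw [e] at h1
    nlinarith [mul_nonneg hε.le (sq_nonneg (-b / c))]
  refine ⟨by simpa using hc0, min ε (κ ^ 2 / (4 * -c)), ?_, fun q => ?_⟩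
  · have : 0 < κ ^ 2 := by positivity
    exact lt_min hε (div_pos this (by linarith))
  · have e : quadForm ((a : ℂ) - (b : ℂ) ^ 2 / c) (Complex.I * κ * b / (2 * c))
        ((κ : ℂ) ^ 2 / (4 * c)) q =
        (((a - b ^ 2 / c) * q.1 ^ 2 + κ ^ 2 / (4 * c) * q.2 ^ 2 : ℝ) : ℂ) +
          ((2 * (κ * b / (2 * c)) * q.1 * q.2 : ℝ) : ℂ) * Complex.I := by
      rw [quadForm]; push_cast; ring
    have e2 : κ ^ 2 / (4 * c) = -(κ ^ 2 / (4 * -c)) := by rw [mul_neg, div_neg, neg_neg]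
    rw [e, Complex.add_re, Complex.ofReal_re, Complex.re_ofReal_mul, Complex.I_re, mul_zero,
      add_zero, e2]
    have h1 := min_le_left ε (κ ^ 2 / (4 * -c))
    have h2 := min_le_right ε (κ ^ 2 / (4 * -c))
    set M := min ε (κ ^ 2 / (4 * -c))
    have h3 := mul_le_mul_of_nonneg_right (show a - b ^ 2 / c ≤ -M by linarith) (sq_nonneg q.1)
    have h4 := mul_le_mul_of_nonneg_right h2 (sq_nonneg q.2)
    linarith

variable {l κ : ℝ}

/-- The normalising factor of `T_λ h_{λ,m}` in terms of the unnormalised Hermite functions. -/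
def thNorm (κ : ℝ) (m : ℕ × ℕ) : ℝ :=
  √(|κ| / (2 * Real.pi)) * (√|κ| * ((hermiteNorm m.1)⁻¹ * (hermiteNorm m.2)⁻¹))

theorem thNorm_pos (hκ : κ ≠ 0) (m : ℕ × ℕ) : 0 < thNorm κ m := by
  have := hermiteNorm_pos m.1
  have := hermiteNorm_pos m.2
  have := abs_pos.2 hκ
  unfold thNorm
  positivity

/-- The functions `T_λ h_{λ,m}` are the partial Fourier transforms, up to the phase
`e^{i l x y / 2}`, of products of Hermite functions in a Hermite frame. The class
`PolyGauss a' b' c'` is the image of the class `PolyGauss a b c` under the partial transform. -/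
theorem exists_thEig_eq (hκ : κ ≠ 0) (l : ℝ) :
    ∃ α β, IsHermiteFrame l κ α β ∧
      (∀ m, nuEig l κ m = (α.1 ^ 2 + α.2 ^ 2) * (2 * m.1 + 1) +
        (β.1 ^ 2 + β.2 ^ 2) * (2 * m.2 + 1)) ∧
      (∀ m q, thEig l κ m q = thNorm κ m * (Complex.exp (Complex.I * (l / 2 * q.1 * q.2 : ℝ)) *
        planeFT κ (hermiteProd α β m) q)) ∧
      ∃ a b c : ℂ, IsNegQuad a b c ∧
        (∀ f, FrameGauss α β f → PolyGauss a b c (planeFT κ f)) ∧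
        (∀ g, PolyGauss a b c g → ∃ f, FrameGauss α β f ∧ planeFT κ f = g) := by
  obtain ⟨α, β, hF, hh, hν⟩ := exists_isHermiteFrame hκ l
  have hh' : ∀ m u, (hEig l κ m u : ℂ) =
      (√|κ| * ((hermiteNorm m.1)⁻¹ * (hermiteNorm m.2)⁻¹) : ℝ) * hermiteProd α β m u :=
    fun m u => by
      rw [hh, hermiteProd, hermiteFun_eq, hermiteFun_eq]
      push_cast; ring
  have hneg := hF.isNegQuad hκ
  obtain ⟨hc, hneg'⟩ := hneg.planeFT hκ
  refine ⟨α, β, hF, hν, fun m q => ?_, _, _, _, hneg',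
    fun f hf => hf.planeFT hneg hκ (planeFT_gauss hc),
    fun g hg => hg.exists_planeFT_eq hneg hκ ?_ (planeFT_gauss hc)⟩
  · rw [thEig, opT_eq_planeFT, funext (hh' m), planeFT_const_mul, thNorm]
    push_cast; ring
  · have hc0 : ((-(α.2 ^ 2 + β.2 ^ 2) / 2 : ℝ) : ℂ) ≠ 0 := fun h => by rw [h] at hc; simp at hc
    rw [Ne, Complex.cpow_eq_zero_iff]
    exact fun h => (div_ne_zero (Complex.ofReal_ne_zero.2 Real.pi_ne_zero) (neg_ne_zero.2 hc0)) h.1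

theorem norm_exp_I_mul (r : ℝ) : ‖Complex.exp (Complex.I * (r : ℂ))‖ = 1 := by
  rw [mul_comm, Complex.norm_exp_ofReal_mul_I]

theorem conj_exp_I_mul_mul_self (r : ℝ) :
    conj (Complex.exp (Complex.I * (r : ℂ))) * Complex.exp (Complex.I * (r : ℂ)) = 1 := by
  rw [Complex.conj_mul', norm_exp_I_mul]; simp

theorem memLp_thEig (hκ : κ ≠ 0) (l : ℝ) (m : ℕ × ℕ) : MemLp (thEig l κ m) 2 := by
  obtain ⟨α, β, hF, -, hth, a, b, c, hneg, hft, -⟩ := exists_thEig_eq hκ l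
  have h1 := hft _ (frameGauss_hermiteProd α β m)
  have h2 := (h1.memLp_two hneg).const_mul (thNorm κ m : ℂ)
  refine h2.of_le ?_ (ae_of_all _ fun q => ?_)
  · rw [funext (hth m)]
    have := h1.contDiff.continuous
    exact (by fun_prop : Continuous _).aestronglyMeasurable
  · rw [hth, norm_mul, norm_mul, norm_exp_I_mul, one_mul, norm_mul]

/-- Orthonormality of the functions `T_λ h_{λ,m}`: the phase cancels, the partial transform is
unitary up to a constant, and the frame changes variables to a product of integrals over lines. -/
theorem integral_conj_thEig_mul_thEig (hκ : κ ≠ 0) (l : ℝ) (m n : ℕ × ℕ) :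
    ∫ q, conj (thEig l κ m q) * thEig l κ n q = if m = n then 1 else 0 := by
  obtain ⟨α, β, hF, -, hth, a, b, c, hneg, hft, -⟩ := exists_thEig_eq hκ l
  have hnegF := hF.isNegQuad hκ
  have hPm := frameGauss_hermiteProd α β m
  have hPn := frameGauss_hermiteProd α β n
  have e1 : ∀ q, conj (thEig l κ m q) * thEig l κ n q = (thNorm κ m * thNorm κ n : ℝ) *
      (conj (planeFT κ (hermiteProd α β m) q) * planeFT κ (hermiteProd α β n) q) := fun q => by
    rw [hth, hth, map_mul, map_mul, Complex.conj_ofReal, Complex.ofReal_mul (thNorm κ m)]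
    linear_combination (thNorm κ m * thNorm κ n * conj (planeFT κ (hermiteProd α β m) q) *
      planeFT κ (hermiteProd α β n) q : ℂ) * conj_exp_I_mul_mul_self (l / 2 * q.1 * q.2)
  have i1 : Integrable fun q => conj (planeFT κ (hermiteProd α β m) q) *
      planeFT κ (hermiteProd α β n) q :=
    ((hft _ hPm).memLp_two hneg).star.integrable_mul ((hft _ hPn).memLp_two hneg)
  have i2 : Integrable fun q => conj (hermiteProd α β m q) * hermiteProd α β n q :=
    (hPm.memLp_two hnegF).star.integrable_mul (hPn.memLp_two hnegF)
  have e2 : ∫ q, conj (planeFT κ (hermiteProd α β m) q) * planeFT κ (hermiteProd α β n) q =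
      (2 * Real.pi / |κ| : ℝ) * ∫ q, conj (hermiteProd α β m q) * hermiteProd α β n q := by
    rw [Measure.volume_eq_prod] at i1 i2 ⊢
    rw [integral_prod _ i1, integral_prod _ i2, ← integral_const_mul]
    exact integral_congr_ae (ae_of_all _ fun x =>
      integral_conj_planeFT_mul_planeFT hnegF hκ hPm hPn x)
  have e3 : ∫ q, conj (hermiteProd α β m q) * hermiteProd α β n q = (|κ|⁻¹ : ℝ) *
      ((∫ x, rawHermite m.1 x * rawHermite n.1 x : ℝ) *
        (∫ x, rawHermite m.2 x * rawHermite n.2 x : ℝ)) := by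
    have hc : ∀ k, Continuous (rawHermite k) := fun k => (contDiff_rawHermite k).continuous
    have h1 := hF.integral_comp hκ (φ := fun u : ℝ × ℝ =>
      (((rawHermite m.1 u.1 * rawHermite n.1 u.1) * (rawHermite m.2 u.2 * rawHermite n.2 u.2) : ℝ) :
        ℂ)) (by
        have := hc m.1; have := hc m.2; have := hc n.1; have := hc n.2
        fun_prop)
    have h2 : ∫ u : ℝ × ℝ, (((rawHermite m.1 u.1 * rawHermite n.1 u.1) *
        (rawHermite m.2 u.2 * rawHermite n.2 u.2) : ℝ) : ℂ) =
        ((∫ x, rawHermite m.1 x * rawHermite n.1 x : ℝ) *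
          (∫ x, rawHermite m.2 x * rawHermite n.2 x : ℝ)) := by
      have h3 := integral_prod_mul (μ := volume) (ν := volume)
        (fun x => rawHermite m.1 x * rawHermite n.1 x) (fun x => rawHermite m.2 x * rawHermite n.2 x)
      rw [← Measure.volume_eq_prod] at h3
      rw [integral_complex_ofReal, h3, Complex.ofReal_mul]
    rw [← h2, ← h1, Complex.ofReal_inv, inv_mul_cancel_left₀
      (Complex.ofReal_ne_zero.2 (abs_ne_zero.2 hκ))]
    refine integral_congr_ae (ae_of_all _ fun u => ?_)
    simp only [hermiteProd, Complex.conj_ofReal]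
    push_cast; ring
  have e4 : ∀ j k : ℕ, ∫ x, rawHermite j x * rawHermite k x =
      hermiteNorm j * hermiteNorm k * if j = k then 1 else 0 := fun j k => by
    have := integral_hermiteFun_mul j k
    rw [← this, ← integral_const_mul]
    refine integral_congr_ae (ae_of_all _ fun x => ?_)
    have := hermiteNorm_pos j
    have := hermiteNorm_pos k
    simp only [hermiteFun_eq]
    field_simp
  simp only [e1]
  rw [integral_const_mul, e2, e3, e4, e4]
  have hk : 0 < |κ| := abs_pos.2 hκ
  have hs1 : √(|κ| / (2 * Real.pi)) ^ 2 = |κ| / (2 * Real.pi) := Real.sq_sqrt (by positivity)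
  have hs2 : √|κ| ^ 2 = |κ| := Real.sq_sqrt hk.le
  have h1 := hermiteNorm_pos m.1
  have h2 := hermiteNorm_pos m.2
  have h3 := hermiteNorm_pos n.1
  have h4 := hermiteNorm_pos n.2
  have e5 : thNorm κ m * thNorm κ n * (2 * Real.pi / |κ| * (|κ|⁻¹ *
      (hermiteNorm m.1 * hermiteNorm n.1 * (hermiteNorm m.2 * hermiteNorm n.2)))) = 1 := by
    unfold thNorm
    have : 2 * Real.pi / |κ| * (√(|κ| / (2 * Real.pi)) ^ 2 * √|κ| ^ 2 * |κ|⁻¹) = 1 := by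
      rw [hs1, hs2]; field_simp
    rw [← this]
    field_simp
  rcases m with ⟨m1, m2⟩
  rcases n with ⟨n1, n2⟩
  simp only at e5 ⊢
  by_cases hm : m1 = n1 <;> by_cases hn : m2 = n2 <;> simp only [Prod.mk.injEq, hm, hn, and_self,
    and_true, and_false, if_true, if_false, mul_zero, mul_one, zero_mul, Complex.ofReal_zero]
  subst hm hn
  rw [← Complex.ofReal_mul, ← Complex.ofReal_mul, ← Complex.ofReal_mul, ← Complex.ofReal_mul, e5,
    Complex.ofReal_one]

/-- The functions `T_λ h_{λ,m}`, `m ∈ ℕ²`, are total in `L²(ℝ²)`. -/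
theorem ae_eq_zero_of_integral_mul_conj_thEig_eq_zero (hκ : κ ≠ 0) (l : ℝ) {G : ℝ × ℝ → ℂ}
    (hG : MemLp G 2) (h : ∀ m, ∫ q, G q * conj (thEig l κ m q) = 0) : G =ᵐ[volume] 0 := by
  obtain ⟨α, β, hF, -, hth, a, b, c, hneg, hft, hsurj⟩ := exists_thEig_eq hκ l
  -- `G' = conj G · e^{i l x y / 2}` is orthogonal to the transforms of all polynomial Gaussians
  set E : ℝ × ℝ → ℂ := fun q => Complex.exp (Complex.I * (l / 2 * q.1 * q.2 : ℝ)) with hE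
  have hEc : Continuous E := by fun_prop
  have hG' : MemLp (fun q => conj (G q) * E q) 2 :=
    hG.star.of_le (hG.star.1.mul hEc.aestronglyMeasurable) (ae_of_all _ fun q => by
      rw [norm_mul, hE, norm_exp_I_mul, mul_one]; exact le_rfl)
  have h1 : ∀ f ∈ Submodule.span ℂ (Set.range (hermiteProd α β)), FrameGauss α β f ∧
      ∫ q, conj (G q) * E q * planeFT κ f q = 0 := by
    intro f hf
    induction hf using Submodule.span_induction with
    | mem f hf =>
      obtain ⟨m, rfl⟩ := hf
      refine ⟨frameGauss_hermiteProd α β m, ?_⟩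
      have h2 := congrArg conj (h m)
      rw [map_zero, ← integral_conj] at h2
      have h3 : (thNorm κ m : ℂ) * ∫ q, conj (G q) * E q * planeFT κ (hermiteProd α β m) q = 0 := by
        rw [← h2, ← integral_const_mul]
        refine integral_congr_ae (ae_of_all _ fun q => ?_)
        simp only [map_mul, Complex.conj_conj, hth, hE]
        ring
      exact (mul_eq_zero.1 h3).resolve_left (Complex.ofReal_ne_zero.2 (thNorm_pos hκ m).ne')
    | zero =>
      refine ⟨PolyGauss.zero, ?_⟩
      simp [planeFT, lineFT]
    | add f g _ _ hf hg =>
      refine ⟨hf.1.add hg.1, ?_⟩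
      have e : ∀ q, conj (G q) * E q * planeFT κ (f + g) q =
          conj (G q) * E q * planeFT κ f q + conj (G q) * E q * planeFT κ g q := fun q => by
        rw [← mul_add, ← planeFT_add (hF.isNegQuad hκ) hf.1 hg.1]; rfl
      simp only [e]
      rw [integral_add, hf.2, hg.2, add_zero]
      · exact hG'.integrable_mul ((hft _ hf.1).memLp_two hneg)
      · exact hG'.integrable_mul ((hft _ hg.1).memLp_two hneg)
    | smul k f _ hf =>
      refine ⟨hf.1.const_mul k, ?_⟩
      have e : ∀ q, conj (G q) * E q * planeFT κ (k • f) q =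
          k * (conj (G q) * E q * planeFT κ f q) := fun q => by
        have : planeFT κ (k • f) q = k * planeFT κ f q := planeFT_const_mul k f q
        rw [this]; ring
      simp only [e]
      rw [integral_const_mul, hf.2, mul_zero]
  have h2 := ae_eq_zero_of_integral_mul_polyGauss_eq_zero hneg hG' fun g hg => by
    obtain ⟨f, hf, rfl⟩ := hsurj g hg
    exact (h1 f (hF.mem_span hκ hf)).2
  filter_upwards [h2] with q hq
  have h3 : conj (G q) = 0 := (mul_eq_zero.1 hq).resolve_right (Complex.exp_ne_zero _)
  simpa using h3

/-- `T_λ h_{λ,m} = e^{i l x y / 2} w` where `w` is a polynomial multiple of a Gaussian, with the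
eigenvalue equation that `w` satisfies. -/
theorem exists_thEig_eigen (hκ : κ ≠ 0) (l : ℝ) (m : ℕ × ℕ) :
    ∃ (a b c : ℂ) (w w1 w11 w2 w22 : ℝ × ℝ → ℂ), IsNegQuad a b c ∧ PolyGauss a b c w ∧
      PolyGauss a b c w1 ∧ PolyGauss a b c w2 ∧
      (∀ q, thEig l κ m q = Complex.exp (Complex.I * (l / 2 * q.1 * q.2 : ℝ)) * w q) ∧
      (∀ x y, HasDerivAt (fun s : ℝ => w (s, y)) (w1 (x, y)) x) ∧
      (∀ x y, HasDerivAt (fun s : ℝ => w1 (s, y)) (w11 (x, y)) x) ∧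
      (∀ x y, HasDerivAt (fun s : ℝ => w (x, s)) (w2 (x, y)) y) ∧
      (∀ x y, HasDerivAt (fun s : ℝ => w2 (x, s)) (w22 (x, y)) y) ∧
      ∀ q, -(w11 q + w22 q + 2 * Complex.I * l * q.1 * w2 q - (l : ℂ) ^ 2 * (q.1 : ℂ) ^ 2 * w q) +
        (κ : ℂ) ^ 2 * ((q.1 : ℂ) ^ 2 + (q.2 : ℂ) ^ 2) * w q = nuEig l κ m * w q := by
  obtain ⟨α, β, hF, hν, hth, a, b, c, hneg, hft, -⟩ := exists_thEig_eq hκ l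
  obtain ⟨h1, h11, h2, h22, f1, f11, f2, f22, d1, d11, d2, d22, heq⟩ := hF.exists_derivs m
  have hnegF := hF.isNegQuad hκ
  have f := frameGauss_hermiteProd α β m
  set h := hermiteProd α β m with hh
  obtain ⟨N, hN⟩ : ∃ N : ℂ, N = (thNorm κ m : ℂ) := ⟨_, rfl⟩
  have g2 : FrameGauss α β fun q => -Complex.I * κ * ((q.2 : ℂ) * h q) := f.snd_mul.const_mul _
  have g22 : FrameGauss α β fun q => -Complex.I * κ * ((q.2 : ℂ) * (-Complex.I * κ * ((q.2 : ℂ) * h q))) :=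
    g2.snd_mul.const_mul _
  refine ⟨a, b, c, fun q => N * planeFT κ h q, fun q => N * planeFT κ h1 q,
    fun q => N * planeFT κ h11 q, fun q => N * planeFT κ _ q, fun q => N * planeFT κ _ q, hneg,
    (hft _ f).const_mul N, (hft _ f1).const_mul N, (hft _ g2).const_mul N,
    fun q => ?_, fun x y => (hasDerivAt_planeFT_fst hnegF f f1 d1 x y).const_mul N,
    fun x y => (hasDerivAt_planeFT_fst hnegF f1 f11 d11 x y).const_mul N,
    fun x y => (hasDerivAt_planeFT_snd hnegF f x y).const_mul N,
    fun x y => (hasDerivAt_planeFT_snd hnegF g2 x y).const_mul N, fun q => ?_⟩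
  · rw [hth, ← hN]; ring
  · have k1 : planeFT κ h11 q + planeFT κ h22 q =
        ((l ^ 2 + κ ^ 2) * q.1 ^ 2 - nuEig l κ m : ℝ) * planeFT κ h q +
          (-(2 * l * q.1) * Complex.I) * planeFT κ (fun q => -Complex.I * κ * ((q.2 : ℂ) * h q)) q +
          (-1) * planeFT κ (fun q => -Complex.I * κ *
            ((q.2 : ℂ) * (-Complex.I * κ * ((q.2 : ℂ) * h q)))) q := by
      rw [← planeFT_add hnegF f11 f22, ← planeFT_const_mul, ← planeFT_const_mul,
        ← planeFT_const_mul, ← planeFT_add hnegF (f.const_mul _) (g2.const_mul _),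
        ← planeFT_add hnegF ((f.const_mul _).add (g2.const_mul _)) (g22.const_mul _)]
      simp only [planeFT, lineFT]
      refine integral_congr_ae (ae_of_all _ fun z => ?_)
      simp only [heq, ← hν]
      congr 1
      push_cast
      linear_combination (-2 * l * q.1 * κ * z * h (q.1, z) + κ ^ 2 * z ^ 2 * h (q.1, z) : ℂ) *
        Complex.I_sq
    have k2 : planeFT κ h22 q = (Complex.I * κ * q.2) * ((Complex.I * κ * q.2) * planeFT κ h q) := by
      rw [planeFT_deriv_snd hnegF f2 f22 d22, planeFT_deriv_snd hnegF f f2 d2]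
    rw [k2] at k1
    push_cast at k1
    linear_combination (-N) * k1 + N * κ ^ 2 * q.2 ^ 2 * planeFT κ h q * Complex.I_sq

end ThEig

/-! ### Expansion in the functions `T_λ h_{λ,m}`, as a unitary operator -/

section Expansion

/-- Parseval's identity for a total orthonormal family of functions. -/
theorem tsum_enorm_integral_sq {X ι : Type*} [MeasurableSpace X] {μ : Measure X} [DecidableEq ι]
    {e : ι → X → ℂ} (he : ∀ i, MemLp (e i) 2 μ)
    (ho : ∀ i j, ∫ x, conj (e i x) * e j x ∂μ = if i = j then 1 else 0)
    (ht : ∀ G : X → ℂ, MemLp G 2 μ → (∀ i, ∫ x, G x * conj (e i x) ∂μ = 0) → G =ᵐ[μ] 0)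
    {G : X → ℂ} (hG : MemLp G 2 μ) :
    ∑' i, ‖∫ x, G x * conj (e i x) ∂μ‖ₑ ^ 2 = ∫⁻ x, ‖G x‖ₑ ^ 2 ∂μ := by
  set v : ι → Lp ℂ 2 μ := fun i => (he i).toLp (e i) with hv
  have hin : ∀ (i : ι) (F : Lp ℂ 2 μ), ⟪v i, F⟫_ℂ = ∫ x, F x * conj (e i x) ∂μ := fun i F => by
    rw [L2.inner_def]
    refine integral_congr_ae ?_
    filter_upwards [(he i).coeFn_toLp] with x hx
    rw [RCLike.inner_apply, hx]
  have hon : Orthonormal ℂ v := by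
    rw [orthonormal_iff_ite]
    intro i j
    rw [hin, ← ho i j]
    refine integral_congr_ae ?_
    filter_upwards [(he j).coeFn_toLp] with x hx
    rw [hx, mul_comm]
  have hbot : (Submodule.span ℂ (Set.range v))ᗮ = ⊥ := by
    rw [Submodule.eq_bot_iff]
    intro F hF
    rw [Submodule.mem_orthogonal] at hF
    exact Lp.eq_zero_iff_ae_eq_zero.2 (ht F (Lp.memLp F) fun i => by
      rw [← hin]; exact hF _ (Submodule.subset_span ⟨i, rfl⟩))
  set b := HilbertBasis.mkOfOrthogonalEqBot hon hbot
  have hb : ∀ i, b i = v i := fun i => by rw [HilbertBasis.coe_mkOfOrthogonalEqBot]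
  have h1 := b.hasSum_inner_mul_inner (hG.toLp G) (hG.toLp G)
  have h2 : HasSum (fun i => ‖∫ x, G x * conj (e i x) ∂μ‖ ^ 2) (‖hG.toLp G‖ ^ 2) := by
    have h3 := Complex.reCLM.hasSum h1
    have e1 : ∀ i, ⟪b i, hG.toLp G⟫_ℂ = ∫ x, G x * conj (e i x) ∂μ := fun i => by
      rw [hb, hin]
      refine integral_congr_ae ?_
      filter_upwards [hG.coeFn_toLp] with x hx
      rw [hx]
    have e2 : ∀ i, Complex.reCLM (⟪hG.toLp G, b i⟫_ℂ * ⟪b i, hG.toLp G⟫_ℂ) =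
        ‖∫ x, G x * conj (e i x) ∂μ‖ ^ 2 := fun i => by
      rw [← inner_conj_symm (hG.toLp G), e1, Complex.conj_mul', ← Complex.ofReal_pow]
      exact Complex.ofReal_re _
    have e3 : Complex.reCLM ⟪hG.toLp G, hG.toLp G⟫_ℂ = ‖hG.toLp G‖ ^ 2 := by
      rw [inner_self_eq_norm_sq_to_K]
      norm_cast
    simp only [e2] at h3
    rwa [e3] at h3
  have h4 : ENNReal.ofReal (‖hG.toLp G‖ ^ 2) = ∫⁻ x, ‖G x‖ₑ ^ 2 ∂μ := by
    rw [ENNReal.ofReal_pow (norm_nonneg _), Lp.norm_toLp, ENNReal.ofReal_toReal hG.2.ne,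
      eLpNorm_two_eq, ← ENNReal.rpow_natCast, ← ENNReal.rpow_mul]
    norm_num
  rw [← h4, ← h2.tsum_eq, ENNReal.ofReal_tsum_of_nonneg (fun i => by positivity) h2.summable]
  refine tsum_congr fun i => ?_
  rw [ENNReal.ofReal_pow (norm_nonneg _), ofReal_norm]

variable {κ : ℝ}

theorem measurable_muEig (ε κ : ℝ) : Measurable fun l => muEig ε l κ := by
  unfold muEig; fun_prop

theorem continuous_nuEig (κ : ℝ) (m : ℕ × ℕ) : Continuous fun l => nuEig l κ m := by
  unfold nuEig muEig; fun_prop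

theorem measurable_kMat (κ : ℝ) (i j : Fin 2) : Measurable fun l => kMat l κ i j := by
  have h : ∀ l, kMat l κ i j = if l = 0 then (1 : Matrix (Fin 2) (Fin 2) ℝ) i j else
      !![l * κ / √((l * κ) ^ 2 + ((l ^ 2 - |l| * √(l ^ 2 + 4 * κ ^ 2)) / 2) ^ 2),
        l * κ / √((l * κ) ^ 2 + ((l ^ 2 + |l| * √(l ^ 2 + 4 * κ ^ 2)) / 2) ^ 2);
        (l ^ 2 - |l| * √(l ^ 2 + 4 * κ ^ 2)) / 2 /
          √((l * κ) ^ 2 + ((l ^ 2 - |l| * √(l ^ 2 + 4 * κ ^ 2)) / 2) ^ 2),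
        (l ^ 2 + |l| * √(l ^ 2 + 4 * κ ^ 2)) / 2 /
          √((l * κ) ^ 2 + ((l ^ 2 + |l| * √(l ^ 2 + 4 * κ ^ 2)) / 2) ^ 2)] i j := fun l => by
    unfold kMat; split_ifs <;> rfl
  simp only [h]
  refine Measurable.ite (measurableSet_singleton 0) measurable_const ?_
  fin_cases i <;> fin_cases j <;> simp <;> fun_prop

theorem continuous_hermiteFun (n : ℕ) : Continuous (hermiteFun n) := by
  rw [funext (hermiteFun_eq n)]
  exact continuous_const.mul (contDiff_rawHermite n).continuous

theorem measurable_hEig (κ : ℝ) (m : ℕ × ℕ) :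
    Measurable fun p : ℝ × (ℝ × ℝ) => hEig p.1 κ m p.2 := by
  have hk : ∀ i j, Measurable fun p : ℝ × (ℝ × ℝ) => kMat p.1 κ i j := fun i j =>
    (measurable_kMat κ i j).comp measurable_fst
  have hμ : ∀ ε, Measurable fun p : ℝ × (ℝ × ℝ) => muEig ε p.1 κ ^ (1 / 4 : ℝ) := fun ε =>
    ((measurable_muEig ε κ).comp measurable_fst).pow_const _
  have h1 := (continuous_hermiteFun m.1).measurable
  have h2 := (continuous_hermiteFun m.2).measurable
  simp only [hEig, Matrix.mulVec, dotProduct, Fin.sum_univ_two, Matrix.transpose_apply,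
    Matrix.cons_val_zero, Matrix.cons_val_one]
  have hv : ∀ j, Measurable fun p : ℝ × (ℝ × ℝ) => kMat p.1 κ 0 j * p.2.1 + kMat p.1 κ 1 j * p.2.2 :=
    fun j => ((hk 0 j).mul (by fun_prop)).add ((hk 1 j).mul (by fun_prop))
  exact (measurable_const.mul (h1.comp ((hμ 1).mul (hv 0)))).mul
    (h2.comp ((hμ (-1)).mul (hv 1)))

theorem measurable_thEig (κ : ℝ) (m : ℕ × ℕ) :
    Measurable fun p : Heis => thEig p.2 κ m p.1 := by
  have h1 : Measurable fun r : Heis × ℝ =>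
      Complex.exp (-Complex.I * (κ * r.1.1.2 * r.2 : ℝ)) * (hEig r.1.2 κ m (r.1.1.1, r.2) : ℂ) := by
    refine Measurable.mul (by fun_prop) (Complex.measurable_ofReal.comp ?_)
    exact (measurable_hEig κ m).comp (g := fun p : ℝ × (ℝ × ℝ) => hEig p.1 κ m p.2)
      (f := fun r : Heis × ℝ => (r.1.2, (r.1.1.1, r.2))) (by fun_prop)
  have h2 := (h1.stronglyMeasurable.integral_prod_right' (ν := (volume : Measure ℝ))).measurable
  have h3 : Measurable fun p : Heis => ((√(|κ| / (2 * Real.pi)) : ℝ) : ℂ) *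
      Complex.exp (Complex.I * (p.2 / 2 * p.1.1 * p.1.2 : ℝ)) := by fun_prop
  exact h3.mul h2

/-- The measure space `ℕ² × ℝ` of the pairs `(m, λ₁)`, on which the Heisenberg oscillator becomes
the operator of multiplication by `ν_{λ,m}`. -/
abbrev specMeasure : Measure ((ℕ × ℕ) × ℝ) := Measure.count.prod volume

theorem measurable_cCoeff (κ : ℝ) (F : Lp ℂ 2 (volume : Measure Heis)) :
    Measurable fun z : (ℕ × ℕ) × ℝ => cCoeff F z.2 κ z.1 := by
  refine measurable_from_prod_countable_right fun m => ?_
  have h1 : Measurable fun p : Heis => F p * conj (thEig p.2 κ m p.1) :=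
    (measurable_coeFn F).mul (Complex.continuous_conj.measurable.comp (measurable_thEig κ m))
  exact (h1.stronglyMeasurable.integral_prod_left' (μ := (volume : Measure (ℝ × ℝ)))).measurable

theorem lintegral_specMeasure {f : (ℕ × ℕ) × ℝ → ℝ≥0∞} (hf : Measurable f) :
    ∫⁻ z, f z ∂specMeasure = ∑' m, ∫⁻ l, f (m, l) := by
  rw [lintegral_prod _ hf.aemeasurable, lintegral_count]

theorem ae_specMeasure_iff {P : (ℕ × ℕ) × ℝ → Prop} :
    (∀ᵐ z ∂specMeasure, P z) ↔ ∀ m, ∀ᵐ l, P (m, l) := by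
  constructor
  · intro h m
    have h1 := Measure.ae_ae_of_ae_prod h
    rw [ae_iff, Measure.count_eq_zero_iff] at h1
    by_contra h2
    exact (Set.eq_empty_iff_forall_notMem.1 h1 m) h2
  · intro h
    have h1 : {z | ¬P z} ⊆ ⋃ m : ℕ × ℕ, ({m} : Set (ℕ × ℕ)) ×ˢ {l | ¬P (m, l)} := fun z hz =>
      Set.mem_iUnion.2 ⟨z.1, rfl, hz⟩
    refine measure_mono_null h1 (measure_iUnion_null fun m => ?_)
    have h2 : volume {l | ¬P (m, l)} = 0 := h m
    rw [Measure.prod_prod, h2, mul_zero]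

/-- Parseval's identity for the orthonormal basis `T_λ h_{λ,m}` of `L²(ℝ²)`, for each `λ₁`,
integrated over `λ₁`. -/
theorem eLpNorm_cCoeff (hκ : κ ≠ 0) (F : Lp ℂ 2 (volume : Measure Heis)) :
    eLpNorm (fun z : (ℕ × ℕ) × ℝ => cCoeff F z.2 κ z.1) 2 specMeasure = eLpNorm F 2 := by
  rw [eLpNorm_two_eq, eLpNorm_two_eq]
  congr 1
  have hm := (measurable_cCoeff κ F).enorm.pow_const 2
  rw [lintegral_specMeasure hm, lintegral_heis_symm ((measurable_coeFn F).enorm.pow_const 2),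
    ← lintegral_tsum (f := fun m l => ‖cCoeff F l κ m‖ₑ ^ 2)
      fun m => (hm.comp measurable_prodMk_left).aemeasurable]
  refine lintegral_congr_ae ?_
  filter_upwards [ae_memLp_slice_left (measurable_coeFn F) (Lp.memLp F)] with l hl
  exact tsum_enorm_integral_sq (memLp_thEig hκ l) (integral_conj_thEig_mul_thEig hκ l)
    (fun G hG h => ae_eq_zero_of_integral_mul_conj_thEig_eq_zero hκ l hG h) hl

theorem memLp_cCoeff (hκ : κ ≠ 0) (F : Lp ℂ 2 (volume : Measure Heis)) :
    MemLp (fun z : (ℕ × ℕ) × ℝ => cCoeff F z.2 κ z.1) 2 specMeasure :=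
  ⟨(measurable_cCoeff κ F).aestronglyMeasurable, by
    rw [eLpNorm_cCoeff hκ]; exact (Lp.memLp F).2⟩

theorem integrable_mul_conj_thEig (hκ : κ ≠ 0) {l : ℝ} (m : ℕ × ℕ) {G : ℝ × ℝ → ℂ}
    (hG : MemLp G 2) : Integrable fun q => G q * conj (thEig l κ m q) :=
  hG.integrable_mul (memLp_thEig hκ l m).star

/-- The isometry `F ↦ c_{λ,m}` of `L²` onto sequences of square integrable functions of `λ₁`. -/
def coeffIsometry (hκ : κ ≠ 0) : Lp ℂ 2 (volume : Measure Heis) →ₗᵢ[ℂ] Lp ℂ 2 specMeasure where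
  toFun F := (memLp_cCoeff hκ F).toLp _
  map_add' F G := by
    rw [← MemLp.toLp_add]
    refine MemLp.toLp_congr _ _ (ae_specMeasure_iff.2 fun m => ?_)
    filter_upwards [ae_memLp_slice_left (measurable_coeFn F) (Lp.memLp F),
      ae_memLp_slice_left (measurable_coeFn G) (Lp.memLp G),
      ae_ae_of_ae_heis_left (Lp.coeFn_add F G)] with l h1 h2 h3
    simp only [cCoeff, Pi.add_apply]
    rw [← integral_add (integrable_mul_conj_thEig hκ m h1) (integrable_mul_conj_thEig hκ m h2)]
    refine integral_congr_ae ?_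
    filter_upwards [h3] with q hq
    rw [hq, Pi.add_apply, add_mul]
  map_smul' k F := by
    rw [RingHom.id_apply, ← MemLp.toLp_const_smul]
    refine MemLp.toLp_congr _ _ (ae_specMeasure_iff.2 fun m => ?_)
    filter_upwards [ae_ae_of_ae_heis_left (Lp.coeFn_smul k F)] with l h3
    simp only [cCoeff, Pi.smul_apply, smul_eq_mul]
    rw [← integral_const_mul]
    refine integral_congr_ae ?_
    filter_upwards [h3] with q hq
    rw [hq, Pi.smul_apply, smul_eq_mul, mul_assoc]
  norm_map' F := by
    change ‖(memLp_cCoeff hκ F).toLp _‖ = ‖F‖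
    rw [Lp.norm_toLp, eLpNorm_cCoeff hκ, Lp.norm_def]

theorem coeFn_coeffIsometry (hκ : κ ≠ 0) (F : Lp ℂ 2 (volume : Measure Heis)) :
    coeffIsometry hκ F =ᵐ[specMeasure] fun z => cCoeff F z.2 κ z.1 :=
  (memLp_cCoeff hκ F).coeFn_toLp

theorem lintegral_enorm_thEig_sq (hκ : κ ≠ 0) (l : ℝ) (m : ℕ × ℕ) :
    ∫⁻ q, ‖thEig l κ m q‖ₑ ^ 2 = 1 := by
  have h1 := integral_conj_thEig_mul_thEig hκ l m m
  simp only [Complex.conj_mul', if_true, ← Complex.ofReal_pow] at h1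
  rw [integral_complex_ofReal, ← Complex.ofReal_one, Complex.ofReal_inj] at h1
  have h2 := ofReal_integral_eq_lintegral_ofReal ((memLp_two_iff_integrable_sq_norm
    (memLp_thEig hκ l m).1).1 (memLp_thEig hκ l m)) (ae_of_all _ fun q => by positivity)
  rw [h1, ENNReal.ofReal_one] at h2
  rw [h2]
  refine lintegral_congr fun q => ?_
  rw [ENNReal.ofReal_pow (norm_nonneg _), ofReal_norm]

theorem memLp_mul_thEig (hκ : κ ≠ 0) (m : ℕ × ℕ) (φ : Lp ℂ 2 specMeasure) :
    MemLp (fun p : Heis => φ (m, p.2) * thEig p.2 κ m p.1) 2 := by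
  have hφ : Measurable φ := (Lp.stronglyMeasurable φ).measurable
  have hm : Measurable fun p : Heis => φ (m, p.2) * thEig p.2 κ m p.1 :=
    (hφ.comp (by fun_prop : Measurable fun p : Heis => (m, p.2))).mul (measurable_thEig κ m)
  refine ⟨hm.aestronglyMeasurable, ?_⟩
  rw [eLpNorm_two_eq, lintegral_heis_symm (hm.enorm.pow_const 2)]
  have h1 : ∀ l : ℝ, ∫⁻ q : ℝ × ℝ, ‖φ (m, l) * thEig l κ m q‖ₑ ^ 2 = ‖φ (m, l)‖ₑ ^ 2 := fun l => by
    simp only [enorm_mul, mul_pow]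
    rw [lintegral_const_mul' _ _ (by finiteness), lintegral_enorm_thEig_sq hκ, mul_one]
  simp only [h1]
  have h2 : ∫⁻ l, ‖φ (m, l)‖ₑ ^ 2 ≤ ∫⁻ z, ‖φ z‖ₑ ^ 2 ∂specMeasure := by
    rw [lintegral_specMeasure (hφ.enorm.pow_const 2)]
    exact ENNReal.le_tsum (f := fun m => ∫⁻ l, ‖φ (m, l)‖ₑ ^ 2) m
  have h3 := (Lp.memLp φ).2
  rw [eLpNorm_two_eq, ENNReal.rpow_lt_top_iff_of_pos (by norm_num)] at h3
  exact ENNReal.rpow_lt_top_of_nonneg (by norm_num) (h2.trans_lt h3).ne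

theorem cCoeff_mul_thEig (hκ : κ ≠ 0) {m n : ℕ × ℕ} {φ : Lp ℂ 2 specMeasure}
    {F : Lp ℂ 2 (volume : Measure Heis)}
    (hF : F =ᵐ[volume] fun p : Heis => φ (m, p.2) * thEig p.2 κ m p.1) :
    ∀ᵐ l, cCoeff F l κ n = if m = n then φ (m, l) else 0 := by
  filter_upwards [ae_ae_of_ae_heis_left hF] with l hl
  rw [cCoeff]
  have e : ∫ q, F (q, l) * conj (thEig l κ n q) =
      ∫ q, φ (m, l) * (conj (thEig l κ n q) * thEig l κ m q) := by
    refine integral_congr_ae ?_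
    filter_upwards [hl] with q hq
    rw [hq]; ring
  rw [e, integral_const_mul, integral_conj_thEig_mul_thEig hκ]
  by_cases h : m = n
  · subst h; simp
  · rw [if_neg h, if_neg (Ne.symm h), mul_zero]

/-- The function `φ_m(λ₁) T_λ h_{λ,m}` is the preimage of the `m`-th component of `φ`. -/
theorem coeffIsometry_mul_thEig (hκ : κ ≠ 0) (m : ℕ × ℕ) (φ : Lp ℂ 2 specMeasure) :
    coeffIsometry hκ ((memLp_mul_thEig hκ m φ).toLp _) =ᵐ[specMeasure]
      (Prod.fst ⁻¹' {m}).indicator φ := by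
  refine (coeFn_coeffIsometry hκ _).trans (ae_specMeasure_iff.2 fun n => ?_)
  filter_upwards [cCoeff_mul_thEig hκ (n := n) (memLp_mul_thEig hκ m φ).coeFn_toLp] with l hl
  rw [hl]
  by_cases h : m = n
  · subst h; simp
  · simp [h, Ne.symm h]

/-- The range is closed and contains every component of every `φ`, so that nothing is orthogonal to
it. -/
theorem surjective_coeffIsometry (hκ : κ ≠ 0) : Function.Surjective (coeffIsometry hκ) := by
  have hbot : (LinearMap.range (coeffIsometry hκ).toLinearMap)ᗮ = ⊥ := by
    rw [Submodule.eq_bot_iff]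
    intro φ hφ
    rw [Submodule.mem_orthogonal] at hφ
    refine Lp.eq_zero_iff_ae_eq_zero.2 (ae_specMeasure_iff.2 fun m => ?_)
    -- testing against the preimage of the `m`-th component of `φ`
    set F := (memLp_mul_thEig hκ m φ).toLp _
    have h1 := coeffIsometry_mul_thEig hκ m φ
    have h2 : ⟪coeffIsometry hκ F, φ⟫_ℂ = 0 := hφ _ ⟨F, rfl⟩
    have h3 : ⟪coeffIsometry hκ F, φ⟫_ℂ = ⟪coeffIsometry hκ F, coeffIsometry hκ F⟫_ℂ := by
      rw [L2.inner_def, L2.inner_def]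
      refine integral_congr_ae ?_
      filter_upwards [h1] with z hz
      rw [hz]
      by_cases h : z ∈ (Prod.fst ⁻¹' {m} : Set ((ℕ × ℕ) × ℝ))
      · rw [Set.indicator_of_mem h]
      · rw [Set.indicator_of_notMem h, inner_zero_left, inner_zero_left]
    rw [h3, inner_self_eq_zero] at h2
    rw [h2] at h1
    filter_upwards [ae_specMeasure_iff.1 (h1.symm.trans (Lp.coeFn_zero ℂ 2 specMeasure)) m]
      with l hl
    simpa using hl
  have hc : CompleteSpace (LinearMap.range (coeffIsometry hκ).toLinearMap) :=
    (coeffIsometry hκ).isometry.isUniformInducing.isComplete_range.completeSpace_coe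
  exact LinearMap.range_eq_top.1 ((Submodule.orthogonal_eq_bot_iff).1 hbot)

/-- The unitary operator `F ↦ c_{λ,m}`. -/
def coeffUnitary (hκ : κ ≠ 0) : Lp ℂ 2 (volume : Measure Heis) ≃ₗᵢ[ℂ] Lp ℂ 2 specMeasure :=
  LinearIsometryEquiv.ofSurjective (coeffIsometry hκ) (surjective_coeffIsometry hκ)

end Expansion

/-! ### Calculus with the left-invariant vector fields -/

section VectorFields

variable {φ ψ : Heis → ℂ}

theorem ContDiff.heisX (hφ : ContDiff ℝ ∞ φ) : ContDiff ℝ ∞ (heisX φ) := by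
  rw [funext (heisX_eq hφ)]
  exact (hφ.fderiv_right (m := ∞) (by simp)).clm_apply (by fun_prop)

theorem ContDiff.heisY (hφ : ContDiff ℝ ∞ φ) : ContDiff ℝ ∞ (heisY φ) := by
  rw [funext (heisY_eq hφ)]
  exact (hφ.fderiv_right (m := ∞) (by simp)).clm_apply (by fun_prop)

theorem heisX_mul (hφ : ContDiff ℝ ∞ φ) (hψ : ContDiff ℝ ∞ ψ) (p : Heis) :
    heisX (fun p => φ p * ψ p) p = heisX φ p * ψ p + φ p * heisX ψ p := by
  rw [heisX_eq (hφ.mul hψ), heisX_eq hφ, heisX_eq hψ,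
    fderiv_fun_mul (hφ.differentiable (by simp) p) (hψ.differentiable (by simp) p)]
  simp only [add_apply, smul_apply, smul_eq_mul]
  ring

theorem heisY_mul (hφ : ContDiff ℝ ∞ φ) (hψ : ContDiff ℝ ∞ ψ) (p : Heis) :
    heisY (fun p => φ p * ψ p) p = heisY φ p * ψ p + φ p * heisY ψ p := by
  rw [heisY_eq (hφ.mul hψ), heisY_eq hφ, heisY_eq hψ,
    fderiv_fun_mul (hφ.differentiable (by simp) p) (hψ.differentiable (by simp) p)]
  simp only [add_apply, smul_apply, smul_eq_mul]
  ring

theorem heisX_add (hφ : ContDiff ℝ ∞ φ) (hψ : ContDiff ℝ ∞ ψ) (p : Heis) :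
    heisX (fun p => φ p + ψ p) p = heisX φ p + heisX ψ p := by
  rw [heisX_eq (hφ.add hψ), heisX_eq hφ, heisX_eq hψ,
    fderiv_fun_add (hφ.differentiable (by simp) p) (hψ.differentiable (by simp) p)]
  rfl

theorem heisY_add (hφ : ContDiff ℝ ∞ φ) (hψ : ContDiff ℝ ∞ ψ) (p : Heis) :
    heisY (fun p => φ p + ψ p) p = heisY φ p + heisY ψ p := by
  rw [heisY_eq (hφ.add hψ), heisY_eq hφ, heisY_eq hψ,
    fderiv_fun_add (hφ.differentiable (by simp) p) (hψ.differentiable (by simp) p)]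
  rfl

theorem heisOscExpr_mul (κ : ℝ) (hφ : ContDiff ℝ ∞ φ) (hψ : ContDiff ℝ ∞ ψ) (p : Heis) :
    heisOscExpr κ (fun p => φ p * ψ p) p = φ p * heisOscExpr κ ψ p -
      2 * (heisX φ p * heisX ψ p) - 2 * (heisY φ p * heisY ψ p) -
      (heisX (heisX φ) p + heisY (heisY φ) p) * ψ p := by
  rw [heisOscExpr, heisOscExpr, funext (heisX_mul hφ hψ), funext (heisY_mul hφ hψ),
    heisX_add (hφ.heisX.mul hψ) (hφ.mul hψ.heisX), heisY_add (hφ.heisY.mul hψ) (hφ.mul hψ.heisY),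
    heisX_mul hφ.heisX hψ, heisX_mul hφ hψ.heisX, heisY_mul hφ.heisY hψ, heisY_mul hφ hψ.heisY]
  ring

/-- The vector fields commute with complex conjugation. -/
theorem heisX_conj (φ : Heis → ℂ) (p : Heis) :
    heisX (fun p => conj (φ p)) p = conj (heisX φ p) := by
  simp only [heisX]
  exact deriv.star

theorem heisY_conj (φ : Heis → ℂ) (p : Heis) :
    heisY (fun p => conj (φ p)) p = conj (heisY φ p) := by
  simp only [heisY]
  exact deriv.star

theorem heisOscExpr_conj (κ : ℝ) (φ : Heis → ℂ) (p : Heis) :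
    heisOscExpr κ (fun p => conj (φ p)) p = conj (heisOscExpr κ φ p) := by
  simp only [heisOscExpr, funext (heisX_conj φ), funext (heisY_conj φ), heisX_conj, heisY_conj,
    map_add, map_neg, map_mul, Complex.conj_ofReal]

theorem IsTestFun.conj (hφ : IsTestFun φ) : IsTestFun fun p => conj (φ p) :=
  ⟨Complex.conjCLE.contDiff.comp hφ.1, hφ.2.comp_left (g := fun z : ℂ => (starRingEnd ℂ) z) (by simp)⟩

theorem IsTestFun.mul_contDiff (hφ : IsTestFun φ) (hψ : ContDiff ℝ ∞ ψ) :
    IsTestFun fun p => φ p * ψ p :=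
  ⟨hφ.1.mul hψ, hφ.2.mul_right⟩

theorem IsTestFun.integrable (hφ : IsTestFun φ) : Integrable φ :=
  hφ.1.continuous.integrable_of_hasCompactSupport hφ.2

theorem IsTestFun.memLp (hφ : IsTestFun φ) : MemLp φ 2 :=
  hφ.1.continuous.memLp_of_hasCompactSupport hφ.2

theorem IsTestFun.fderiv_apply (hφ : IsTestFun φ) (v : Heis) :
    IsTestFun fun p => fderiv ℝ φ p v :=
  ⟨(hφ.1.fderiv_right (m := ∞) (by simp)).clm_apply contDiff_const,
    (hφ.2.fderiv (𝕜 := ℝ)).comp_left (g := fun L : Heis →L[ℝ] ℂ => L v) (by simp)⟩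

/-- Integration by parts along a constant vector. -/
theorem integral_fderiv_mul_eq_neg (hφ : IsTestFun φ) (hψ : ContDiff ℝ ∞ ψ) (v : Heis) :
    ∫ p, fderiv ℝ φ p v * ψ p = -∫ p, φ p * fderiv ℝ ψ p v := by
  have hψ' : ContDiff ℝ ∞ fun p => fderiv ℝ ψ p v :=
    (hψ.fderiv_right (m := ∞) (by simp)).clm_apply contDiff_const
  have : (volume : Measure Heis).IsAddHaarMeasure := by
    rw [Measure.volume_eq_prod]; infer_instance
  rw [integral_mul_fderiv_eq_neg_fderiv_mul_of_integrable
    ((hφ.fderiv_apply v).mul_contDiff hψ).integrable (hφ.mul_contDiff hψ').integrable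
    (hφ.mul_contDiff hψ).integrable (fun p _ => hφ.1.differentiable (by simp) p)
    (fun p _ => hψ.differentiable (by simp) p), neg_neg]

/-- Integration by parts along the vector field `v + c w`, for constant vectors `v`, `w` and a
linear coefficient `c` that does not depend on the direction of `w`. -/
theorem integral_fderiv_add_smul_mul (hφ : IsTestFun φ) (hψ : ContDiff ℝ ∞ ψ) (v w : Heis)
    (c : Heis →L[ℝ] ℝ) (hc : c w = 0) :
    ∫ p, fderiv ℝ φ p (v + c p • w) * ψ p = -∫ p, φ p * fderiv ℝ ψ p (v + c p • w) := by
  have hcc : ContDiff ℝ ∞ fun p => (c p : ℂ) := Complex.ofRealCLM.contDiff.comp c.contDiff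
  have hψ' : ∀ u, ContDiff ℝ ∞ fun p => fderiv ℝ ψ p u := fun u =>
    (hψ.fderiv_right (m := ∞) (by simp)).clm_apply contDiff_const
  have e : ∀ p, fderiv ℝ (fun p => (c p : ℂ) * ψ p) p w = (c p : ℂ) * fderiv ℝ ψ p w := fun p => by
    have h1 : HasFDerivAt (fun p => (c p : ℂ)) (Complex.ofRealCLM ∘L c) p :=
      Complex.ofRealCLM.hasFDerivAt.comp p c.hasFDerivAt
    have h2 := h1.mul (hψ.differentiable (by simp) p).hasFDerivAt
    have h3 : fderiv ℝ (fun p => (c p : ℂ) * ψ p) p = _ := h2.fderiv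
    rw [h3]
    simp [hc]
  have h1 := integral_fderiv_mul_eq_neg hφ hψ v
  have h2 := integral_fderiv_mul_eq_neg hφ (hcc.mul hψ) w
  simp only [e] at h2
  have i1 := ((hφ.fderiv_apply v).mul_contDiff hψ).integrable
  have i2 := ((hφ.fderiv_apply w).mul_contDiff (hcc.mul hψ)).integrable
  have i3 := (hφ.mul_contDiff (hψ' v)).integrable
  have i4 := (hφ.mul_contDiff (hcc.mul (hψ' w))).integrable
  have e1 : ∀ p, fderiv ℝ φ p (v + c p • w) * ψ p =
      fderiv ℝ φ p v * ψ p + fderiv ℝ φ p w * ((c p : ℂ) * ψ p) := fun p => by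
    rw [map_add, map_smul, Complex.real_smul]; ring
  have e2 : ∀ p, φ p * fderiv ℝ ψ p (v + c p • w) =
      φ p * fderiv ℝ ψ p v + φ p * ((c p : ℂ) * fderiv ℝ ψ p w) := fun p => by
    rw [map_add, map_smul, Complex.real_smul]; ring
  simp only [e1, e2]
  rw [integral_add i1 i2, integral_add i3 i4, h1, h2, neg_add]

theorem integral_heisX_mul (hφ : IsTestFun φ) (hψ : ContDiff ℝ ∞ ψ) :
    ∫ p, heisX φ p * ψ p = -∫ p, φ p * heisX ψ p := by
  have h := integral_fderiv_add_smul_mul hφ hψ ((1, 0), 0) ((0, 0), 1)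
    ((-(1 / 2) : ℝ) • (ContinuousLinearMap.snd ℝ ℝ ℝ ∘L ContinuousLinearMap.fst ℝ (ℝ × ℝ) ℝ))
    (by simp)
  have e : ∀ p : Heis, (((1, 0), 0) : Heis) + ((-(1 / 2) : ℝ) • (ContinuousLinearMap.snd ℝ ℝ ℝ ∘L
      ContinuousLinearMap.fst ℝ (ℝ × ℝ) ℝ)) p • (((0, 0), 1) : Heis) = ((1, 0), -(p.1.2 / 2)) :=
    fun p => by ext <;> simp; ring
  simp only [e] at h
  rwa [funext (heisX_eq hφ.1), funext (heisX_eq hψ)]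

theorem integral_heisY_mul (hφ : IsTestFun φ) (hψ : ContDiff ℝ ∞ ψ) :
    ∫ p, heisY φ p * ψ p = -∫ p, φ p * heisY ψ p := by
  have h := integral_fderiv_add_smul_mul hφ hψ ((0, 1), 0) ((0, 0), 1)
    ((1 / 2 : ℝ) • (ContinuousLinearMap.fst ℝ ℝ ℝ ∘L ContinuousLinearMap.fst ℝ (ℝ × ℝ) ℝ))
    (by simp)
  have e : ∀ p : Heis, (((0, 1), 0) : Heis) + ((1 / 2 : ℝ) • (ContinuousLinearMap.fst ℝ ℝ ℝ ∘L
      ContinuousLinearMap.fst ℝ (ℝ × ℝ) ℝ)) p • (((0, 0), 1) : Heis) = ((0, 1), p.1.1 / 2) :=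
    fun p => by ext <;> simp; ring
  simp only [e] at h
  rwa [funext (heisY_eq hφ.1), funext (heisY_eq hψ)]

/-- The differential expression is symmetric for the bilinear pairing, because each vector field is
antisymmetric, having divergence zero. -/
theorem integral_heisOscExpr_mul (κ : ℝ) (hφ : IsTestFun φ) (hψ : IsTestFun ψ) :
    ∫ p, φ p * heisOscExpr κ ψ p = ∫ p, heisOscExpr κ φ p * ψ p := by
  have hV : ContDiff ℝ ∞ (fun p : Heis => ((κ ^ 2 * (p.1.1 ^ 2 + p.1.2 ^ 2) : ℝ) : ℂ)) :=
    Complex.ofRealCLM.contDiff.comp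
      (by fun_prop : ContDiff ℝ ∞ (fun p : Heis => κ ^ 2 * (p.1.1 ^ 2 + p.1.2 ^ 2)))
  have h1 : ∫ p, heisX (heisX φ) p * ψ p = ∫ p, φ p * heisX (heisX ψ) p := by
    rw [integral_heisX_mul hφ.heisX hψ.1, integral_heisX_mul hφ hψ.1.heisX, neg_neg]
  have h2 : ∫ p, heisY (heisY φ) p * ψ p = ∫ p, φ p * heisY (heisY ψ) p := by
    rw [integral_heisY_mul hφ.heisY hψ.1, integral_heisY_mul hφ hψ.1.heisY, neg_neg]
  have e1 : ∀ p, φ p * heisOscExpr κ ψ p = -(φ p * heisX (heisX ψ) p) -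
      φ p * heisY (heisY ψ) p + φ p * ((κ ^ 2 * (p.1.1 ^ 2 + p.1.2 ^ 2) : ℝ) * ψ p) := fun p => by
    rw [heisOscExpr]; ring
  have e2 : ∀ p, heisOscExpr κ φ p * ψ p = -(heisX (heisX φ) p * ψ p) -
      heisY (heisY φ) p * ψ p + φ p * ((κ ^ 2 * (p.1.1 ^ 2 + p.1.2 ^ 2) : ℝ) * ψ p) := fun p => by
    rw [heisOscExpr]; ring
  have i0 := (hφ.mul_contDiff (hV.mul hψ.1)).integrable
  have i1 := (hφ.mul_contDiff hψ.1.heisX.heisX).integrable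
  have i2 := (hφ.mul_contDiff hψ.1.heisY.heisY).integrable
  have i3 := (hφ.heisX.heisX.mul_contDiff hψ.1).integrable
  have i4 := (hφ.heisY.heisY.mul_contDiff hψ.1).integrable
  simp only [e1, e2]
  have j1 : Integrable fun p => -(φ p * heisX (heisX ψ) p) := i1.neg
  have j3 : Integrable fun p => -(heisX (heisX φ) p * ψ p) := i3.neg
  rw [integral_add (f := fun p => -(φ p * heisX (heisX ψ) p) - φ p * heisY (heisY ψ) p)
      (j1.sub i2) i0,
    integral_add (f := fun p => -(heisX (heisX φ) p * ψ p) - heisY (heisY φ) p * ψ p)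
      (j3.sub i4) i0, integral_sub j1 i2, integral_sub j3 i4, integral_neg, integral_neg, h1, h2]

/-- The automorphic dilations of the Heisenberg group. -/
def heisDil (r : ℝ) (p : Heis) : Heis := ((r * p.1.1, r * p.1.2), r ^ 2 * p.2)

/-- The vector fields are homogeneous of degree one with respect to the dilations. -/
theorem heisX_comp_heisDil (φ : Heis → ℂ) (r : ℝ) (p : Heis) :
    heisX (fun p => φ (heisDil r p)) p = r * heisX φ (heisDil r p) := by
  have h : ∀ s, heisDil r (heisMul p ((s, 0), 0)) = heisMul (heisDil r p) ((r * s, 0), 0) :=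
    fun s => by simp only [heisDil, heisMul]; ext <;> simp <;> ring
  simp only [heisX, h]
  have := deriv_comp_mul_left r (fun s => φ (heisMul (heisDil r p) ((s, 0), 0))) 0
  rw [this, mul_zero, Complex.real_smul]

theorem heisY_comp_heisDil (φ : Heis → ℂ) (r : ℝ) (p : Heis) :
    heisY (fun p => φ (heisDil r p)) p = r * heisY φ (heisDil r p) := by
  have h : ∀ s, heisDil r (heisMul p ((0, s), 0)) = heisMul (heisDil r p) ((0, r * s), 0) :=
    fun s => by simp only [heisDil, heisMul]; ext <;> simp <;> ring
  simp only [heisY, h]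
  have := deriv_comp_mul_left r (fun s => φ (heisMul (heisDil r p) ((0, s), 0))) 0
  rw [this, mul_zero, Complex.real_smul]

theorem heisX_const_mul (c : ℂ) (φ : Heis → ℂ) (p : Heis) :
    heisX (fun p => c * φ p) p = c * heisX φ p := by
  simp only [heisX]
  exact deriv_const_mul_field c

theorem heisY_const_mul (c : ℂ) (φ : Heis → ℂ) (p : Heis) :
    heisY (fun p => c * φ p) p = c * heisY φ p := by
  simp only [heisY]
  exact deriv_const_mul_field c

/-- Cut-offs: smooth compactly supported functions that tend to `1`, whose derivatives along the
vector fields tend to `0` uniformly. -/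
theorem exists_cutoff : ∃ η : ℕ → Heis → ℂ, (∀ n, IsTestFun (η n)) ∧ (∀ n p, ‖η n p‖ ≤ 1) ∧
    (∀ p, Tendsto (fun n => η n p) atTop (𝓝 1)) ∧
    ∃ C : ℝ, ∀ n p, ‖heisX (η n) p‖ ≤ C / (n + 1) ∧ ‖heisY (η n) p‖ ≤ C / (n + 1) ∧
      ‖heisX (heisX (η n)) p + heisY (heisY (η n)) p‖ ≤ C / (n + 1) := by
  let b : ContDiffBump (0 : Heis) := ⟨1, 2, by norm_num, by norm_num⟩
  have hη : IsTestFun fun p => (b p : ℂ) :=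
    ⟨Complex.ofRealCLM.contDiff.comp b.contDiff,
      b.hasCompactSupport.comp_left (g := fun r : ℝ => (r : ℂ)) (by simp)⟩
  set η : Heis → ℂ := fun p => (b p : ℂ)
  set r : ℕ → ℝ := fun n => 1 / ((n : ℝ) + 1)
  have hr0 : ∀ n, 0 < r n := fun n => by positivity
  have hr1 : ∀ n, r n ≤ 1 := fun n => by
    rw [div_le_one (by positivity)]; linarith [n.cast_nonneg (α := ℝ)]
  have hrt : Tendsto r atTop (𝓝 0) := tendsto_one_div_add_atTop_nhds_zero_nat
  have hδ : ∀ r, ContDiff ℝ ∞ (heisDil r) := fun r => by unfold heisDil; fun_prop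
  have hX : ∀ n, heisX (fun p => η (heisDil (r n) p)) = fun p =>
      (r n : ℂ) * heisX η (heisDil (r n) p) := fun n => funext (heisX_comp_heisDil η (r n))
  have hY : ∀ n, heisY (fun p => η (heisDil (r n) p)) = fun p =>
      (r n : ℂ) * heisY η (heisDil (r n) p) := fun n => funext (heisY_comp_heisDil η (r n))
  obtain ⟨C1, hC1⟩ := hη.heisX.2.exists_bound_of_continuous hη.heisX.1.continuous
  obtain ⟨C2, hC2⟩ := hη.heisY.2.exists_bound_of_continuous hη.heisY.1.continuous
  obtain ⟨C3, hC3⟩ := hη.heisX.heisX.2.exists_bound_of_continuous hη.heisX.heisX.1.continuous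
  obtain ⟨C4, hC4⟩ := hη.heisY.heisY.2.exists_bound_of_continuous hη.heisY.heisY.1.continuous
  have h1 := (norm_nonneg _).trans (hC1 0)
  have h2 := (norm_nonneg _).trans (hC2 0)
  have h3 := (norm_nonneg _).trans (hC3 0)
  have h4 := (norm_nonneg _).trans (hC4 0)
  have hbd : ∀ (n : ℕ) (z : ℂ) (D : ℝ), ‖z‖ ≤ D → D ≤ C1 + C2 + C3 + C4 →
      ‖(r n : ℂ) * z‖ ≤ (C1 + C2 + C3 + C4) / (n + 1) := fun n z D hz hD => by
    rw [norm_mul, Complex.norm_real, Real.norm_of_nonneg (hr0 n).le, div_eq_inv_mul, ← one_div]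
    exact mul_le_mul_of_nonneg_left (hz.trans hD) (hr0 n).le
  refine ⟨fun n p => η (heisDil (r n) p), fun n => ⟨hη.1.comp (hδ _), ?_⟩, fun n p => ?_,
    fun p => ?_, C1 + C2 + C3 + C4, fun n p => ⟨?_, ?_, ?_⟩⟩
  · -- the dilation is a homeomorphism
    let e : Heis ≃ₜ Heis :=
      { toFun := heisDil (r n)
        invFun := heisDil (r n)⁻¹
        left_inv := fun p => by
          have := (hr0 n).ne'
          simp only [heisDil]; ext <;> field_simp
        right_inv := fun p => by
          have := (hr0 n).ne'
          simp only [heisDil]; ext <;> field_simp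
        continuous_toFun := (hδ _).continuous
        continuous_invFun := (hδ _).continuous }
    exact hη.2.comp_homeomorph e
  · simp only [η, Complex.norm_real, Real.norm_of_nonneg (b.nonneg)]
    exact b.le_one
  · have hc : Continuous fun s : ℝ => η (heisDil s p) :=
      hη.1.continuous.comp (by unfold heisDil; fun_prop)
    have h5 := (hc.tendsto 0).comp hrt
    have h6 : η (heisDil 0 p) = 1 := by
      have : heisDil 0 p = 0 := by simp only [heisDil]; ext <;> simp
      simp only [η, this]
      rw [b.one_of_mem_closedBall (by simp [b])]
      simp
    rwa [h6] at h5
  · rw [hX]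
    exact hbd n _ _ (hC1 _) (by linarith)
  · rw [hY]
    exact hbd n _ _ (hC2 _) (by linarith)
  · rw [hX, hY, heisX_const_mul, heisY_const_mul, heisX_comp_heisDil, heisY_comp_heisDil, ← mul_add,
      ← mul_add]
    refine hbd n _ (C3 + C4) ?_ (by linarith)
    rw [norm_mul, Complex.norm_real, Real.norm_of_nonneg (hr0 n).le]
    exact (mul_le_of_le_one_left (norm_nonneg _) (hr1 n)).trans
      ((norm_add_le _ _).trans (add_le_add (hC3 _) (hC4 _)))

end VectorFields

section Twist

variable {κ l ν : ℝ} {w w1 w11 w2 w22 : ℝ × ℝ → ℂ}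

/-- The function `e^{i l (t + x y / 2)} w(x, y)`. -/
def twist (l : ℝ) (w : ℝ × ℝ → ℂ) (p : Heis) : ℂ :=
  Complex.exp (Complex.I * (l * (p.2 + p.1.1 * p.1.2 / 2) : ℝ)) * w p.1

theorem ContDiff.twist (hw : ContDiff ℝ ∞ w) (l : ℝ) : ContDiff ℝ ∞ (twist l w) := by
  have h1 : ContDiff ℝ ∞ fun p : Heis => ((l * (p.2 + p.1.1 * p.1.2 / 2) : ℝ) : ℂ) :=
    Complex.ofRealCLM.contDiff.comp
      (by fun_prop : ContDiff ℝ ∞ fun p : Heis => l * (p.2 + p.1.1 * p.1.2 / 2))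
  exact (contDiff_const.mul h1).cexp.mul (hw.comp contDiff_fst)

theorem heisX_twist (l : ℝ) (h : ∀ x y, HasDerivAt (fun s : ℝ => w (s, y)) (w1 (x, y)) x) :
    heisX (twist l w) = twist l w1 := by
  funext p
  have e : ∀ s : ℝ, twist l w (heisMul p ((s, 0), 0)) =
      Complex.exp (Complex.I * (l * (p.2 + p.1.1 * p.1.2 / 2) : ℝ)) * w (p.1.1 + s, p.1.2) :=
    fun s => by
      simp only [twist, heisMul, add_zero, mul_zero, zero_sub]
      congr 4; ring
  simp only [heisX, e]
  have h1 : HasDerivAt (fun s : ℝ => w (p.1.1 + s, p.1.2)) (w1 p.1) 0 :=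
    HasDerivAt.comp_const_add p.1.1 0 (by simpa using h p.1.1 p.1.2)
  exact (h1.const_mul _).deriv

theorem heisY_twist (l : ℝ) (h : ∀ x y, HasDerivAt (fun s : ℝ => w (x, s)) (w2 (x, y)) y) :
    heisY (twist l w) = twist l fun q => w2 q + Complex.I * l * q.1 * w q := by
  funext p
  have e : ∀ s : ℝ, twist l w (heisMul p ((0, s), 0)) =
      Complex.exp (Complex.I * (l * (p.2 + p.1.1 * p.1.2 / 2) : ℝ)) *
        (Complex.exp (Complex.I * l * p.1.1 * s) * w (p.1.1, p.1.2 + s)) :=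
    fun s => by
      simp only [twist, heisMul, add_zero, zero_mul, sub_zero]
      rw [← mul_assoc, ← Complex.exp_add]
      congr 2; push_cast; ring
  simp only [heisY, e]
  have h1 : HasDerivAt (fun s : ℝ => w (p.1.1, p.1.2 + s)) (w2 p.1) 0 :=
    HasDerivAt.comp_const_add p.1.2 0 (by simpa using h p.1.1 p.1.2)
  have h2 : HasDerivAt (fun s : ℝ => Complex.exp (Complex.I * l * p.1.1 * s))
      (Complex.I * l * p.1.1) 0 := by
    have : HasDerivAt (fun s : ℝ => (s : ℂ)) 1 (0 : ℝ) := Complex.ofRealCLM.hasDerivAt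
    simpa using (this.const_mul (Complex.I * l * p.1.1)).cexp
  have h3 := ((h2.mul h1).const_mul
    (Complex.exp (Complex.I * (l * (p.2 + p.1.1 * p.1.2 / 2) : ℝ)))).deriv
  refine h3.trans ?_
  simp [twist]; ring

/-- If `w` satisfies the twisted Hermite equation, then `e^{i l (t + x y / 2)} w` is an
eigenfunction of the differential expression. -/
theorem heisOscExpr_twist (hd1 : ∀ x y, HasDerivAt (fun s : ℝ => w (s, y)) (w1 (x, y)) x)
    (hd11 : ∀ x y, HasDerivAt (fun s : ℝ => w1 (s, y)) (w11 (x, y)) x)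
    (hd2 : ∀ x y, HasDerivAt (fun s : ℝ => w (x, s)) (w2 (x, y)) y)
    (hd22 : ∀ x y, HasDerivAt (fun s : ℝ => w2 (x, s)) (w22 (x, y)) y)
    (heq : ∀ q : ℝ × ℝ, -(w11 q + w22 q + 2 * Complex.I * l * q.1 * w2 q -
      (l : ℂ) ^ 2 * (q.1 : ℂ) ^ 2 * w q) + (κ : ℂ) ^ 2 * ((q.1 : ℂ) ^ 2 + (q.2 : ℂ) ^ 2) * w q =
        ν * w q) (p : Heis) :
    heisOscExpr κ (twist l w) p = ν * twist l w p := by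
  have h2 : ∀ x y, HasDerivAt (fun s : ℝ => w2 (x, s) + Complex.I * l * x * w (x, s))
      (w22 (x, y) + Complex.I * l * x * w2 (x, y)) y := fun x y =>
    (hd22 x y).add ((hd2 x y).const_mul _)
  rw [heisOscExpr, heisX_twist l hd1, heisX_twist l hd11, heisY_twist l hd2,
    heisY_twist l (w := fun q => w2 q + Complex.I * l * q.1 * w q)
      (w2 := fun q => w22 q + Complex.I * l * q.1 * w2 q) h2]
  simp only [twist]
  push_cast
  linear_combination Complex.exp (Complex.I * (l * (p.2 + p.1.1 * p.1.2 / 2))) * heq p.1 -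
    Complex.exp (Complex.I * (l * (p.2 + p.1.1 * p.1.2 / 2))) * l ^ 2 * p.1.1 ^ 2 * w p.1 *
      Complex.I_sq

end Twist

/-! ### Slices of convergent sequences -/

section Slices

theorem norm_mulL2_apply_le {Z : Type*} [MeasurableSpace Z] {μ : Measure Z} {b : Z → ℂ}
    (hb : Measurable b) {C : ℝ} (hC : ∀ z, ‖b z‖ ≤ C) (f : Lp ℂ 2 μ) :
    ‖mulL2 b hb C hC f‖ ≤ C * ‖f‖ := by
  refine Lp.norm_le_mul_norm_of_ae_le_mul ?_
  filter_upwards [coeFn_mulL2 hb C hC f] with z hz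
  rw [hz, norm_mul]
  exact mul_le_mul_of_nonneg_right (hC z) (norm_nonneg _)

/-- The pairing on a slice depends continuously on the slice. -/
theorem tendsto_integral_mul_of_lintegral {X : Type*} [MeasurableSpace X] {μ : Measure X}
    {F : ℕ → X → ℂ} {G W : X → ℂ} (hF : ∀ n, MemLp (F n) 2 μ) (hG : MemLp G 2 μ)
    (hW : MemLp W 2 μ) (h : Tendsto (fun n => ∫⁻ x, ‖F n x - G x‖ₑ ^ 2 ∂μ) atTop (𝓝 0)) :
    Tendsto (fun n => ∫ x, F n x * W x ∂μ) atTop (𝓝 (∫ x, G x * W x ∂μ)) := by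
  rw [tendsto_iff_edist_tendsto_0]
  have hb : ∀ n, edist (∫ x, F n x * W x ∂μ) (∫ x, G x * W x ∂μ) ≤
      (∫⁻ x, ‖F n x - G x‖ₑ ^ 2 ∂μ) ^ (1 / 2 : ℝ) * (∫⁻ x, ‖W x‖ₑ ^ 2 ∂μ) ^ (1 / 2 : ℝ) := fun n => by
    have i1 : Integrable (fun x => F n x * W x) μ := (hF n).integrable_mul hW
    have i2 : Integrable (fun x => G x * W x) μ := hG.integrable_mul hW
    rw [edist_eq_enorm_sub, ← integral_sub i1 i2]
    refine (enorm_integral_le_lintegral_enorm _).trans ?_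
    have h1 := ENNReal.lintegral_mul_le_Lp_mul_Lq μ (Real.HolderConjugate.two_two)
      ((hF n).sub hG).1.enorm hW.1.enorm
    simp only [ENNReal.rpow_two, Pi.mul_apply, Pi.sub_apply] at h1
    refine le_trans (lintegral_mono fun x => ?_) h1
    simp only [← sub_mul, enorm_mul, le_refl]
  have h1 : Tendsto (fun n => (∫⁻ x, ‖F n x - G x‖ₑ ^ 2 ∂μ) ^ (1 / 2 : ℝ) *
      (∫⁻ x, ‖W x‖ₑ ^ 2 ∂μ) ^ (1 / 2 : ℝ)) atTop (𝓝 0) := by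
    have h2 := (h.ennrpow_const (1 / 2 : ℝ))
    rw [ENNReal.zero_rpow_of_pos (by norm_num)] at h2
    have h3 : (∫⁻ x, ‖W x‖ₑ ^ 2 ∂μ) ^ (1 / 2 : ℝ) ≠ ⊤ := by
      rw [← eLpNorm_two_eq]; exact hW.2.ne
    simpa using ENNReal.Tendsto.mul_const h2 (Or.inr h3)
  exact tendsto_of_tendsto_of_tendsto_of_le_of_le tendsto_const_nhds h1 (fun _ => zero_le) hb

/-- Along a subsequence, almost all slices of finitely many convergent sequences in `L²` converge
weakly. -/
theorem exists_subseq_slices {J : Type*} [Finite J]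
    {F : J → ℕ → Lp ℂ 2 (volume : Measure Heis)} {G : J → Lp ℂ 2 (volume : Measure Heis)}
    (h : ∀ j, Tendsto (F j) atTop (𝓝 (G j))) :
    ∃ σ : ℕ → ℕ, ∀ᵐ l : ℝ, ∀ j, ∀ W : ℝ × ℝ → ℂ, MemLp W 2 →
      Tendsto (fun k => ∫ q, F j (σ k) (q, l) * W q) atTop (𝓝 (∫ q, G j (q, l) * W q)) := by
  have := Fintype.ofFinite J
  have hm : ∀ j n, Measurable fun p : Heis => ‖F j n p - G j p‖ₑ ^ 2 := fun j n =>
    ((measurable_coeFn _).sub (measurable_coeFn _)).enorm.pow_const 2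
  -- the squared distances
  have h1 : ∀ j, Tendsto (fun n => ∫⁻ p, ‖F j n p - G j p‖ₑ ^ 2) atTop (𝓝 0) := fun j => by
    have h2 := (Lp.tendsto_Lp_iff_tendsto_eLpNorm' _ _).1 (h j)
    have h3 := ENNReal.Tendsto.pow (n := 2) h2
    rw [zero_pow two_ne_zero] at h3
    refine h3.congr fun n => ?_
    rw [eLpNorm_two_eq, ← ENNReal.rpow_natCast, ← ENNReal.rpow_mul]
    norm_num
  have h2 : ∀ k : ℕ, ∃ n, ∀ j, ∫⁻ p, ‖F j n p - G j p‖ₑ ^ 2 ≤ (2⁻¹ : ℝ≥0∞) ^ k := fun k => by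
    have : ∀ᶠ n in atTop, ∀ j, ∫⁻ p, ‖F j n p - G j p‖ₑ ^ 2 ≤ (2⁻¹ : ℝ≥0∞) ^ k :=
      eventually_all.2 fun j => (h1 j).eventually_le_const (by
        exact ENNReal.pow_pos (by simp) k)
    exact this.exists
  choose σ hσ using h2
  refine ⟨σ, ?_⟩
  rw [ae_all_iff]
  intro j
  have h3 : ∫⁻ l : ℝ, ∑' k, ∫⁻ q : ℝ × ℝ, ‖F j (σ k) (q, l) - G j (q, l)‖ₑ ^ 2 ≠ ⊤ := by
    rw [lintegral_tsum fun k => ((hm j (σ k)).lintegral_prod_left').aemeasurable]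
    refine ne_top_of_le_ne_top ?_ (ENNReal.tsum_le_tsum fun k =>
      (lintegral_heis_symm (hm j (σ k))).symm.le.trans (hσ k j))
    rw [ENNReal.tsum_geometric]
    simp
  have h4 := ae_lt_top' (AEMeasurable.tsum fun k =>
    ((hm j (σ k)).lintegral_prod_left').aemeasurable) h3
  have h5 : ∀ᵐ l : ℝ, ∀ k, MemLp (fun q : ℝ × ℝ => F j (σ k) (q, l)) 2 :=
    ae_all_iff.2 fun k => ae_memLp_slice_left (measurable_coeFn _) (Lp.memLp _)
  filter_upwards [h4, h5, ae_memLp_slice_left (measurable_coeFn (G j)) (Lp.memLp _)]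
    with l hl1 hl2 hl3 W hW
  exact tendsto_integral_mul_of_lintegral hl2 hl3 hW
    (ENNReal.tendsto_atTop_zero_of_tsum_ne_top hl1.ne)

theorem IsTestFun.exists_slab {b : Heis → ℂ} (hb : IsTestFun b) :
    ∃ R, ∀ p : Heis, R < |p.2| → b p = 0 := by
  obtain ⟨R, hR⟩ := hb.2.isCompact.isBounded.exists_norm_le
  refine ⟨R, fun p hp => ?_⟩
  by_contra h
  have h1 := hR p (subset_tsupport _ h)
  have h2 : |p.2| ≤ ‖p‖ := norm_snd_le p
  linarith

/-- Fubini: the pairing with `e^{-ilt} W(x, y)` is the pairing of the slice of the central Fourier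
transform with `W`. The weight `W` does not depend on `t`, so bounded support in `t` is needed for
integrability. -/
theorem integral_mul_exp_mul_eq {f : Heis → ℂ} (hf : MemLp f 2) {R : ℝ}
    (hR : ∀ p : Heis, R < |p.2| → f p = 0) {W : ℝ × ℝ → ℂ} (hW : MemLp W 2) (l : ℝ) :
    ∫ p, f p * (Complex.exp (-Complex.I * (l * p.2 : ℝ)) * W p.1) =
      ∫ q, centralFT f (q, l) * W q := by
  set χ : ℝ → ℂ := (Set.Icc (-R) R).indicator fun _ => 1 with hχ
  have hχ2 : MemLp χ 2 := memLp_indicator_const 2 measurableSet_Icc 1 (Or.inr (by simp))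
  have h1 : MemLp (fun p : Heis => W p.1 * χ p.2) 2 := by
    have hm : AEStronglyMeasurable (fun p : Heis => W p.1 * χ p.2) :=
      hW.1.comp_fst.mul hχ2.1.comp_snd
    rw [memLp_two_iff_integrable_sq_norm hm]
    have := ((memLp_two_iff_integrable_sq_norm hW.1).1 hW).mul_prod
      ((memLp_two_iff_integrable_sq_norm hχ2.1).1 hχ2)
    refine this.congr (ae_of_all _ fun p => ?_)
    simp only [norm_mul, mul_pow]
  have h2 : ∀ p : Heis, f p * (Complex.exp (-Complex.I * (l * p.2 : ℝ)) * W p.1) =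
      f p * (Complex.exp (-Complex.I * (l * p.2 : ℝ)) * (W p.1 * χ p.2)) := fun p => by
    by_cases hp : R < |p.2|
    · rw [hR p hp, zero_mul, zero_mul]
    · have : p.2 ∈ Set.Icc (-R) R := abs_le.1 (not_lt.1 hp)
      rw [hχ, Set.indicator_of_mem this, mul_one]
  have h3 : Integrable fun p : Heis =>
      f p * (Complex.exp (-Complex.I * (l * p.2 : ℝ)) * W p.1) := by
    simp only [h2]
    exact hf.integrable_mul (memLp_two_mul_of_bound (C := 1) (by fun_prop)
      (fun p => (norm_exp_neg_I_mul _).le) h1)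
  rw [integral_heis h3]
  refine integral_congr_ae (ae_of_all _ fun q => ?_)
  simp only [centralFT, lineFT]
  rw [← integral_mul_const]
  refine integral_congr_ae (ae_of_all _ fun t => ?_)
  simp only; ring

/-- For a test function `b`, pairing `f` with `b e^{-ilt} W(x, y)` amounts to pairing the slice of
the central Fourier transform of `b f` with `W`. -/
theorem ae_integral_mul_exp_mul_eq {b : Heis → ℂ} (hb : IsTestFun b)
    {f f' : Lp ℂ 2 (volume : Measure Heis)} (hf' : f' =ᵐ[volume] fun p => b p * f p) :
    ∀ᵐ l : ℝ, ∀ W : ℝ × ℝ → ℂ, MemLp W 2 →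
      ∫ p, f p * (b p * (Complex.exp (-Complex.I * (l * p.2 : ℝ)) * W p.1)) =
        ∫ q, centralFourier f' (q, l) * W q := by
  obtain ⟨R, hR⟩ := hb.exists_slab
  have h2 : MemLp (fun p => b p * f p) 2 := (memLp_congr_ae hf').1 (Lp.memLp f')
  have hR' : ∀ p : Heis, R < |p.2| → b p * f p = 0 := fun p hp => by rw [hR p hp, zero_mul]
  have h3 : f' = h2.toLp _ := Lp.ext (hf'.trans h2.coeFn_toLp.symm)
  have h4 := coeFn_centralFourier_toLp h2 hR'
  rw [← h3] at h4
  filter_upwards [ae_ae_of_ae_heis_left h4] with l hl W hW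
  have h5 : ∫ q, centralFourier f' (q, l) * W q = ∫ q, centralFT (fun p => b p * f p) (q, l) * W q :=
    integral_congr_ae (by filter_upwards [hl] with q hq; rw [hq])
  rw [h5, ← integral_mul_exp_mul_eq h2 hR' hW]
  refine integral_congr_ae (ae_of_all _ fun p => ?_)
  simp only; ring

end Slices

/-! ### Diagonalisation of the Heisenberg oscillator -/

section Diagonal

variable {κ : ℝ}

theorem continuous_centralFourier : Continuous centralFourier :=
  AddMonoidHomClass.continuous_of_bound centralFourier (√(2 * Real.pi))
    fun f => (norm_centralFourier f).le

theorem tendsto_mulL2_zero {Z : Type*} [MeasurableSpace Z] {μ : Measure Z} {b : ℕ → Z → ℂ}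
    (hb : ∀ n, Measurable (b n)) {C : ℝ} (hC : ∀ n z, ‖b n z‖ ≤ C / (n + 1)) (f : Lp ℂ 2 μ) :
    Tendsto (fun n : ℕ => mulL2 (b n) (hb n) (C / (n + 1)) (hC n) f) atTop (𝓝 0) := by
  refine squeeze_zero_norm (fun n => norm_mulL2_apply_le (hb n) (hC n) f) ?_
  have h : Tendsto (fun n : ℕ => C * (1 / ((n : ℝ) + 1)) * ‖f‖) atTop (𝓝 (C * 0 * ‖f‖)) :=
    (tendsto_one_div_add_atTop_nhds_zero_nat.const_mul C).mul_const _
  simpa [div_eq_mul_inv] using h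

/-- The conjugate of the eigenfunction `e^{ilt} T_λ h_{λ,m}` of the differential expression, and
its derivatives along the vector fields. -/
theorem exists_eigenfunction (hκ : κ ≠ 0) (l : ℝ) (m : ℕ × ℕ) :
    ∃ (V : Heis → ℂ) (W1 W2 : ℝ × ℝ → ℂ), ContDiff ℝ ∞ V ∧ MemLp W1 2 ∧ MemLp W2 2 ∧
      (∀ p, V p = Complex.exp (-Complex.I * (l * p.2 : ℝ)) * conj (thEig l κ m p.1)) ∧
      (∀ p, heisX V p = Complex.exp (-Complex.I * (l * p.2 : ℝ)) * W1 p.1) ∧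
      (∀ p, heisY V p = Complex.exp (-Complex.I * (l * p.2 : ℝ)) * W2 p.1) ∧
      ∀ p, heisOscExpr κ V p = nuEig l κ m * V p := by
  obtain ⟨a, b, c, w, w1, w11, w2, w22, hneg, f, f1, f2, hth, d1, d11, d2, d22, heq⟩ :=
    exists_thEig_eigen hκ l m
  have e : ∀ (u : ℝ × ℝ → ℂ) (p : Heis), twist (-l) u p =
      Complex.exp (-Complex.I * (l * p.2 : ℝ)) *
        (Complex.exp (Complex.I * (-(l / 2 * p.1.1 * p.1.2) : ℝ)) * u p.1) := fun u p => by
    rw [← mul_assoc, ← Complex.exp_add, twist]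
    congr 2; push_cast; ring
  have hmem : ∀ u : ℝ × ℝ → ℂ, MemLp u 2 →
      MemLp (fun q : ℝ × ℝ => Complex.exp (Complex.I * (-(l / 2 * q.1 * q.2) : ℝ)) * u q) 2 :=
    fun u hu => memLp_two_mul_of_bound (C := 1) (by fun_prop) (fun q => (norm_exp_I_mul _).le) hu
  have c1 : ∀ x y, HasDerivAt (fun s : ℝ => conj (w (s, y))) (conj (w1 (x, y))) x :=
    fun x y => (d1 x y).star
  have c11 : ∀ x y, HasDerivAt (fun s : ℝ => conj (w1 (s, y))) (conj (w11 (x, y))) x :=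
    fun x y => (d11 x y).star
  have c2 : ∀ x y, HasDerivAt (fun s : ℝ => conj (w (x, s))) (conj (w2 (x, y))) y :=
    fun x y => (d2 x y).star
  have c22 : ∀ x y, HasDerivAt (fun s : ℝ => conj (w2 (x, s))) (conj (w22 (x, y))) y :=
    fun x y => (d22 x y).star
  have hW2 : MemLp (fun q : ℝ × ℝ => conj (w2 q) + Complex.I * (-l : ℝ) * q.1 * conj (w q)) 2 := by
    have h1 := ((f2.add (f.fst_mul.const_mul (Complex.I * l))).memLp_two hneg).star
    convert h1 using 2 with q
    simp only [Pi.star_apply, star_add, star_mul', RCLike.star_def, Complex.conj_I,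
      Complex.conj_ofReal]
    push_cast; ring
  refine ⟨twist (-l) fun q => conj (w q), _, _,
    (Complex.conjCLE.contDiff.comp f.contDiff).twist (-l), hmem _ (f1.memLp_two hneg).star,
    hmem _ hW2, fun p => ?_, fun p => ?_, fun p => ?_,
    heisOscExpr_twist (w := fun q => conj (w q)) (w1 := fun q => conj (w1 q))
      (w11 := fun q => conj (w11 q)) (w2 := fun q => conj (w2 q)) (w22 := fun q => conj (w22 q))
      c1 c11 c2 c22 fun q => ?_⟩
  · rw [e, hth, map_mul, ← Complex.exp_conj, map_mul, Complex.conj_I, Complex.conj_ofReal,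
      Complex.ofReal_neg, mul_neg, ← neg_mul]
  · rw [heisX_twist (-l) (w := fun q => conj (w q)) (w1 := fun q => conj (w1 q)) c1, e]
    rfl
  · rw [heisY_twist (-l) (w := fun q => conj (w q)) (w2 := fun q => conj (w2 q)) c2, e]
  · have h1 := congrArg conj (heq q)
    simp only [map_add, map_neg, map_sub, map_mul, map_pow, Complex.conj_I, Complex.conj_ofReal,
      map_ofNat] at h1
    push_cast
    linear_combination h1

/-- If `A f = g` in the sense of distributions, then `c_{λ,m}(g) = ν_{λ,m} c_{λ,m}(f)`. The
eigenfunction `e^{-ilt} conj (T_λ h_{λ,m})` is not a test function, so it is multiplied by cut-offs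
`η_n`. The terms with derivatives of `η_n` tend to zero, but only in `L²` after the Fourier
transform; to evaluate them at a fixed frequency one passes to a subsequence along which almost all
slices converge. -/
theorem ae_cCoeff_of_mem_heisOscGraph (hκ : κ ≠ 0) {f g : Lp ℂ 2 (volume : Measure Heis)}
    (h : (f, g) ∈ heisOscGraph κ) :
    ∀ᵐ l : ℝ, ∀ m, cCoeff (centralFourier g) l κ m =
      nuEig l κ m * cCoeff (centralFourier f) l κ m := by
  obtain ⟨η, hη, hη1, hlim, C, hC⟩ := exists_cutoff
  have hL : ∀ n, IsTestFun fun p => heisX (heisX (η n)) p + heisY (heisY (η n)) p := fun n =>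
    ⟨(hη n).heisX.heisX.1.add (hη n).heisY.heisY.1, (hη n).heisX.heisX.2.add (hη n).heisY.heisY.2⟩
  have m0 : ∀ n, Measurable (η n) := fun n => (hη n).1.continuous.measurable
  have m1 : ∀ n, Measurable (heisX (η n)) := fun n => (hη n).heisX.1.continuous.measurable
  have m2 : ∀ n, Measurable (heisY (η n)) := fun n => (hη n).heisY.1.continuous.measurable
  have m3 : ∀ n, Measurable fun p => heisX (heisX (η n)) p + heisY (heisY (η n)) p :=
    fun n => (hL n).1.continuous.measurable
  set f0 := fun n => mulL2 (η n) (m0 n) 1 (hη1 n) f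
  set f1 := fun n : ℕ => mulL2 (heisX (η n)) (m1 n) (C / (n + 1)) (fun p => (hC n p).1) f
  set f2 := fun n : ℕ => mulL2 (heisY (η n)) (m2 n) (C / (n + 1)) (fun p => (hC n p).2.1) f
  set f3 := fun n : ℕ => mulL2 (fun p => heisX (heisX (η n)) p + heisY (heisY (η n)) p) (m3 n)
    (C / (n + 1)) (fun p => (hC n p).2.2) f
  set f4 := fun n => mulL2 (η n) (m0 n) 1 (hη1 n) g
  have t0 : Tendsto f0 atTop (𝓝 f) := tendsto_mul_of_tendsto_one m0 hη1 hlim f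
  have t1 : Tendsto f1 atTop (𝓝 0) := tendsto_mulL2_zero m1 (fun n p => (hC n p).1) f
  have t2 : Tendsto f2 atTop (𝓝 0) := tendsto_mulL2_zero m2 (fun n p => (hC n p).2.1) f
  have t3 : Tendsto f3 atTop (𝓝 0) := tendsto_mulL2_zero m3 (fun n p => (hC n p).2.2) f
  have t4 : Tendsto f4 atTop (𝓝 g) := tendsto_mul_of_tendsto_one m0 hη1 hlim g
  have ht : ∀ {a : ℕ → Lp ℂ 2 (volume : Measure Heis)} {b}, Tendsto a atTop (𝓝 b) →
      Tendsto (fun n => centralFourier (a n)) atTop (𝓝 (centralFourier b)) := fun h =>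
    (continuous_centralFourier.tendsto _).comp h
  obtain ⟨σ, hσ⟩ := exists_subseq_slices
    (F := ![fun n => centralFourier (f0 n), fun n => centralFourier (f1 n),
      fun n => centralFourier (f2 n), fun n => centralFourier (f3 n), fun n => centralFourier (f4 n)])
    (G := ![centralFourier f, centralFourier 0, centralFourier 0, centralFourier 0,
      centralFourier g]) (by
      intro j
      fin_cases j
      exacts [ht t0, ht t1, ht t2, ht t3, ht t4])
  have p0 := ae_all_iff.2 fun n => ae_integral_mul_exp_mul_eq (hη n)
    (coeFn_mulL2 (m0 n) 1 (hη1 n) f)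
  have p1 := ae_all_iff.2 fun n : ℕ => ae_integral_mul_exp_mul_eq (hη n).heisX
    (coeFn_mulL2 (m1 n) (C / (n + 1)) (fun p => (hC n p).1) f)
  have p2 := ae_all_iff.2 fun n : ℕ => ae_integral_mul_exp_mul_eq (hη n).heisY
    (coeFn_mulL2 (m2 n) (C / (n + 1)) (fun p => (hC n p).2.1) f)
  have p3 := ae_all_iff.2 fun n : ℕ => ae_integral_mul_exp_mul_eq (hL n)
    (coeFn_mulL2 (m3 n) (C / (n + 1)) (fun p => (hC n p).2.2) f)
  have p4 := ae_all_iff.2 fun n => ae_integral_mul_exp_mul_eq (hη n)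
    (coeFn_mulL2 (m0 n) 1 (hη1 n) g)
  filter_upwards [hσ, p0, p1, p2, p3, p4,
    ae_ae_of_ae_heis_left (Lp.coeFn_zero ℂ 2 (volume : Measure Heis))]
    with l hl q0 q1 q2 q3 q4 hz m
  obtain ⟨V, W1, W2, hV, hW1, hW2, eV, eX, eY, hA⟩ := exists_eigenfunction hκ l m
  set W0 : ℝ × ℝ → ℂ := fun q => conj (thEig l κ m q) with hW0d
  have hW0 : MemLp W0 2 := (memLp_thEig hκ l m).star
  have hz' : ∀ W : ℝ × ℝ → ℂ,
      ∫ q, (centralFourier 0 : Lp ℂ 2 (volume : Measure Heis)) (q, l) * W q = 0 := fun W => by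
    rw [map_zero]
    refine integral_eq_zero_of_ae ?_
    filter_upwards [hz] with q hq
    rw [hq]; simp
  have l0 := hl 0 W0 hW0
  have l1 := hl 1 W1 hW1
  have l2 := hl 2 W2 hW2
  have l3 := hl 3 W0 hW0
  have l4 := hl 4 W0 hW0
  simp only [Matrix.cons_val] at l0 l1 l2 l3 l4
  rw [hz'] at l1 l2 l3
  -- the test function `η_n V` gives the equation up to terms that vanish in the limit
  have key : ∀ n, nuEig l κ m * (∫ q, centralFourier (f0 n) (q, l) * W0 q) -
      2 * (∫ q, centralFourier (f1 n) (q, l) * W1 q) -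
      2 * (∫ q, centralFourier (f2 n) (q, l) * W2 q) -
      (∫ q, centralFourier (f3 n) (q, l) * W0 q) =
      ∫ q, centralFourier (f4 n) (q, l) * W0 q := fun n => by
    rw [← q0 n W0 hW0, ← q1 n W1 hW1, ← q2 n W2 hW2, ← q3 n W0 hW0, ← q4 n W0 hW0]
    have h1 := h _ ((hη n).mul_contDiff hV)
    simp only [hW0d, ← eV, ← eX, ← eY]
    rw [← h1]
    have i0 := ((hη n).mul_contDiff hV).integrable_mul f
    have i1 := ((hη n).heisX.mul_contDiff hV.heisX).integrable_mul f
    have i2 := ((hη n).heisY.mul_contDiff hV.heisY).integrable_mul f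
    have i3 := ((hL n).mul_contDiff hV).integrable_mul f
    have j1 := (i0.const_mul (nuEig l κ m : ℂ)).sub (i1.const_mul 2)
    have j2 := j1.sub (i2.const_mul 2)
    have e1 := (integral_sub j2 i3).symm
    have e2 := integral_sub j1 (i2.const_mul 2)
    have e3 := integral_sub (i0.const_mul (nuEig l κ m : ℂ)) (i1.const_mul 2)
    rw [integral_const_mul, integral_const_mul] at e3
    rw [integral_const_mul] at e2
    refine Eq.trans ?_ (e1.trans (integral_congr_ae (ae_of_all _ fun p => ?_)))
    · exact congrArg₂ (· - ·) (e2.trans (congrArg₂ (· - ·) e3 rfl)).symm rfl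
    simp only [Pi.sub_apply]
    rw [heisOscExpr_mul κ (hη n).1 hV, hA]
    ring
  have lim := (((l0.const_mul (nuEig l κ m : ℂ)).sub (l1.const_mul 2)).sub (l2.const_mul 2)).sub l3
  simp only [key, mul_zero, sub_zero] at lim
  exact tendsto_nhds_unique l4 lim

/-- The unitary operator that diagonalises the Heisenberg oscillator, `f ↦ (2π)^{-1/2} c_{λ,m}(f)`. -/
def oscUnitary (hκ : κ ≠ 0) : Lp ℂ 2 (volume : Measure Heis) ≃ₗᵢ[ℂ] Lp ℂ 2 specMeasure :=
  centralUnitary.trans (coeffUnitary hκ)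

theorem coeFn_oscUnitary (hκ : κ ≠ 0) (f : Lp ℂ 2 (volume : Measure Heis)) :
    oscUnitary hκ f =ᵐ[specMeasure] fun z =>
      ((√(2 * Real.pi))⁻¹ : ℂ) * cCoeff (centralFourier f) z.2 κ z.1 := by
  have h1 : oscUnitary hκ f = ((√(2 * Real.pi))⁻¹ : ℂ) • coeffIsometry hκ (centralFourier f) := by
    rw [← map_smul, ← centralUnitary_apply]; rfl
  rw [h1]
  filter_upwards [Lp.coeFn_smul ((√(2 * Real.pi))⁻¹ : ℂ) (coeffIsometry hκ (centralFourier f)),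
    coeFn_coeffIsometry hκ (centralFourier f)] with z h2 h3
  rw [h2, Pi.smul_apply, h3, smul_eq_mul]

theorem coeFn_oscUnitary_of_mem_heisOscGraph (hκ : κ ≠ 0) {f g : Lp ℂ 2 (volume : Measure Heis)}
    (h : (f, g) ∈ heisOscGraph κ) :
    oscUnitary hκ g =ᵐ[specMeasure] fun z => (nuEig z.2 κ z.1 : ℂ) * oscUnitary hκ f z := by
  have h1 : ∀ᵐ z ∂specMeasure, cCoeff (centralFourier g) z.2 κ z.1 =
      nuEig z.2 κ z.1 * cCoeff (centralFourier f) z.2 κ z.1 :=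
    ae_specMeasure_iff.2 fun m => by
      filter_upwards [ae_cCoeff_of_mem_heisOscGraph hκ h] with l hl
      exact hl m
  filter_upwards [h1, coeFn_oscUnitary hκ f, coeFn_oscUnitary hκ g] with z h2 h3 h4
  rw [h3, h4, h2]; ring

theorem toLp_mem_heisOscGraph {φ : Heis → ℂ} (hφ : IsTestFun φ) :
    (hφ.memLp.toLp φ, (hφ.heisOscExpr κ).memLp.toLp (heisOscExpr κ φ)) ∈ heisOscGraph κ := by
  intro ψ hψ
  have h1 : ∫ p, hφ.memLp.toLp φ p * heisOscExpr κ ψ p = ∫ p, φ p * heisOscExpr κ ψ p :=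
    integral_congr_ae (by filter_upwards [hφ.memLp.coeFn_toLp] with p hp; rw [hp])
  have h2 : ∫ p, (hφ.heisOscExpr κ).memLp.toLp (heisOscExpr κ φ) p * ψ p =
      ∫ p, heisOscExpr κ φ p * ψ p :=
    integral_congr_ae (by
      filter_upwards [(hφ.heisOscExpr κ).memLp.coeFn_toLp] with p hp; rw [hp])
  exact h1.trans ((integral_heisOscExpr_mul κ hφ hψ).trans h2.symm)

/-- One direction is the computation of the coefficients of `A f`. For the converse, if the
coefficients of `g` are `ν` times those of `f`, then `(g, φ) = (f, A φ)` for every test function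
`φ`, since `φ` belongs to the domain and its coefficients are known by the first direction; so `A f
= g` in the sense of distributions. -/
theorem isDiagonalizedBy_heisOsc (hκ : κ ≠ 0) :
    IsDiagonalizedBy (heisOsc κ) (oscUnitary hκ) fun z => nuEig z.2 κ z.1 := by
  intro f g
  rw [heisOsc_graph]
  refine ⟨coeFn_oscUnitary_of_mem_heisOscGraph hκ, fun h φ hφ => ?_⟩
  have h1 := coeFn_oscUnitary_of_mem_heisOscGraph hκ (toLp_mem_heisOscGraph (κ := κ) hφ.conj)
  set a := hφ.conj.memLp.toLp _ with ha
  set b := (hφ.conj.heisOscExpr κ).memLp.toLp _ with hb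
  have e1 : ∫ p, f p * heisOscExpr κ φ p = ⟪b, f⟫_ℂ := by
    rw [L2.inner_def]
    refine integral_congr_ae ?_
    filter_upwards [(hφ.conj.heisOscExpr κ).memLp.coeFn_toLp] with p hp
    rw [RCLike.inner_apply, hb, hp, heisOscExpr_conj, Complex.conj_conj]
  have e2 : ∫ p, g p * φ p = ⟪a, g⟫_ℂ := by
    rw [L2.inner_def]
    refine integral_congr_ae ?_
    filter_upwards [hφ.conj.memLp.coeFn_toLp] with p hp
    rw [RCLike.inner_apply, ha, hp, Complex.conj_conj]
  change ∫ p, f p * heisOscExpr κ φ p = ∫ p, g p * φ p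
  rw [e1, e2, inner_eq_integral_of_isometry (oscUnitary hκ),
    inner_eq_integral_of_isometry (oscUnitary hκ)]
  refine integral_congr_ae ?_
  filter_upwards [h, h1] with z h2 h3
  rw [h2, h3, map_mul, Complex.conj_ofReal]
  ring

end Diagonal

/-! ### The eigenvalues -/

section Eigenvalues

variable {κ : ℝ}

/-- The square is `μ₊ + μ₋ + 2 √(μ₊ μ₋)`, and `μ₊ μ₋ = κ⁴`. -/
theorem sqrt_muEig_add_sqrt_muEig (l κ : ℝ) :
    √(muEig 1 l κ) + √(muEig (-1) l κ) = √(l ^ 2 + 4 * κ ^ 2) := by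
  have hS := Real.sq_sqrt (show 0 ≤ l ^ 2 + 4 * κ ^ 2 by positivity)
  have hl := sq_abs l
  have hp : 0 ≤ muEig 1 l κ := by unfold muEig; positivity
  have hprod : muEig 1 l κ * muEig (-1) l κ = (κ ^ 2) ^ 2 := by
    unfold muEig
    linear_combination (-l ^ 2 / 4) * hS - √(l ^ 2 + 4 * κ ^ 2) ^ 2 / 4 * hl
  have hm : 0 ≤ muEig (-1) l κ := by
    have h1 : |l| * √(l ^ 2 + 4 * κ ^ 2) ≤ l ^ 2 + 2 * κ ^ 2 := by
      refine abs_le_of_sq_le_sq' ?_ (by positivity) |>.2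
      rw [mul_pow, hl, hS]
      nlinarith [sq_nonneg (κ ^ 2)]
    unfold muEig
    linarith
  have hsq : √(muEig 1 l κ) * √(muEig (-1) l κ) = κ ^ 2 := by
    rw [← Real.sqrt_mul hp, hprod, Real.sqrt_sq (sq_nonneg κ)]
  rw [eq_comm, Real.sqrt_eq_iff_mul_self_eq (by positivity) (by positivity), ← sq, add_sq,
    mul_assoc, hsq, Real.sq_sqrt hp, Real.sq_sqrt hm]
  unfold muEig
  ring

theorem nuEig_zero (l κ : ℝ) : nuEig l κ (0, 0) = √(l ^ 2 + 4 * κ ^ 2) := by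
  rw [← sqrt_muEig_add_sqrt_muEig, nuEig]
  simp

theorem nuEig_zero_zero (κ : ℝ) : nuEig 0 κ (0, 0) = 2 * |κ| := by
  rw [nuEig_zero, show (0 : ℝ) ^ 2 + 4 * κ ^ 2 = (2 * κ) ^ 2 by ring, Real.sqrt_sq_eq_abs, abs_mul,
    abs_two]

theorem two_mul_abs_le_nuEig (l κ : ℝ) (m : ℕ × ℕ) : 2 * |κ| ≤ nuEig l κ m := by
  have h1 : nuEig 0 κ (0, 0) ≤ nuEig l κ (0, 0) := by
    rw [nuEig_zero, nuEig_zero]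
    exact Real.sqrt_le_sqrt (by nlinarith [sq_nonneg l])
  have h2 : nuEig l κ (0, 0) ≤ nuEig l κ m := by
    unfold nuEig
    refine add_le_add (mul_le_mul_of_nonneg_left ?_ (Real.sqrt_nonneg _))
      (mul_le_mul_of_nonneg_left ?_ (Real.sqrt_nonneg _)) <;> simp
  rw [← nuEig_zero_zero]
  exact h1.trans h2

/-- The values for `m = 0` already fill the half-line, as `ν_{λ,0} = √(λ₁² + 4κ²)`. -/
theorem setOf_nuEig_eq_Ici (κ : ℝ) :
    {s : ℝ | ∃ (l : ℝ) (m : ℕ × ℕ), s = nuEig l κ m} = Set.Ici (nuEig 0 κ (0, 0)) := by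
  rw [nuEig_zero_zero]
  ext s
  simp only [Set.mem_ofPred_eq, Set.mem_Ici]
  constructor
  · rintro ⟨l, m, rfl⟩
    exact two_mul_abs_le_nuEig l κ m
  · intro hs
    have hs0 : 0 ≤ s := by linarith [abs_nonneg κ]
    have h1 : 0 ≤ s ^ 2 - 4 * κ ^ 2 := by
      have := pow_le_pow_left₀ (by positivity) hs 2
      rw [mul_pow, sq_abs] at this
      linarith
    refine ⟨√(s ^ 2 - 4 * κ ^ 2), (0, 0), ?_⟩
    rw [nuEig_zero, Real.sq_sqrt h1, sub_add_cancel, Real.sqrt_sq hs0]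

theorem measurable_nuEig (κ : ℝ) : Measurable fun z : (ℕ × ℕ) × ℝ => nuEig z.2 κ z.1 :=
  measurable_from_prod_countable_right fun m => (continuous_nuEig κ m).measurable

/-- Every value of `ν` is an essential value, by continuity in `λ₁`. -/
theorem specMeasure_nuEig_ne_zero (l κ : ℝ) (m : ℕ × ℕ) {ε : ℝ} (hε : 0 < ε) :
    specMeasure {z | |nuEig z.2 κ z.1 - nuEig l κ m| < ε} ≠ 0 := by
  set U : Set ℝ := {l' | |nuEig l' κ m - nuEig l κ m| < ε}
  have hU : IsOpen U := isOpen_lt (by have := continuous_nuEig κ m; fun_prop) continuous_const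
  have hsub : ({m} : Set (ℕ × ℕ)) ×ˢ U ⊆ {z | |nuEig z.2 κ z.1 - nuEig l κ m| < ε} := by
    rintro ⟨m', l'⟩ ⟨h1, h2⟩
    obtain rfl : m' = m := h1
    exact h2
  have h1 : specMeasure (({m} : Set (ℕ × ℕ)) ×ˢ U) ≠ 0 := by
    rw [Measure.prod_prod, Measure.count_singleton, one_mul]
    exact (hU.measure_pos volume ⟨l, by simpa [U] using hε⟩).ne'
  exact fun h0 => h1 (measure_mono_null hsub h0)

end Eigenvalues

/-! ### The spectral projections -/

section SpectralProj

variable {κ : ℝ} {B : Set ℝ}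

/-- Multiplication by the indicator function of `{ν ∈ B}`. -/
def specCut (κ : ℝ) {B : Set ℝ} (hB : MeasurableSet B) :
    Lp ℂ 2 specMeasure →L[ℂ] Lp ℂ 2 specMeasure :=
  mulL2 (((fun z : (ℕ × ℕ) × ℝ => nuEig z.2 κ z.1) ⁻¹' B).indicator fun _ => 1)
    (measurable_const.indicator (measurable_nuEig κ hB)) 1
    (fun z => by
      by_cases h : z ∈ (fun z : (ℕ × ℕ) × ℝ => nuEig z.2 κ z.1) ⁻¹' B <;> simp [h])

theorem coeFn_specCut (hB : MeasurableSet B) (φ : Lp ℂ 2 specMeasure) :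
    specCut κ hB φ =ᵐ[specMeasure]
      ((fun z : (ℕ × ℕ) × ℝ => nuEig z.2 κ z.1) ⁻¹' B).indicator φ := by
  refine (coeFn_mulL2 _ _ _ φ).trans (ae_of_all _ fun z => ?_)
  by_cases h : z ∈ (fun z : (ℕ × ℕ) × ℝ => nuEig z.2 κ z.1) ⁻¹' B <;> simp [h]

/-- The expansion of a function in its components `φ_m(λ₁) T_λ h_{λ,m}`. -/
theorem hasSum_mul_thEig (hκ : κ ≠ 0) (φ : Lp ℂ 2 specMeasure) :
    HasSum (fun m => (memLp_mul_thEig hκ m φ).toLp _) ((coeffUnitary hκ).symm φ) := by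
  have h : HasSum (fun m => coeffUnitary hκ ((memLp_mul_thEig hκ m φ).toLp _)) φ :=
    hasSum_of_ae_eq_indicator (S := fun m : ℕ × ℕ => Prod.fst ⁻¹' {m})
      (fun m => measurable_fst (measurableSet_singleton m))
      (fun m n h => (Set.disjoint_singleton.2 h).preimage _)
      (fun m => coeffIsometry_mul_thEig hκ m φ)
      (by rw [← Set.preimage_iUnion, Set.iUnion_of_singleton, Set.preimage_univ,
        Set.indicator_univ])
  simpa [Function.comp_def] using
    h.map (coeffUnitary hκ).symm (coeffUnitary hκ).symm.continuous

open Classical in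
/-- The components of the cut coefficient function are the terms of the series that defines `E(B)`.
-/
theorem mul_thEig_ae_eq (hκ : κ ≠ 0) (hB : MeasurableSet B) (F : Lp ℂ 2 (volume : Measure Heis))
    (m : ℕ × ℕ) :
    (memLp_mul_thEig hκ m (specCut κ hB (coeffUnitary hκ F))).toLp _ =ᵐ[volume] fun p : Heis =>
      if nuEig p.2 κ m ∈ B then cCoeff F p.2 κ m * thEig p.2 κ m p.1 else 0 := by
  have h1 := ae_specMeasure_iff.1 ((coeFn_specCut (κ := κ) hB (coeffUnitary hκ F))) m
  have h2 := ae_specMeasure_iff.1 (coeFn_coeffIsometry hκ F) m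
  filter_upwards [(memLp_mul_thEig hκ m (specCut κ hB (coeffUnitary hκ F))).coeFn_toLp,
    ae_heis_of_ae_snd h1, ae_heis_of_ae_snd h2] with p h3 h4 h5
  rw [h3, h4]
  have h6 : coeffUnitary hκ F (m, p.2) = cCoeff F p.2 κ m := h5
  by_cases h : nuEig p.2 κ m ∈ B
  · rw [if_pos h, Set.indicator_of_mem (by exact h), h6]
  · rw [if_neg h, Set.indicator_of_notMem (by exact h), zero_mul]

theorem oscUnitary_eq (hκ : κ ≠ 0) (f : Lp ℂ 2 (volume : Measure Heis)) :
    oscUnitary hκ f = ((√(2 * Real.pi))⁻¹ : ℂ) • coeffUnitary hκ (centralFourier f) := by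
  rw [← map_smul, ← centralUnitary_apply]; rfl

/-- `P` satisfies the series formula for `E(B)` if and only if it is diagonalised to the
multiplication by the indicator function of `{ν ∈ B}`. -/
theorem isSpectralProj_iff (hκ : κ ≠ 0) (hB : MeasurableSet B)
    (P : Lp ℂ 2 (volume : Measure Heis) →L[ℂ] Lp ℂ 2 (volume : Measure Heis)) :
    IsSpectralProj κ B P ↔ ∀ f, oscUnitary hκ (P f) = specCut κ hB (oscUnitary hκ f) := by
  have hc : ((√(2 * Real.pi))⁻¹ : ℂ) ≠ 0 := by
    have : (0 : ℝ) < √(2 * Real.pi) := by positivity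
    exact inv_ne_zero (Complex.ofReal_ne_zero.2 this.ne')
  have key : ∀ f, oscUnitary hκ (P f) = specCut κ hB (oscUnitary hκ f) ↔
      centralFourier (P f) = (coeffUnitary hκ).symm
        (specCut κ hB (coeffUnitary hκ (centralFourier f))) := fun f => by
    rw [oscUnitary_eq, oscUnitary_eq, map_smul, (smul_right_injective _ hc).eq_iff]
    exact ⟨fun h => by rw [← h, LinearIsometryEquiv.symm_apply_apply],
      fun h => by rw [h, LinearIsometryEquiv.apply_symm_apply]⟩
  simp only [key]
  refine forall_congr' fun f => ⟨?_, fun h => ?_⟩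
  · rintro ⟨F, G, hF, hG, u, hu, hsum⟩
    rw [isCentralFourier_iff] at hF hG
    subst hF hG
    have hu' : u = fun m => (memLp_mul_thEig hκ m
        (specCut κ hB (coeffUnitary hκ (centralFourier f)))).toLp _ :=
      funext fun m => Lp.ext ((hu m).trans (mul_thEig_ae_eq hκ hB (centralFourier f) m).symm)
    rw [hu'] at hsum
    exact hsum.unique (hasSum_mul_thEig hκ _)
  · refine ⟨centralFourier f, centralFourier (P f), (isCentralFourier_iff _ _).2 rfl,
      (isCentralFourier_iff _ _).2 rfl, _, mul_thEig_ae_eq hκ hB (centralFourier f), ?_⟩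
    rw [h]
    exact hasSum_mul_thEig hκ _

theorem existsUnique_isSpectralProj (hκ : κ ≠ 0) (hB : MeasurableSet B) :
    ∃! P : Lp ℂ 2 (volume : Measure Heis) →L[ℂ] Lp ℂ 2 (volume : Measure Heis),
      IsSpectralProj κ B P := by
  simp only [isSpectralProj_iff hκ hB]
  refine ⟨((oscUnitary hκ).symm.toContinuousLinearEquiv : _ →L[ℂ] _) ∘L specCut κ hB ∘L
    ((oscUnitary hκ).toContinuousLinearEquiv : _ →L[ℂ] _), fun f => ?_, fun P hP => ?_⟩
  · exact (oscUnitary hκ).apply_symm_apply _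
  · refine ContinuousLinearMap.ext fun f => (oscUnitary hκ).injective ?_
    rw [hP]
    exact ((oscUnitary hκ).apply_symm_apply _).symm

end SpectralProj

end

theorem mainTheorem1 (κ : ℝ) (hκ : κ ≠ 0) :
    IsSelfAdjoint (heisOsc κ) ∧
    (∀ B : Set ℝ, MeasurableSet B →
      ∃! P : Lp ℂ 2 (volume : Measure Heis) →L[ℂ] Lp ℂ 2 (volume : Measure Heis),
        IsSpectralProj κ B P) ∧
    (∀ E : Set ℝ → (Lp ℂ 2 (volume : Measure Heis) →L[ℂ] Lp ℂ 2 (volume : Measure Heis)),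
      (∀ B : Set ℝ, MeasurableSet B → IsSpectralProj κ B (E B)) →
        IsSpectralResolution E (heisOsc κ)) ∧
    spectrumPMap (heisOsc κ) =
      Complex.ofReal '' {s : ℝ | ∃ (l : ℝ) (m : ℕ × ℕ), s = nuEig l κ m} ∧
    {s : ℝ | ∃ (l : ℝ) (m : ℕ × ℕ), s = nuEig l κ m} = Set.Ici (nuEig 0 κ (0, 0)) ∧
    nuEig 0 κ (0, 0) = 2 * |κ| := by
  have hdiag := isDiagonalizedBy_heisOsc hκ
  have hν := measurable_nuEig κ
  refine ⟨hdiag.isSelfAdjoint hν (show 0 < 2 * |κ| by positivity)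
    (fun z => two_mul_abs_le_nuEig z.2 κ z.1), fun B hB => existsUnique_isSpectralProj hκ hB,
    fun E hE => hdiag.isSpectralResolution hν fun B hB f => ?_,
    hdiag.spectrum_eq hν ?_ (fun z => ⟨z.2, z.1, rfl⟩) ?_, setOf_nuEig_eq_Ici κ, nuEig_zero_zero κ⟩
  · rw [(isSpectralProj_iff hκ hB (E B)).1 (hE B hB) f]
    exact coeFn_specCut hB _
  · rw [setOf_nuEig_eq_Ici]
    exact isClosed_Ici
  · rintro s ⟨l, m, rfl⟩ ε hε
    exact specMeasure_nuEig_ne_zero l κ m hε
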